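/- Let $K$ be a field, let $\mathbb X\subseteq\mathbb P^n_K$ be a (non-empty) $0$-dimensional closed subscheme with homogeneous vanishing ideal $I_{\mathbb X}\subseteq P=K[X_0,\dots,X_n]$ (homogeneous and saturated), and suppose that no point of $\mathbb X$ lies on the hyperplane $X_0=0$. Let $R=P/I_{\mathbb X}$ be its homogeneous coordinate ring, $x_i$ the image of $X_i$ in $R$, $S=R/\langle x_0-1\rangle$ its affine coordinate ring, and $\deg(\mathbb X)=\dim_K S$; assume that $\operatorname{char}K=0$ or $\operatorname{char}K>\deg(\mathbb X)$. Let $p_1,\dots,p_s$ be the closed points of $\mathbb X$ (the maximal ideals of $S$), with local rings $\mathcal O_{\mathbb X,p_j}$, residue fields $K(p_j)$ and $\kappa_j=\dim_K K(p_j)$. Let $\mathbb X_{\rm ci}$ be the set of complete intersection points, i.e. of those $p_j$ for which the local ring $\mathcal O_{\mathbb X,p_j}$ is a complete intersection: the kernel of the surjection $\mathcal O_{\mathbb A^n,p_j}=K[X_1,\dots,X_n]_{\mathfrak m_j}\to\mathcal O_{\mathbb X,p_j}$ is generated by a regular sequence of length $n$, where $\mathfrak m_j$ is the maximal ideal of $p_j$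 in $K[X_1,\dots,X_n]$. Let $\vartheta_{\mathbb X}=F_0(\Omega^1_{R/K[x_0]})\subseteq R$ be the Kähler different, that is, the initial Fitting ideal of the module of Kähler differentials of $R$ over $K[x_0]$. For a finitely generated graded $R$-module $M$ let $\operatorname{HF}_M(i)=\dim_K M_i$ $(i\in\mathbb Z)$ be its Hilbert function, $\operatorname{HP}_M$ its Hilbert polynomial, and let $\operatorname{ri}(M)$ be the least $i\in\mathbb Z$ with $\operatorname{HF}_M(j)=\operatorname{HP}_M(j)$ for all $j\ge i$ (with $\operatorname{ri}(M)=-\infty$ if they agree on all of $\mathbb Z$). Put $r_{\mathbb X}=\operatorname{ri}(R)$, which is an integer. Then $$\operatorname{HP}_{\vartheta_{\mathbb X}}=\sum_{p_j\in\mathbb X_{\rm ci}}\dim_K K(p_j)=\sum_{p_j\in\mathbb X_{\rm ci}}\kappa_j \qquad\text{and}\qquad \operatorname{ri}(\vartheta_{\mathbb X})\le (n+1)\,r_{\mathbb X}.$$ Moreover, if $n=1$, then $\operatorname{ri}(\vartheta_{\mathbb X})=r_{\mathbb X}+\sum_{p_j\in\mathbb X_{\rm ci}}\kappa_j-1$;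 and if $n\ge2$ and all points $p_j\in\mathbb X_{\rm ci}$ are reduced (i.e. $\mathcal O_{\mathbb X,p_j}$ is reduced), then $\operatorname{ri}(\vartheta_{\mathbb X})\le n\,r_{\mathbb X}$. -/

import Mathlib

noncomputable section

/-- The initial Fitting ideal `F₀(M)` of an `R`-module `M`: the ideal generated by the maximal minors
of the relation matrices of `M`, that is, by the determinants of the square matrices whose rows are
relations of a finite system of generators `m₁, …, m_k` of `M`. For a finitely generated module the
ideal obtained from one system of generators is the same for every system, so that letting all of
them contribute does not change it. -/
def initialFittingIdeal (R M : Type*) [CommRing R] [AddCommGroup M] [Module R M] : Ideal R :=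
  Ideal.span {d | ∃ (k : ℕ) (m : Fin k → M) (A : Matrix (Fin k) (Fin k) R),
    Submodule.span R (Set.range m) = ⊤ ∧ (∀ i, ∑ j, A i j • m j = 0) ∧ d = A.det}

/-- `p` is the Hilbert polynomial of the numerical function `H`: the two agree at all large
integers. -/
def IsHilbertPolynomial (H : ℤ → ℕ) (p : Polynomial ℚ) : Prop :=
  ∀ᶠ i : ℤ in Filter.atTop, (H i : ℚ) = p.eval (i : ℚ)

/-- `r` is the regularity index of the numerical function `H` with Hilbert polynomial `p`: the
least integer from which on `H` and `p` agree, or `-∞` (written `⊥`) if they agree everywhere. -/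
def IsRegularityIndex (H : ℤ → ℕ) (r : WithBot ℤ) : Prop :=
  ∃ p : Polynomial ℚ, IsHilbertPolynomial H p ∧
    ((r = ⊥ ∧ ∀ j : ℤ, (H j : ℚ) = p.eval (j : ℚ)) ∨
      ∃ i : ℤ, r = i ∧ IsLeast {i : ℤ | ∀ j : ℤ, i ≤ j → (H j : ℚ) = p.eval (j : ℚ)} i)

attribute [local instance] MvPolynomial.gradedAlgebra

/-- A `0`-dimensional closed subscheme of `ℙⁿ` over `K`, given by its homogeneous vanishing ideal in
`K[X₀, …, Xₙ]`, none of whose points lies on the hyperplane `X₀ = 0`. -/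
structure ZeroDimScheme (K : Type*) [Field K] (n : ℕ) where
  /-- The homogeneous vanishing ideal. -/
  I : Ideal (MvPolynomial (Fin (n + 1)) K)
  homogeneous : I.IsHomogeneous (MvPolynomial.homogeneousSubmodule (Fin (n + 1)) K)
  /-- Vanishing ideals of subschemes are the homogeneous ideals that are saturated with respect
  to `(X₀, …, Xₙ)`. -/
  saturated : ∀ f, (∀ i, MvPolynomial.X i * f ∈ I) → f ∈ I
  /-- The scheme has dimension `0` (in particular it is not empty). -/
  dim_eq : ringKrullDim (MvPolynomial (Fin (n + 1)) K ⧸ I) = 1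
  /-- No point of the scheme (a relevant homogeneous prime ideal that contains `I`) lies on the
  hyperplane `X₀ = 0`. -/
  avoids : ∀ 𝔭 : Ideal (MvPolynomial (Fin (n + 1)) K), 𝔭.IsPrime →
    𝔭.IsHomogeneous (MvPolynomial.homogeneousSubmodule (Fin (n + 1)) K) →
    I ≤ 𝔭 → MvPolynomial.X 0 ∈ 𝔭 → ∀ i, MvPolynomial.X i ∈ 𝔭

namespace ZeroDimScheme

variable {K : Type*} [Field K] {n : ℕ} (𝕏 : ZeroDimScheme K n)

/-- The homogeneous coordinate ring `R = K[X₀, …, Xₙ] / I`. -/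
def R : Type _ := MvPolynomial (Fin (n + 1)) K ⧸ 𝕏.I

instance : CommRing 𝕏.R := inferInstanceAs (CommRing (MvPolynomial (Fin (n + 1)) K ⧸ 𝕏.I))

instance : Algebra K 𝕏.R := inferInstanceAs (Algebra K (MvPolynomial (Fin (n + 1)) K ⧸ 𝕏.I))

/-- The canonical surjection `K[X₀, …, Xₙ] → R`. -/
def toR : MvPolynomial (Fin (n + 1)) K →ₐ[K] 𝕏.R := Ideal.Quotient.mkₐ K 𝕏.I

/-- The image `xᵢ` of `Xᵢ` in `R`. -/
def x (i : Fin (n + 1)) : 𝕏.R := 𝕏.toR (MvPolynomial.X i)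

/-- The homogeneous component `R_i` of the graded ring `R`, for `i ∈ ℤ`. -/
def component (i : ℤ) : Submodule K 𝕏.R :=
  if 0 ≤ i then
    (MvPolynomial.homogeneousSubmodule (Fin (n + 1)) K i.toNat).map 𝕏.toR.toLinearMap
  else ⊥

/-- The Hilbert function `i ↦ dim_K (𝔞 ∩ R_i)` of a homogeneous ideal `𝔞` of `R`. -/
def hilbertFunction (𝔞 : Ideal 𝕏.R) (i : ℤ) : ℕ :=
  Module.finrank K ↥(𝔞.restrictScalars K ⊓ 𝕏.component i)

/-- The Kähler different of `𝕏`: the initial Fitting ideal of the module of Kähler differentials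
of `R` over its subalgebra `K[x₀]`. -/
def kaehlerDifferent : Ideal 𝕏.R :=
  initialFittingIdeal 𝕏.R (KaehlerDifferential (Algebra.adjoin K {𝕏.x 0}) 𝕏.R)

/-- The affine coordinate ring `S = R / ⟨x₀ - 1⟩` of `𝕏` in `D₊(X₀) ≅ 𝔸ⁿ`. -/
def S : Type _ := 𝕏.R ⧸ Ideal.span {𝕏.x 0 - 1}

instance : CommRing 𝕏.S := inferInstanceAs (CommRing (𝕏.R ⧸ Ideal.span {𝕏.x 0 - 1}))

instance : Algebra K 𝕏.S := inferInstanceAs (Algebra K (𝕏.R ⧸ Ideal.span {𝕏.x 0 - 1}))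

/-- The dehomogenization map `R → S`. -/
def dehomogenization : 𝕏.R →ₐ[K] 𝕏.S := Ideal.Quotient.mkₐ K (Ideal.span {𝕏.x 0 - 1})

/-- The degree of `𝕏`. -/
def degree : ℕ := Module.finrank K 𝕏.S

/-- The support of `𝕏`, that is, its set of closed points. As no point lies on `X₀ = 0`, these are
the closed points of `Spec S`. -/
abbrev Point : Type _ := MaximalSpectrum 𝕏.S

variable {𝕏}

/-- The local ring of `𝕏` at the point `p`. -/
abbrev Point.localRing (p : 𝕏.Point) : Type _ := Localization.AtPrime p.asIdeal

/-- The degree `dim_K K(p)` over `K` of the residue field of `𝕏` at `p`. -/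
def Point.kappa (p : 𝕏.Point) : ℕ := Module.finrank K p.asIdeal.ResidueField

/-- A point is reduced if its local ring is. -/
def Point.Reduced (p : 𝕏.Point) : Prop := IsReduced p.localRing

variable (𝕏)

/-- The presentation `K[X₁, …, Xₙ] → S` of the affine coordinate ring, whose kernel is the affine
vanishing ideal of `𝕏`. -/
def affinePresentation : MvPolynomial (Fin n) K →ₐ[K] 𝕏.S :=
  MvPolynomial.aeval fun i => 𝕏.dehomogenization (𝕏.x i.succ)

variable {𝕏}

/-- The maximal ideal of `K[X₁, …, Xₙ]` that belongs to the point `p`. -/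
abbrev Point.maximalIdeal (p : 𝕏.Point) : Ideal (MvPolynomial (Fin n) K) :=
  p.asIdeal.comap 𝕏.affinePresentation

/-- The local ring of `𝕏` at `p` is a complete intersection: the kernel of the surjection from the
regular local ring of `𝔸ⁿ` at `p` (of dimension `n`) onto it, which is the ideal that the affine
vanishing ideal of `𝕏` generates there, can be generated by a regular sequence of length `n`. -/
def Point.IsCompleteIntersection (p : 𝕏.Point) : Prop :=
  ∃ rs : List (Localization.AtPrime p.maximalIdeal), rs.length = n ∧
    RingTheory.Sequence.IsRegular (Localization.AtPrime p.maximalIdeal) rs ∧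
    Ideal.ofList rs = (RingHom.ker 𝕏.affinePresentation).map
      (algebraMap (MvPolynomial (Fin n) K) (Localization.AtPrime p.maximalIdeal))

variable (𝕏)

/-- The set of complete intersection points of `𝕏`. -/
def ciPoints : Set 𝕏.Point := {p | p.IsCompleteIntersection}

end ZeroDimScheme

end

/-! Setting `x₀ = 1` embeds each graded piece of `R` into the finite `K`-algebra `S`. The Hilbert
function of `ϑ` thus measures subspaces of `S`, all contained in the ideal `J` of Jacobian
determinants of `n` affine relations (`hilbertFunction_eq`, `image_le_jacobianIdeal`). Write `r` for
the regularity index of `R`. Every element of `S` has a representative of degree at most `r`, so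
gradients of relations are combinations of gradients of relations of degree at most `r + 1`
(`polyGrad_mem_span`). Their determinants occur in `ϑ` in degree `n r`, and multiplying by forms of
degree `r` reaches all `S`-multiples. Hence the subspaces equal `J` from degree `(n + 1) r` on, and
the Hilbert polynomial is the constant `dim J`.

The dimension of `J` is a local matter. Adding elements of the squared relation ideal to `n` given
relations leaves their gradients in `S` unchanged and makes the system triangular, with leading
forms `X_i ^ M`. The quotient `B` by a triangular system is finite, and the Scheja-Storch argument
gives a nondegenerate form `η` with `Tr(b) = η(b · Jac)` (`exists_frobenius_form`). Nilpotents have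
trace zero, so the local parts of `Jac` are socle elements, and each socle of `B` is generated by
any of its nonzero elements. If the image of `Jac` in `S` is nonzero at `p`, then `B → S` is
injective on the local factor at `p`, and the relations are generated there by the triangular, hence
regular, sequence. Conversely, at a complete intersection point Nakayama identifies the local
factors of `B` and `S`. The trace of the local idempotent is then the dimension of the factor,
nonzero in `K` by the assumption on the characteristic, so `Jac` generates a socle of dimension `κ`.
Summing over the points gives `finrank_jacobianIdeal`.

For `n ≥ 2` and a reduced point with residue field `L`, the determinants of degree `n r` are
polarized over `L ⊗ S`: a matrix of relation gradients becomes an idempotent times the identity plus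
a rank one matrix annihilated by that idempotent. Its determinant is the idempotent, so the whole
local factor already appears in degree `n r` (`mem_of_forall_det_mem`). For `n = 1`, `S = K[x]` and
the piece of `ϑ` in degree `i` is spanned by `μ'(x) x^m` with `m ≤ i - r`, where `μ` is the minimal
polynomial of `x` (`image_eq_powerSpan`); its dimension grows by one per degree until it reaches
`dim J`. -/

open MvPolynomial in
/-- Polynomials of total degree less than `d`. -/
noncomputable def degreeLess (σ R : Type*) [CommRing R] (d : ℕ) : Submodule R (MvPolynomial σ R) :=
  MvPolynomial.restrictSupport R {α | α.degree < d}

/-! ### The degree filtration and polynomials with a monic monomial as leading form -/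

section DegreeLess

open MvPolynomial

variable {σ R : Type*} [CommRing R]

lemma degreeLess_mono {d e : ℕ} (h : d ≤ e) : degreeLess σ R d ≤ degreeLess σ R e :=
  fun _ hp _ hα => lt_of_lt_of_le (hp hα) h

lemma totalDegree_lt_mem_degreeLess {d : ℕ} {p : MvPolynomial σ R} (h : p.totalDegree < d) :
    p ∈ degreeLess σ R d :=
  fun _ hα => lt_of_le_of_lt (le_totalDegree hα) h

lemma mem_degreeLess_succ {d : ℕ} {p : MvPolynomial σ R} :
    p ∈ degreeLess σ R (d + 1) ↔ p.totalDegree ≤ d := by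
  refine ⟨fun h => ?_, fun h => totalDegree_lt_mem_degreeLess (Nat.lt_succ_of_le h)⟩
  rw [totalDegree, Finset.sup_le_iff]
  exact fun α hα => Nat.le_of_lt_succ (h hα)

lemma degreeLess_zero {p : MvPolynomial σ R} (h : p ∈ degreeLess σ R 0) : p = 0 := by
  rw [← support_eq_empty, Finset.eq_empty_iff_forall_notMem]
  exact fun α hα => Nat.not_lt_zero _ (h hα)

lemma monomial_mem_degreeLess {d : ℕ} {α : σ →₀ ℕ} (h : α.degree < d) (r : R) :
    monomial α r ∈ degreeLess σ R d :=
  (monomial_mem_restrictSupport R).2 (Or.inl h)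

lemma C_mem_degreeLess {d : ℕ} (h : 0 < d) (r : R) : C r ∈ degreeLess σ R d :=
  monomial_mem_degreeLess (by simpa using h) r

lemma mul_mem_degreeLess {a b : ℕ} {p q : MvPolynomial σ R}
    (hp : p ∈ degreeLess σ R (a + 1)) (hq : q ∈ degreeLess σ R b) :
    p * q ∈ degreeLess σ R (a + b) := by
  classical
  intro α hα
  obtain ⟨β, hβ, γ, hγ, rfl⟩ := Finset.mem_add.1 (support_mul p q hα)
  have h1 := hp hβ
  have h2 := hq hγ
  simp only [Set.mem_ofPred_eq, map_add] at *
  omega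

lemma map_mem_degreeLess {S : Type*} [CommRing S] (φ : R →+* S) {d : ℕ} {p : MvPolynomial σ R}
    (hp : p ∈ degreeLess σ R d) : MvPolynomial.map φ p ∈ degreeLess σ S d :=
  fun _ hα => hp (support_map_subset φ p hα)

lemma prod_mem_degreeLess {ι : Type*} (s : Finset ι) (d : ι → ℕ) (p : ι → MvPolynomial σ R)
    (h : ∀ i ∈ s, p i ∈ degreeLess σ R (d i + 1)) :
    ∏ i ∈ s, p i ∈ degreeLess σ R (∑ i ∈ s, d i + 1) := by
  classical
  induction s using Finset.induction_on with
  | empty => simpa using C_mem_degreeLess Nat.one_pos (1 : R)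
  | insert a s ha ih =>
    rw [Finset.prod_insert ha, Finset.sum_insert ha, add_assoc]
    exact mul_mem_degreeLess (h a (Finset.mem_insert_self _ _))
      (ih fun i hi => h i (Finset.mem_insert_of_mem hi))

/-- `p` is the monomial `X^β` up to terms of smaller total degree. -/
def HasTop (p : MvPolynomial σ R) (β : σ →₀ ℕ) : Prop :=
  p - monomial β 1 ∈ degreeLess σ R β.degree

lemma HasTop.mem {p : MvPolynomial σ R} {β : σ →₀ ℕ} (h : HasTop p β) :
    p ∈ degreeLess σ R (β.degree + 1) := by
  have := Submodule.add_mem _ (degreeLess_mono (Nat.le_succ _) h)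
    (monomial_mem_degreeLess (Nat.lt_succ_self β.degree) (1 : R))
  simpa using this

lemma hasTop_monomial (β : σ →₀ ℕ) : HasTop (monomial β (1 : R)) β := by
  simp [HasTop]

lemma HasTop.mul {p q : MvPolynomial σ R} {β γ : σ →₀ ℕ} (hp : HasTop p β) (hq : HasTop q γ) :
    HasTop (p * q) (β + γ) := by
  have h1 : p * q - monomial (β + γ) 1 =
      p * (q - monomial γ 1) + monomial γ 1 * (p - monomial β 1) := by
    have : (monomial (β + γ) (1 : R)) = monomial β 1 * monomial γ 1 := by simp [monomial_mul]
    rw [this]; ring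
  rw [HasTop, h1, map_add]
  refine Submodule.add_mem _ (mul_mem_degreeLess hp.mem hq) ?_
  rw [add_comm β.degree]
  exact mul_mem_degreeLess (monomial_mem_degreeLess (Nat.lt_succ_self _) _) hp

lemma hasTop_one : HasTop (1 : MvPolynomial σ R) 0 := hasTop_monomial 0

lemma HasTop.pow {p : MvPolynomial σ R} {β : σ →₀ ℕ} (hp : HasTop p β) (k : ℕ) :
    HasTop (p ^ k) (k • β) := by
  induction k with
  | zero => simpa using hasTop_one
  | succ k ih => rw [pow_succ, succ_nsmul]; exact ih.mul hp

lemma HasTop.prod {ι : Type*} (s : Finset ι) {p : ι → MvPolynomial σ R} {β : ι → σ →₀ ℕ}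
    (h : ∀ i ∈ s, HasTop (p i) (β i)) : HasTop (∏ i ∈ s, p i) (∑ i ∈ s, β i) := by
  classical
  induction s using Finset.induction_on with
  | empty => simpa using hasTop_one
  | insert a s ha ih =>
    rw [Finset.prod_insert ha, Finset.sum_insert ha]
    exact (h a (Finset.mem_insert_self _ _)).mul
      (ih fun i hi => h i (Finset.mem_insert_of_mem hi))

/-- The determinant of a matrix with dominant diagonal. -/
lemma hasTop_det {ι : Type*} [Fintype ι] [DecidableEq ι] (a : Matrix ι ι (MvPolynomial σ R))
    (m : ℕ) (β : ι → σ →₀ ℕ) (hβ : ∀ i, (β i).degree = m) (hd : ∀ i, HasTop (a i i) (β i))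
    (ho : ∀ i j, i ≠ j → a i j ∈ degreeLess σ R m) : HasTop a.det (∑ i, β i) := by
  classical
  have hdeg : (∑ i, β i).degree = Fintype.card ι * m := by
    simp [hβ, Finset.card_univ]
  rw [HasTop, Matrix.det_apply, ← Finset.add_sum_erase _ _ (Finset.mem_univ (1 : Equiv.Perm ι))]
  simp only [Equiv.Perm.sign_one, Equiv.Perm.coe_one, id_eq, one_smul]
  rw [add_sub_right_comm]
  refine Submodule.add_mem _ (HasTop.prod _ fun i _ => hd i) (Submodule.sum_mem _ fun τ hτ => ?_)
  have hτ1 : τ ≠ 1 := (Finset.mem_erase.1 hτ).1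
  obtain ⟨j, hj⟩ : ∃ j, τ j ≠ j := by
    by_contra! h
    exact hτ1 (Equiv.ext h)
  have hle : ∀ i j, a i j ∈ degreeLess σ R (m + 1) := by
    intro i j
    by_cases h : i = j
    · subst h; have := (hd i).mem; rwa [hβ] at this
    · exact degreeLess_mono (Nat.le_succ _) (ho i j h)
  -- A permutation other than the identity uses at least one off-diagonal entry, which costs one
  -- degree.
  have key : ∏ i, a (τ i) i ∈ degreeLess σ R (Fintype.card ι * m) := by
    rw [← Finset.prod_erase_mul _ _ (Finset.mem_univ j)]
    have h1 := prod_mem_degreeLess (Finset.univ.erase j) (fun _ => m) (fun i => a (τ i) i)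
      fun i _ => hle _ _
    have h2 := mul_mem_degreeLess h1 (ho _ _ hj)
    refine degreeLess_mono (le_of_eq ?_) h2
    have hc : 0 < Fintype.card ι := Fintype.card_pos_iff.2 ⟨j⟩
    obtain ⟨c, hc⟩ := Nat.exists_eq_add_of_lt hc
    simp only [Finset.sum_const, smul_eq_mul, Finset.card_erase_of_mem (Finset.mem_univ j),
      Finset.card_univ, hc]
    simp; ring
  rw [hdeg]
  rcases Int.units_eq_one_or (Equiv.Perm.sign τ) with h | h
  · simpa [h] using key
  · simpa [h] using key

end DegreeLess

/-! ### Triangular systems and their residue functional -/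

section Triangular

open MvPolynomial

variable {R : Type*} [CommRing R] {n : ℕ}

/-- The product `f^γ` of powers of the members of a finite family of polynomials. -/
noncomputable def powProd (f : Fin n → MvPolynomial (Fin n) R) (γ : Fin n → ℕ) :
    MvPolynomial (Fin n) R := ∏ i, f i ^ γ i

/-- The linear map `X^β ↦ f^⌊β/M⌋ X^(β mod M)`. -/
noncomputable def exchange (M : ℕ) (f : Fin n → MvPolynomial (Fin n) R) :
    MvPolynomial (Fin n) R →ₗ[R] MvPolynomial (Fin n) R :=
  (basisMonomials (Fin n) R).constr R fun β =>
    powProd f (fun i => β i / M) * ∏ i, X i ^ (β i % M)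

lemma exchange_monomial (M : ℕ) (f : Fin n → MvPolynomial (Fin n) R) (β : Fin n →₀ ℕ) :
    exchange M f (monomial β 1) = powProd f (fun i => β i / M) * ∏ i, X i ^ (β i % M) := by
  have := (basisMonomials (Fin n) R).constr_basis R
    (fun β => powProd f (fun i => β i / M) * ∏ i, X i ^ (β i % M)) β
  simpa [exchange] using this

lemma exchange_monomial_mul {M : ℕ} (hM : 0 < M) (f : Fin n → MvPolynomial (Fin n) R) (i : Fin n)
    (β : Fin n →₀ ℕ) :
    exchange M f (monomial (β + Finsupp.single i M) 1) = f i * exchange M f (monomial β 1) := by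
  rw [exchange_monomial, exchange_monomial, ← mul_assoc]
  congr 1
  · rw [powProd, powProd, ← Finset.mul_prod_erase _ _ (Finset.mem_univ i),
      ← Finset.mul_prod_erase (a := i) _ (fun i => f i ^ (β i / M)) (Finset.mem_univ i),
      ← mul_assoc, ← pow_succ']
    congr 1
    · simp [Nat.add_div_right _ hM]
    · refine Finset.prod_congr rfl fun j hj => ?_
      rw [Finsupp.add_apply, Finsupp.single_eq_of_ne (Finset.ne_of_mem_erase hj), add_zero]
  · refine Finset.prod_congr rfl fun j _ => ?_
    by_cases h : j = i
    · subst h; simp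
    · rw [Finsupp.add_apply, Finsupp.single_eq_of_ne h, add_zero]

/-- Raising `β i` by `M` raises the quotient by one and keeps the remainder. The map therefore
intertwines `X i ^ M` with `f i`, and questions about the system reduce to pure powers of variables.
-/
lemma exchange_X_pow_mul {M : ℕ} (hM : 0 < M) (f : Fin n → MvPolynomial (Fin n) R) (i : Fin n)
    (p : MvPolynomial (Fin n) R) :
    exchange M f (X i ^ M * p) = f i * exchange M f p := by
  induction p using MvPolynomial.induction_on' with
  | monomial β c =>
    have h1 : monomial β c = c • monomial β (1 : R) := by simp [smul_monomial]
    have h2 : X i ^ M * monomial β c = c • monomial (β + Finsupp.single i M) (1 : R) := by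
      rw [X_pow_eq_monomial, monomial_mul, add_comm]; simp [smul_monomial]
    rw [h2, h1, map_smul, map_smul, exchange_monomial_mul hM, mul_smul_comm]
  | add p q hp hq => rw [mul_add, map_add, hp, hq, map_add, mul_add]

variable {M : ℕ} {f : Fin n → MvPolynomial (Fin n) R}

lemma hasTop_exchange (hf : ∀ i, HasTop (f i) (Finsupp.single i M)) (β : Fin n →₀ ℕ) :
    HasTop (exchange M f (monomial β 1)) β := by
  rw [exchange_monomial]
  have h1 : HasTop (powProd f fun i => β i / M) (∑ i, (β i / M) • Finsupp.single i M) :=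
    HasTop.prod _ fun i _ => (hf i).pow _
  have h2 : HasTop (∏ i, (X i : MvPolynomial (Fin n) R) ^ (β i % M))
      (∑ i, (β i % M) • Finsupp.single i 1) :=
    HasTop.prod _ fun i _ => (hasTop_monomial (Finsupp.single i 1)).pow _
  convert h1.mul h2
  ext j
  simp only [Finsupp.add_apply, Finsupp.finsetSum_apply, Finsupp.smul_apply, Finsupp.single_apply,
    smul_eq_mul, mul_ite, mul_zero, mul_one, Finset.sum_ite_eq', Finset.mem_univ, if_true]
  rw [mul_comm, Nat.div_add_mod]

/-- Unipotence for the degree filtration: this yields bijectivity by induction on the degree. -/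
lemma exchange_sub_mem (hf : ∀ i, HasTop (f i) (Finsupp.single i M)) {d : ℕ}
    {p : MvPolynomial (Fin n) R} (hp : p ∈ degreeLess (Fin n) R (d + 1)) :
    exchange M f p - p ∈ degreeLess (Fin n) R d := by
  have h1 : exchange M f p - p =
      ∑ α ∈ p.support, coeff α p • (exchange M f (monomial α 1) - monomial α 1) := by
    conv_lhs => rw [p.as_sum]
    rw [map_sum, ← Finset.sum_sub_distrib]
    refine Finset.sum_congr rfl fun α _ => ?_
    have : monomial α (coeff α p) = coeff α p • monomial α (1 : R) := by simp [smul_monomial]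
    rw [this, map_smul, smul_sub]
  rw [h1]
  exact Submodule.sum_mem _ fun α hα => Submodule.smul_mem _ _
    (degreeLess_mono (Nat.le_of_lt_succ (hp hα)) (hasTop_exchange hf α))

lemma exists_exchange_eq (hf : ∀ i, HasTop (f i) (Finsupp.single i M)) (d : ℕ) :
    ∀ p ∈ degreeLess (Fin n) R d, ∃ q ∈ degreeLess (Fin n) R d, exchange M f q = p := by
  induction d with
  | zero => exact fun p hp => ⟨0, Submodule.zero_mem _, by rw [degreeLess_zero hp, map_zero]⟩
  | succ d ih =>
    intro p hp
    obtain ⟨q, hq, h⟩ := ih _ (exchange_sub_mem hf hp)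
    exact ⟨p - q, Submodule.sub_mem _ hp (degreeLess_mono (Nat.le_succ d) hq),
      by rw [map_sub, h, sub_sub_cancel]⟩

lemma exchange_bijective (hf : ∀ i, HasTop (f i) (Finsupp.single i M)) :
    Function.Bijective (exchange M f) := by
  constructor
  · rw [← LinearMap.ker_eq_bot, LinearMap.ker_eq_bot']
    intro p hp
    have : ∀ d, p ∈ degreeLess (Fin n) R d → p = 0 := by
      intro d
      induction d with
      | zero => exact degreeLess_zero
      | succ d ih =>
        intro h
        have := exchange_sub_mem hf h
        rw [hp, zero_sub] at this
        exact ih (by simpa using Submodule.neg_mem _ this)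
    exact this _ (totalDegree_lt_mem_degreeLess (Nat.lt_succ_self _))
  · intro p
    obtain ⟨q, -, h⟩ := exists_exchange_eq hf _ p
      (totalDegree_lt_mem_degreeLess (Nat.lt_succ_self p.totalDegree))
    exact ⟨q, h⟩

/-- The exchange map as an automorphism. -/
noncomputable def exchangeEquiv (hf : ∀ i, HasTop (f i) (Finsupp.single i M)) :
    MvPolynomial (Fin n) R ≃ₗ[R] MvPolynomial (Fin n) R :=
  LinearEquiv.ofBijective (exchange M f) (exchange_bijective hf)

lemma exchangeEquiv_symm_mul (hM : 0 < M) (hf : ∀ i, HasTop (f i) (Finsupp.single i M))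
    (i : Fin n) (p : MvPolynomial (Fin n) R) :
    (exchangeEquiv hf).symm (f i * p) = X i ^ M * (exchangeEquiv hf).symm p := by
  rw [LinearEquiv.symm_apply_eq]
  change _ = exchange M f _
  rw [exchange_X_pow_mul hM]
  exact congrArg _ ((exchangeEquiv hf).apply_symm_apply p).symm

/-- The exponent `(M - 1, …, M - 1)`. -/
noncomputable def topExponent (n M : ℕ) : Fin n →₀ ℕ := ∑ i, Finsupp.single i (M - 1)

lemma topExponent_apply (n M : ℕ) (i : Fin n) : topExponent n M i = M - 1 := by
  rw [topExponent, Finsupp.finsetSum_apply, Finset.sum_eq_single i] <;>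
    simp +contextual

/-- The residue functional of a triangular system. -/
noncomputable def residueForm (hf : ∀ i, HasTop (f i) (Finsupp.single i M)) :
    MvPolynomial (Fin n) R →ₗ[R] R :=
  lcoeff R (topExponent n M) ∘ₗ (exchangeEquiv hf).symm.toLinearMap

/-- After transport, `f i * p` is a multiple of `X i ^ M`, and the exponent of `X i` in the monomial
that is read off is only `M - 1`. -/
lemma residueForm_mul (hM : 0 < M) (hf : ∀ i, HasTop (f i) (Finsupp.single i M)) (i : Fin n)
    (p : MvPolynomial (Fin n) R) : residueForm hf (f i * p) = 0 := by
  simp only [residueForm, LinearMap.comp_apply, LinearEquiv.coe_coe,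
    exchangeEquiv_symm_mul hM hf, lcoeff_apply, X_pow_eq_monomial]
  rw [coeff_monomial_mul', if_neg]
  intro h
  have := h i
  rw [topExponent_apply, Finsupp.single_eq_same] at this
  omega

lemma residueForm_eq_zero_of_mem (hf : ∀ i, HasTop (f i) (Finsupp.single i M))
    {p : MvPolynomial (Fin n) R} (hp : p ∈ degreeLess (Fin n) R (topExponent n M).degree) :
    residueForm hf p = 0 := by
  obtain ⟨q, hq, rfl⟩ := exists_exchange_eq hf _ p hp
  have : (exchangeEquiv hf).symm (exchange M f q) = q := (exchangeEquiv hf).symm_apply_apply q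
  simp only [residueForm, LinearMap.comp_apply, LinearEquiv.coe_coe, this, lcoeff_apply]
  by_contra h
  exact (lt_irrefl (topExponent n M).degree) (hq (mem_support_iff.2 h))

lemma residueForm_top (hM : 0 < M) (hf : ∀ i, HasTop (f i) (Finsupp.single i M)) :
    residueForm hf (monomial (topExponent n M) 1) = 1 := by
  have h1 : exchange M f (monomial (topExponent n M) 1) = monomial (topExponent n M) 1 := by
    have hd : (M - 1) / M = 0 := Nat.div_eq_of_lt (by omega)
    have hm : (M - 1) % M = M - 1 := Nat.mod_eq_of_lt (by omega)
    rw [exchange_monomial]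
    simp only [topExponent_apply, hd, hm, powProd, pow_zero, Finset.prod_const_one, one_mul]
    rw [topExponent, monomial_sum_one]
    simp [X_pow_eq_monomial]
  have : (exchangeEquiv hf).symm (monomial (topExponent n M) 1) = monomial (topExponent n M) 1 := by
    rw [LinearEquiv.symm_apply_eq]; exact h1.symm
  simp [residueForm, this, lcoeff_apply]

lemma residueForm_eq_zero_of_mem_span (hM : 0 < M) (hf : ∀ i, HasTop (f i) (Finsupp.single i M))
    {p : MvPolynomial (Fin n) R} (hp : p ∈ Ideal.span (Set.range f)) : residueForm hf p = 0 := by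
  rw [Ideal.mem_span_range_iff_exists_fun] at hp
  obtain ⟨c, rfl⟩ := hp
  rw [map_sum]
  exact Finset.sum_eq_zero fun i _ => by rw [mul_comm, residueForm_mul hM]

/-- The quotient by a triangular system is a finite module. -/
lemma finite_quotient_of_hasTop (hM : 0 < M) (hf : ∀ i, HasTop (f i) (Finsupp.single i M)) :
    Module.Finite R (MvPolynomial (Fin n) R ⧸ Ideal.span (Set.range f)) := by
  classical
  let J := Ideal.span (Set.range f)
  let v : (Fin n → Fin M) → MvPolynomial (Fin n) R ⧸ J :=
    fun α => Ideal.Quotient.mk J (∏ i, X i ^ (α i : ℕ))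
  refine ⟨⟨Finset.univ.image v, ?_⟩⟩
  rw [Finset.coe_image, Finset.coe_univ, Set.image_univ, eq_top_iff]
  rintro x -
  obtain ⟨p, rfl⟩ := Ideal.Quotient.mk_surjective x
  -- Exchanged monomials span; those with a nonzero quotient `β i / M` contain a factor `f i` and
  -- vanish, which leaves the finitely many with all exponents below `M`.
  obtain ⟨q, rfl⟩ := (exchange_bijective hf).2 p
  induction q using MvPolynomial.induction_on' with
  | monomial β c =>
    have h1 : monomial β c = c • monomial β (1 : R) := by simp [smul_monomial]
    have h2 : Ideal.Quotient.mk J (exchange M f (monomial β c)) =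
        c • Ideal.Quotient.mk J (exchange M f (monomial β 1)) := by
      rw [h1, map_smul]; exact map_smul (Ideal.Quotient.mkₐ R J) _ _
    rw [h2]
    refine Submodule.smul_mem _ _ ?_
    rw [exchange_monomial]
    by_cases h : ∀ i, β i / M = 0
    · simp only [h, powProd, pow_zero, Finset.prod_const_one, one_mul]
      exact Submodule.subset_span ⟨fun i => ⟨β i % M, Nat.mod_lt _ hM⟩, rfl⟩
    · push Not at h
      obtain ⟨i, hi⟩ := h
      have : powProd f (fun i => β i / M) ∈ J :=
        Ideal.mem_of_dvd _ ((dvd_pow_self (f i) hi).trans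
          (Finset.dvd_prod_of_mem (fun i => f i ^ (β i / M)) (Finset.mem_univ i)))
          (Ideal.subset_span ⟨i, rfl⟩)
      rw [Ideal.Quotient.eq_zero_iff_mem.2 (Ideal.mul_mem_right _ _ this)]
      exact Submodule.zero_mem _
  | add p q hp hq => rw [map_add, map_add]; exact Submodule.add_mem _ hp hq

end Triangular

/-! ### Triangular systems are regular sequences -/

section Regular

open MvPolynomial RingTheory.Sequence

variable {R : Type*} [CommRing R] {n : ℕ} {M : ℕ} {f : Fin n → MvPolynomial (Fin n) R}

/-- In a monomial ideal membership is tested on monomials, and a factor `X i ^ M` does not affect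
divisibility by `X j ^ M` for `j ≠ i`. -/
lemma mem_span_X_pow_of_mul_mem {i : Fin n} {s : Set (Fin n)} (hi : i ∉ s)
    {p : MvPolynomial (Fin n) R}
    (hp : X i ^ M * p ∈ Ideal.span ((fun j => (X j : MvPolynomial (Fin n) R) ^ M) '' s)) :
    p ∈ Ideal.span ((fun j => (X j : MvPolynomial (Fin n) R) ^ M) '' s) := by
  have hs : (fun j => (X j : MvPolynomial (Fin n) R) ^ M) '' s =
      (fun α => monomial α (1 : R)) '' ((fun j => Finsupp.single j M) '' s) := by
    rw [Set.image_image]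
    simp only [X_pow_eq_monomial]
  rw [hs, mem_ideal_span_monomial_image] at hp ⊢
  intro α hα
  have h1 : Finsupp.single i M + α ∈ (X i ^ M * p).support := by
    rw [mem_support_iff] at hα ⊢
    rwa [X_pow_eq_monomial, coeff_monomial_mul, one_mul]
  obtain ⟨_, ⟨j, hj, rfl⟩, hle⟩ := hp _ h1
  refine ⟨_, ⟨j, hj, rfl⟩, ?_⟩
  have hij : j ≠ i := fun h => hi (h ▸ hj)
  have := hle j
  rw [Finsupp.add_apply, Finsupp.single_eq_of_ne hij, zero_add, Finsupp.single_eq_same] at this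
  exact Finsupp.single_le_iff.2 this

/-- Transports the ideal membership of the monomial model to the system. The exchange map is linear
over `R` only, so both inductions carry an arbitrary polynomial multiplier. -/
lemma exchangeEquiv_symm_mem (hM : 0 < M) (hf : ∀ i, HasTop (f i) (Finsupp.single i M))
    (s : Set (Fin n)) (p : MvPolynomial (Fin n) R) :
    (exchangeEquiv hf).symm p ∈ Ideal.span ((fun j => (X j : MvPolynomial (Fin n) R) ^ M) '' s) ↔
      p ∈ Ideal.span (f '' s) := by
  constructor
  · intro h
    rw [← (exchangeEquiv hf).apply_symm_apply p]
    generalize (exchangeEquiv hf).symm p = q at h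
    induction h using Submodule.span_induction with
    | mem x hx =>
      obtain ⟨j, hj, rfl⟩ := hx
      have : exchange M f (X j ^ M) = f j * exchange M f 1 := by
        rw [← exchange_X_pow_mul hM, mul_one]
      change exchange M f (X j ^ M) ∈ _
      rw [this]
      exact Ideal.mul_mem_right _ _ (Ideal.subset_span ⟨j, hj, rfl⟩)
    | zero => rw [map_zero]; exact Submodule.zero_mem _
    | add x y _ _ hx hy => rw [map_add]; exact Submodule.add_mem _ hx hy
    | smul a x hx _ =>
      clear * - hx hM
      induction hx using Submodule.span_induction generalizing a with
      | mem x hx =>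
        obtain ⟨j, hj, rfl⟩ := hx
        change exchange M f (a * X j ^ M) ∈ _
        rw [mul_comm, exchange_X_pow_mul hM]
        exact Ideal.mul_mem_right _ _ (Ideal.subset_span ⟨j, hj, rfl⟩)
      | zero => rw [smul_zero, map_zero]; exact Submodule.zero_mem _
      | add x y _ _ hx hy => rw [smul_add, map_add]; exact Submodule.add_mem _ (hx a) (hy a)
      | smul b x _ hx => rw [smul_smul]; exact hx _
  · intro h
    have : ∀ a, (exchangeEquiv hf).symm (a * p) ∈
        Ideal.span ((fun j => (X j : MvPolynomial (Fin n) R) ^ M) '' s) := by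
      induction h using Submodule.span_induction with
      | mem x hx =>
        obtain ⟨j, hj, rfl⟩ := hx
        intro a
        rw [mul_comm, exchangeEquiv_symm_mul hM]
        exact Ideal.mul_mem_right _ _ (Ideal.subset_span ⟨j, hj, rfl⟩)
      | zero => intro a; rw [mul_zero, map_zero]; exact Submodule.zero_mem _
      | add x y _ _ hx hy =>
        intro a; rw [mul_add, map_add]; exact Submodule.add_mem _ (hx a) (hy a)
      | smul b x _ hx => intro a; rw [smul_eq_mul, ← mul_assoc]; exact hx _
    simpa using this 1

lemma mem_span_of_mul_mem_of_hasTop (hM : 0 < M) (hf : ∀ i, HasTop (f i) (Finsupp.single i M))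
    {i : Fin n} {s : Set (Fin n)} (hi : i ∉ s) {p : MvPolynomial (Fin n) R}
    (hp : f i * p ∈ Ideal.span (f '' s)) : p ∈ Ideal.span (f '' s) := by
  rw [← exchangeEquiv_symm_mem hM hf] at hp ⊢
  rw [exchangeEquiv_symm_mul hM] at hp
  exact mem_span_X_pow_of_mul_mem hi hp

/-- A triangular system is a weakly regular sequence. -/
lemma isWeaklyRegular_of_hasTop (hM : 0 < M) (hf : ∀ i, HasTop (f i) (Finsupp.single i M)) :
    IsWeaklyRegular (MvPolynomial (Fin n) R) (List.ofFn f) := by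
  rw [isWeaklyRegular_iff_Fin]
  intro i
  have hn : (i : ℕ) < n := by simpa using i.2
  have hget : (List.ofFn f)[i] = f ⟨i, hn⟩ := by simp
  have htake : Ideal.ofList ((List.ofFn f).take i) = Ideal.span (f '' {j | (j : ℕ) < i}) := by
    rw [Ideal.ofList]
    congr 1
    ext x
    simp only [Set.mem_ofPred_eq, Set.mem_image, List.mem_take_iff_getElem]
    constructor
    · rintro ⟨j, hj, rfl⟩
      have hj' : j < i ∧ j < n := by simpa using hj
      exact ⟨⟨j, hj'.2⟩, hj'.1, by simp⟩
    · rintro ⟨j, hj, rfl⟩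
      exact ⟨j, by simpa using hj, by simp⟩
  rw [hget, htake, isSMulRegular_quotient_iff_mem_of_smul_mem]
  intro x hx
  rw [smul_eq_mul, Ideal.mul_top] at *
  exact mem_span_of_mul_mem_of_hasTop hM hf (s := {j | (j : ℕ) < i}) (by simp) hx

end Regular

/-! ### First order Taylor expansions (Bézout coefficients) -/

section Bezout

open MvPolynomial

variable {R : Type*} [CommRing R] {n : ℕ}

/-- Taylor expansion of order one of a polynomial at a point. -/
lemma exists_bezout (y : Fin n → R) (p : MvPolynomial (Fin n) R) (d : ℕ)
    (hp : p ∈ degreeLess (Fin n) R (d + 1)) :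
    ∃ a : Fin n → MvPolynomial (Fin n) R, p - C (eval y p) = ∑ j, a j * (X j - C (y j)) ∧
      (∀ j, a j ∈ degreeLess (Fin n) R d) ∧ ∀ j, eval y (a j) = eval y (pderiv j p) := by
  classical
  have mono : ∀ (k : ℕ) (α : Fin n →₀ ℕ) (c : R), α.degree = k →
      ∃ a : Fin n → MvPolynomial (Fin n) R,
      monomial α c - C (eval y (monomial α c)) = ∑ j, a j * (X j - C (y j)) ∧
      (∀ j, a j ∈ degreeLess (Fin n) R k) ∧
      ∀ j, eval y (a j) = eval y (pderiv j (monomial α c)) := by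
    intro k
    induction k with
    | zero =>
      intro α c h
      have : α = 0 := (Finsupp.degree_eq_zero_iff α).1 h
      subst this
      exact ⟨0, by simp, fun _ => Submodule.zero_mem _, by simp⟩
    | succ k ih =>
      intro α c h
      obtain ⟨i, hi⟩ : ∃ i, α i ≠ 0 := by
        by_contra! h0
        have : α = 0 := Finsupp.ext h0
        simp [this] at h
      obtain ⟨β, rfl⟩ : ∃ β, α = β + Finsupp.single i 1 :=
        ⟨α - Finsupp.single i 1, (tsub_add_cancel_of_le
          (Finsupp.single_le_iff.2 (Nat.one_le_iff_ne_zero.2 hi))).symm⟩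
      obtain ⟨a, h1, h2, h3⟩ := ih β c (by simpa using h)
      have hm : monomial (β + Finsupp.single i 1) c = monomial β c * X i := by
        simp [X, monomial_mul]
      -- From `m X_i - m(y) y_i = (m - m(y)) X_i + m(y) (X_i - y_i)`.
      refine ⟨fun j => a j * X i + if j = i then C (eval y (monomial β c)) else 0, ?_, ?_, ?_⟩
      · have : ∑ j, (a j * X i + if j = i then C (eval y (monomial β c)) else 0) * (X j - C (y j)) =
            (∑ j, a j * (X j - C (y j))) * X i + C (eval y (monomial β c)) * (X i - C (y i)) := by
          simp only [add_mul, Finset.sum_add_distrib, ite_mul, zero_mul, Finset.sum_ite_eq',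
            Finset.mem_univ, if_true, Finset.sum_mul]
          congr 1
          exact Finset.sum_congr rfl fun j _ => by ring
        rw [this, ← h1, hm, map_mul, eval_X, C_mul]
        ring
      · intro j
        refine Submodule.add_mem _ ?_ ?_
        · rw [mul_comm, add_comm k]
          exact mul_mem_degreeLess (monomial_mem_degreeLess (by simp) _) (h2 j)
        · split_ifs
          · exact C_mem_degreeLess (Nat.succ_pos _) _
          · exact Submodule.zero_mem _
      · intro j
        rw [hm, Derivation.leibniz]
        by_cases h : j = i
        · subst h
          rw [pderiv_X_self]
          simp only [if_true, map_add, map_mul, h3, eval_X, smul_eq_mul, eval_C, map_one]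
          ring
        · rw [pderiv_X_of_ne (Ne.symm h)]
          simp only [if_neg h, map_add, map_mul, h3, eval_X, smul_eq_mul, map_zero]
          ring
  have hmono : ∀ α : Fin n →₀ ℕ, ∃ a : Fin n → MvPolynomial (Fin n) R,
      monomial α (coeff α p) - C (eval y (monomial α (coeff α p))) =
        ∑ j, a j * (X j - C (y j)) ∧
      (∀ j, a j ∈ degreeLess (Fin n) R α.degree) ∧
      ∀ j, eval y (a j) = eval y (pderiv j (monomial α (coeff α p))) :=
    fun α => mono _ α _ rfl
  choose a h1 h2 h3 using hmono
  refine ⟨fun j => ∑ α ∈ p.support, a α j, ?_, fun j => ?_, fun j => ?_⟩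
  · conv_lhs => rw [p.as_sum, map_sum, map_sum, ← Finset.sum_sub_distrib]
    simp only [h1, Finset.sum_mul]
    exact Finset.sum_comm
  · exact Submodule.sum_mem _ fun α hα =>
      degreeLess_mono (Nat.le_of_lt_succ (hp hα)) (h2 α j)
  · conv_rhs => rw [p.as_sum, map_sum, map_sum]
    rw [map_sum]
    exact Finset.sum_congr rfl fun α _ => h3 α j

/-- The geometric sum makes only the `i`-th coefficient nonzero, with leading form `X i ^ m`; this
gives the Bézout matrix of a triangular system its dominant diagonal. -/
lemma exists_bezout_X_pow (y : Fin n → R) (i : Fin n) (m : ℕ) :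
    ∃ a : Fin n → MvPolynomial (Fin n) R,
      X i ^ (m + 1) - C (eval y (X i ^ (m + 1))) = ∑ j, a j * (X j - C (y j)) ∧
      HasTop (a i) (Finsupp.single i m) ∧ (∀ j, i ≠ j → a j ∈ degreeLess (Fin n) R m) ∧
      ∀ j, eval y (a j) = eval y (pderiv j (X i ^ (m + 1))) := by
  classical
  refine ⟨Pi.single i (∑ k ∈ Finset.range (m + 1), X i ^ k * C (y i) ^ (m - k)), ?_, ?_, ?_, ?_⟩
  · rw [Finset.sum_eq_single i]
    · have := (Commute.all (X i : MvPolynomial (Fin n) R) (C (y i))).geom_sum₂_mul (m + 1)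
      simpa using this.symm
    · intro j _ h; simp [h]
    · simp
  · rw [Pi.single_eq_same, Finset.sum_range_succ, HasTop, X_pow_eq_monomial]
    simp only [Nat.sub_self, pow_zero, mul_one, add_sub_cancel_right, Finsupp.degree_single]
    refine Submodule.sum_mem _ fun k hk => ?_
    rw [← C_pow, X_pow_eq_monomial, mul_comm, C_mul_monomial]
    exact monomial_mem_degreeLess (by simpa using hk) _
  · intro j hj
    rw [Pi.single_eq_of_ne' hj]; exact Submodule.zero_mem _
  · intro j
    by_cases h : i = j
    · subst h
      rw [Pi.single_eq_same, Derivation.leibniz_pow]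
      simp only [map_sum, map_mul, map_pow, eval_X, eval_C, pderiv_X_self]
      rw [Finset.sum_congr rfl (g := fun _ => y i ^ m)]
      · simp
      · intro k hk
        rw [← pow_add, Nat.add_sub_cancel' (Nat.le_of_lt_succ (Finset.mem_range.1 hk))]
    · rw [Pi.single_eq_of_ne' h, Derivation.leibniz_pow, pderiv_X_of_ne h]
      simp

/-- The order one Taylor expansion of a member of a triangular system. -/
lemma exists_bezout_of_hasTop (y : Fin n → R) (i : Fin n) {m : ℕ} {p : MvPolynomial (Fin n) R}
    (hp : HasTop p (Finsupp.single i (m + 1))) :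
    ∃ a : Fin n → MvPolynomial (Fin n) R, p - C (eval y p) = ∑ j, a j * (X j - C (y j)) ∧
      HasTop (a i) (Finsupp.single i m) ∧ (∀ j, i ≠ j → a j ∈ degreeLess (Fin n) R m) ∧
      ∀ j, eval y (a j) = eval y (pderiv j p) := by
  obtain ⟨a, h1, h2, h3, h4⟩ := exists_bezout_X_pow y i m
  have hq : p - X i ^ (m + 1) ∈ degreeLess (Fin n) R (m + 1) := by
    rw [X_pow_eq_monomial]; simpa [HasTop] using hp
  obtain ⟨b, k1, k2, k3⟩ := exists_bezout y _ m hq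
  refine ⟨fun j => a j + b j, ?_, ?_, fun j hj => Submodule.add_mem _ (h3 j hj) (k2 j), ?_⟩
  · simp only [add_mul, Finset.sum_add_distrib, ← h1, ← k1, map_sub]
    ring
  · rw [HasTop, add_sub_right_comm]
    exact Submodule.add_mem _ h2 (by simpa using k2 i)
  · intro j
    rw [map_add, h4, k3, ← map_add, ← map_add, add_sub_cancel]

end Bezout

/-! ### The Frobenius form of a triangular complete intersection -/

section Frobenius

open MvPolynomial

variable {R : Type*} [CommRing R] {n : ℕ} {M : ℕ} {f : Fin n → MvPolynomial (Fin n) R}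

lemma HasTop.map {S : Type*} [CommRing S] (φ : R →+* S) {p : MvPolynomial (Fin n) R}
    {β : Fin n →₀ ℕ} (hp : HasTop p β) : HasTop (MvPolynomial.map φ p) β := by
  have := map_mem_degreeLess φ hp
  simpa [HasTop] using this

/-- The residue functional with coefficients in an algebra. -/
noncomputable def residueFormBaseChange (B : Type*) [CommRing B] [Algebra R B]
    (hf : ∀ i, HasTop (f i) (Finsupp.single i M)) : MvPolynomial (Fin n) B →ₗ[B] B :=
  (basisMonomials (Fin n) B).constr B fun α => algebraMap R B (residueForm hf (monomial α 1))

variable {B : Type*} [CommRing B] [Algebra R B]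

lemma residueFormBaseChange_monomial (hf : ∀ i, HasTop (f i) (Finsupp.single i M))
    (α : Fin n →₀ ℕ) :
    residueFormBaseChange B hf (monomial α 1) = algebraMap R B (residueForm hf (monomial α 1)) := by
  have := (basisMonomials (Fin n) B).constr_basis B
    (fun α => algebraMap R B (residueForm hf (monomial α 1))) α
  simpa [residueFormBaseChange] using this

lemma monomial_eq_smul_one (α : Fin n →₀ ℕ) (c : R) :
    monomial α c = c • monomial α (1 : R) := by simp [smul_monomial]

lemma residueFormBaseChange_map (hf : ∀ i, HasTop (f i) (Finsupp.single i M))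
    (p : MvPolynomial (Fin n) R) :
    residueFormBaseChange B hf (map (algebraMap R B) p) = algebraMap R B (residueForm hf p) := by
  induction p using MvPolynomial.induction_on' with
  | monomial α c =>
    rw [map_monomial, monomial_eq_smul_one, map_smul, residueFormBaseChange_monomial,
      monomial_eq_smul_one α c, map_smul, smul_eq_mul, smul_eq_mul, map_mul]
  | add p q hp hq => rw [map_add, map_add, hp, hq, map_add, map_add]

lemma residueFormBaseChange_mul (hM : 0 < M) (hf : ∀ i, HasTop (f i) (Finsupp.single i M))
    (i : Fin n) (p : MvPolynomial (Fin n) B) :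
    residueFormBaseChange B hf (map (algebraMap R B) (f i) * p) = 0 := by
  induction p using MvPolynomial.induction_on' with
  | monomial α c =>
    have : monomial α c = c • map (algebraMap R B) (monomial α 1) := by
      rw [map_monomial, map_one, ← monomial_eq_smul_one]
    rw [this, mul_smul_comm, map_smul, ← map_mul, residueFormBaseChange_map, residueForm_mul hM,
      map_zero, smul_zero]
  | add p q hp hq => rw [mul_add, map_add, hp, hq, add_zero]

lemma residueFormBaseChange_eq_zero_of_mem (hf : ∀ i, HasTop (f i) (Finsupp.single i M))
    {p : MvPolynomial (Fin n) B} (hp : p ∈ degreeLess (Fin n) B (topExponent n M).degree) :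
    residueFormBaseChange B hf p = 0 := by
  rw [p.as_sum, map_sum]
  refine Finset.sum_eq_zero fun α hα => ?_
  rw [monomial_eq_smul_one, map_smul, residueFormBaseChange_monomial,
    residueForm_eq_zero_of_mem hf (monomial_mem_degreeLess (hp hα) 1), map_zero, smul_zero]

lemma residueFormBaseChange_eq_one (hM : 0 < M) (hf : ∀ i, HasTop (f i) (Finsupp.single i M))
    {p : MvPolynomial (Fin n) B} (hp : HasTop p (topExponent n M)) :
    residueFormBaseChange B hf p = 1 := by
  have h := residueFormBaseChange_eq_zero_of_mem hf hp
  rw [map_sub, residueFormBaseChange_monomial, residueForm_top hM, map_one] at h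
  exact sub_eq_zero.1 h

/-- The quotient of a polynomial ring by a triangular system is a Frobenius algebra whose trace form
is the multiple of the Frobenius form by the Jacobian determinant. -/
theorem exists_frobenius_form {K B : Type*} [Field K] [CommRing B] [Algebra K B]
    [Module.Finite K B] {f : Fin n → MvPolynomial (Fin n) K}
    (hM : 0 < M) (hf : ∀ i, HasTop (f i) (Finsupp.single i M))
    (π : MvPolynomial (Fin n) K →ₐ[K] B) (hπ : Function.Surjective π)
    (hker : RingHom.ker π = Ideal.span (Set.range f)) :
    ∃ η : B →ₗ[K] K, (∀ b, (∀ c, η (b * c) = 0) → b = 0) ∧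
      ∀ b, Algebra.trace K _ b = η (b * π (Matrix.of fun i j => pderiv j (f i)).det) := by
  classical
  obtain ⟨m, rfl⟩ : ∃ m, M = m + 1 := ⟨M - 1, by omega⟩
  let y : Fin n → B := fun j => π (X j)
  have heval : ∀ p : MvPolynomial (Fin n) K, eval y (map (algebraMap K B) p) = π p := by
    intro p
    rw [eval_map, ← aeval_def]
    exact congrArg (fun φ : MvPolynomial (Fin n) K →ₐ[K] B => φ p) (aeval_unique π).symm
  have hfB : ∀ i, HasTop (map (algebraMap K B) (f i)) (Finsupp.single i (m + 1)) :=
    fun i => (hf i).map _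
  choose a h1 h2 h3 h4 using fun i => exists_bezout_of_hasTop y i (hfB i)
  have hfJ : ∀ i, π (f i) = 0 := fun i => by
    have : f i ∈ RingHom.ker π := hker ▸ Ideal.subset_span ⟨i, rfl⟩
    exact this
  set A : Matrix (Fin n) (Fin n) (MvPolynomial (Fin n) B) := Matrix.of a with hA
  set Δ := A.det with hΔ
  -- The generic point `y` is a zero of the system in `B`, so the expansion has no constant term.
  have hAv : ∀ i, map (algebraMap K B) (f i) = ∑ j, A i j * (X j - C (y j)) := by
    intro i
    have := h1 i
    rwa [heval, hfJ, map_zero, sub_zero] at this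
  let ηB := residueFormBaseChange B hf
  have hηΔ : ηB Δ = 1 := by
    refine residueFormBaseChange_eq_one hM hf ?_
    have := hasTop_det A m (fun i => Finsupp.single i m) (by simp) h2 h3
    simpa [topExponent] using this
  -- Cramer's rule: `Δ` multiplies the ideal of the point `y` into the ideal of the system.
  have hcramer : ∀ j, ∃ c : Fin n → MvPolynomial (Fin n) B,
      Δ * (X j - C (y j)) = ∑ i, c i * map (algebraMap K B) (f i) := by
    intro j
    refine ⟨fun i => A.adjugate j i, ?_⟩
    have h := congrFun (congrArg (fun N => N.mulVec fun j => (X j - C (y j))) A.adjugate_mul) j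
    simp only [← Matrix.mulVec_mulVec, Matrix.smul_mulVec, Matrix.one_mulVec, Pi.smul_apply,
      smul_eq_mul] at h
    rw [hΔ, ← h, Matrix.mulVec, dotProduct]
    refine Finset.sum_congr rfl fun i _ => ?_
    rw [hAv i]; rfl
  have hlin : ∀ j (p : MvPolynomial (Fin n) B), ηB (Δ * (X j - C (y j)) * p) = 0 := by
    intro j p
    obtain ⟨c, hc⟩ := hcramer j
    rw [hc, Finset.sum_mul, map_sum]
    refine Finset.sum_eq_zero fun i _ => ?_
    rw [mul_comm (c i), mul_assoc]
    exact residueFormBaseChange_mul hM hf i _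
  -- Modulo the ideal of `y`, `p` is the constant `p(y)`, and `ηB Δ = 1` because `Δ` has the top
  -- exponent as its leading monomial.
  have hmul : ∀ p : MvPolynomial (Fin n) B, ηB (Δ * p) = eval y p := by
    intro p
    obtain ⟨c, hc, -, -⟩ := exists_bezout y p _
      (totalDegree_lt_mem_degreeLess (Nat.lt_succ_self _))
    rw [sub_eq_iff_eq_add] at hc
    nth_rewrite 1 [hc]
    rw [mul_add, map_add, Finset.mul_sum, map_sum, Finset.sum_eq_zero, zero_add, mul_comm,
      ← smul_eq_C_mul, map_smul, hηΔ, smul_eq_mul, mul_one]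
    intro j _
    rw [mul_comm (c j), ← mul_assoc]
    exact hlin j _
  obtain ⟨η, hη⟩ : ∃ η : B →ₗ[K] K, ∀ p, η (π p) = residueForm hf p := by
    have hle : LinearMap.ker π.toLinearMap ≤ LinearMap.ker (residueForm hf) := fun p hp =>
      residueForm_eq_zero_of_mem_span hM hf (hker ▸ hp)
    obtain ⟨s, hs⟩ := π.toLinearMap.exists_rightInverse_of_surjective
      (LinearMap.range_eq_top.2 hπ)
    refine ⟨residueForm hf ∘ₗ s, fun p => ?_⟩
    have : s (π p) - p ∈ LinearMap.ker (residueForm hf) := hle <| by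
      rw [LinearMap.mem_ker, map_sub, sub_eq_zero]
      exact congrArg (fun g : B →ₗ[K] B => g (π p)) hs
    rw [LinearMap.mem_ker, map_sub, sub_eq_zero] at this
    exact this
  let xp : (Fin n →₀ ℕ) → B := fun α => π (monomial α 1)
  -- The identity `ηB (Δ p) = p(y)` read coefficientwise: the monomials and the coefficients of `Δ`
  -- are dual families for `η`. Nondegeneracy is immediate from this.
  have hexp : ∀ b : B, b = ∑ α ∈ Δ.support, η (xp α * b) • coeff α Δ := by
    intro b
    obtain ⟨p, rfl⟩ := hπ b
    have h0 : π p = ηB (Δ * map (algebraMap K B) p) := by rw [hmul, heval]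
    rw [h0]
    nth_rewrite 1 [Δ.as_sum]
    rw [Finset.sum_mul, map_sum]
    refine Finset.sum_congr rfl fun α _ => ?_
    have : monomial α (coeff α Δ) * map (algebraMap K B) p =
        coeff α Δ • map (algebraMap K B) (monomial α 1 * p) := by
      rw [monomial_eq_smul_one, map_mul, map_monomial, map_one (algebraMap K B), smul_mul_assoc]
    have h2 : ηB (map (algebraMap K B) (monomial α 1 * p)) = _ := residueFormBaseChange_map hf _
    rw [this, map_smul, h2, ← hη, map_mul, smul_eq_mul, Algebra.smul_def, mul_comm, h0]
  refine ⟨η, fun b hb => ?_, fun b => ?_⟩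
  · rw [hexp b]
    refine Finset.sum_eq_zero fun α _ => ?_
    rw [mul_comm, hb, zero_smul]
  -- Multiplication by `b` becomes a sum of rank one maps, whose traces add up to `η (b Δ(y))`; and
  -- `Δ(y)` is the Jacobian determinant.
  · have hl : LinearMap.mulLeft K b = ∑ α ∈ Δ.support,
        (η ∘ₗ LinearMap.mulLeft K (xp α)).smulRight (b * coeff α Δ) := by
      ext c
      conv_lhs => rw [LinearMap.mulLeft_apply, hexp c, Finset.mul_sum]
      rw [LinearMap.sum_apply]
      refine Finset.sum_congr rfl fun α _ => ?_
      simp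
    have htr : Algebra.trace K B b = LinearMap.trace K B (LinearMap.mulLeft K b) := rfl
    have hdet : π (Matrix.of fun i j => pderiv j (f i)).det = eval y Δ := by
      rw [hΔ, RingHom.map_det, AlgHom.map_det]
      congr 1
      ext i j
      have := h4 i j
      rw [pderiv_map, heval] at this
      exact this.symm
    rw [htr, hl, map_sum]
    simp only [LinearMap.trace_smulRight, LinearMap.comp_apply, LinearMap.mulLeft_apply]
    rw [← map_sum, hdet, eval_eq, Finset.mul_sum]
    congr 1
    refine Finset.sum_congr rfl fun α _ => ?_
    have : xp α = ∏ i, y i ^ α i := by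
      simp only [xp, y, ← map_pow, ← map_prod]
      rw [monomial_eq, C_1, one_mul, Finsupp.prod_fintype _ _ (by simp)]
    have hp : ∏ i ∈ α.support, y i ^ α i = ∏ i, y i ^ α i := by
      rw [← Finsupp.prod_fintype α (fun i k => y i ^ k) (by simp)]; rfl
    rw [this, hp]; ring

end Frobenius

/-! ### Local idempotents of Artinian rings -/

section LocalIdempotent

variable {B S : Type*} [CommRing B] [CommRing S]

/-- The idempotent `e` cuts out the local factor at `p` of an Artinian ring. -/
structure IsLocalIdempotent (p : Ideal B) (e : B) : Prop where
  idem : e * e = e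
  one_sub_mem : 1 - e ∈ p
  exists_mul_eq : ∀ t, t ∉ p → ∃ u, e = u * t
  exists_pow : ∃ N : ℕ, ∀ x ∈ p ^ N, e * x = 0

/-- The powers of `p` stabilize at an idempotent finitely generated ideal, which is generated by an
idempotent `g`; take `e = 1 - g`. -/
lemma exists_isLocalIdempotent [IsArtinianRing B] (p : Ideal B) [hp : p.IsMaximal] :
    ∃ e, IsLocalIdempotent p e := by
  obtain ⟨N, hN⟩ := IsArtinian.monotone_stabilizes
    (⟨fun k => OrderDual.toDual (p ^ (k + 1)), fun a b h => Ideal.pow_le_pow_right (by omega)⟩ :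
      ℕ →o (Ideal B)ᵒᵈ)
  have hN' : ∀ m, N ≤ m → p ^ (N + 1) = p ^ (m + 1) := hN
  have hidem : IsIdempotentElem (p ^ (N + 1)) := by
    rw [IsIdempotentElem, ← pow_add, show N + 1 + (N + 1) = (2 * N + 1) + 1 by ring]
    exact (hN' _ (by omega)).symm
  obtain ⟨g, hg, hspan⟩ := (Ideal.isIdempotentElem_iff_of_fg _ (IsNoetherian.noetherian _)).1 hidem
  have hg' : g * g = g := hg
  have hgp : g ∈ p ^ (N + 1) := by rw [hspan]; exact Ideal.mem_span_singleton_self g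
  refine ⟨1 - g, by ring_nf; rw [pow_two, hg']; ring, ?_, fun t ht => ?_, N + 1, fun x hx => ?_⟩
  · rw [sub_sub_cancel]; exact Ideal.pow_le_self (Nat.succ_ne_zero N) hgp
  · have h1 : IsCoprime (Ideal.span {t}) (p ^ (N + 1)) := by
      refine IsCoprime.pow_right ?_
      rw [Ideal.isCoprime_iff_sup_eq, sup_comm]
      exact (Ideal.isMaximal_def.1 hp).2 _ (Submodule.lt_sup_iff_notMem.2 ht)
    rw [Ideal.isCoprime_iff_exists] at h1
    obtain ⟨i, hi, j, hj, hij⟩ := h1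
    obtain ⟨u, rfl⟩ := Ideal.mem_span_singleton'.1 hi
    rw [hspan] at hj
    obtain ⟨v, rfl⟩ := Ideal.mem_span_singleton'.1 hj
    refine ⟨(1 - g) * u, ?_⟩
    calc 1 - g = (1 - g) * (u * t + v * g) := by rw [hij, mul_one]
      _ = (1 - g) * u * t + v * (g - g * g) := by ring
      _ = (1 - g) * u * t := by rw [hg', sub_self, mul_zero, add_zero]
  · rw [hspan, Ideal.mem_span_singleton'] at hx
    obtain ⟨a, rfl⟩ := hx
    rw [mul_comm a, ← mul_assoc, sub_mul, one_mul, hg', sub_self, zero_mul]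

namespace IsLocalIdempotent

variable {p : Ideal B} {e : B}

lemma notMem (he : IsLocalIdempotent p e) (hp : p ≠ ⊤) : e ∉ p := fun h =>
  hp ((Ideal.eq_top_iff_one p).2 (by simpa using p.add_mem he.one_sub_mem h))

lemma unique {e' : B} (he : IsLocalIdempotent p e) (he' : IsLocalIdempotent p e') (hp : p ≠ ⊤) :
    e = e' := by
  obtain ⟨u, hu⟩ := he.exists_mul_eq e' (he'.notMem hp)
  obtain ⟨v, hv⟩ := he'.exists_mul_eq e (he.notMem hp)
  have h1 : e * e' = e := by rw [hu, mul_assoc, he'.idem]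
  have h2 : e' * e = e' := by rw [hv, mul_assoc, he.idem]
  rw [← h1, mul_comm, h2]

lemma map {q : Ideal S} {e : S} (φ : S →+* B) (hφ : Function.Surjective φ)
    (hq : q = p.comap φ) (he : IsLocalIdempotent q e) : IsLocalIdempotent p (φ e) := by
  subst hq
  refine ⟨by rw [← map_mul, he.idem], ?_, fun t ht => ?_, ?_⟩
  · have := he.one_sub_mem
    rwa [Ideal.mem_comap, map_sub, map_one] at this
  · obtain ⟨t, rfl⟩ := hφ t
    obtain ⟨u, hu⟩ := he.exists_mul_eq t ht
    exact ⟨φ u, by rw [← map_mul, ← hu]⟩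
  · obtain ⟨N, hN⟩ := he.exists_pow
    refine ⟨N, fun x hx => ?_⟩
    have h1 : p ^ N = (p.comap φ ^ N).map φ := by
      rw [Ideal.map_pow, Ideal.map_comap_of_surjective φ hφ]
    rw [h1, Ideal.mem_map_iff_of_surjective φ hφ] at hx
    obtain ⟨y, hy, rfl⟩ := hx
    rw [← map_mul, hN y hy, map_zero]

lemma isNilpotent (he : IsLocalIdempotent p e) {b : B} (hb : b ∈ p) : IsNilpotent (e * b) := by
  obtain ⟨N, hN⟩ := he.exists_pow
  refine ⟨N + 1, ?_⟩
  rw [mul_pow, pow_succ e, mul_assoc,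
    hN _ (Ideal.pow_le_pow_right (Nat.le_succ N) (Ideal.pow_mem_pow hb _)), mul_zero]

lemma mul_eq_self (he : IsLocalIdempotent p e) {s : B} (hs : ∀ x ∈ p, x * s = 0) : e * s = s := by
  have := hs _ he.one_sub_mem
  rw [sub_mul, one_mul, sub_eq_zero] at this
  exact this.symm

/-- A nonzero ideal inside the local factor contains a nonzero socle element. -/
lemma exists_socle (he : IsLocalIdempotent p e) (I : Ideal B) {b : B} (hb : b ∈ I)
    (hb0 : e * b ≠ 0) : ∃ s ∈ I, s ≠ 0 ∧ ∀ x ∈ p, x * s = 0 := by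
  obtain ⟨N, hN⟩ := he.exists_pow
  -- Induction on the power of `p` that kills `e * c`: a nonzero product with an element of the last
  -- power that does not kill it is a socle element.
  have key : ∀ k : ℕ, ∀ c ∈ I, e * c ≠ 0 → (∀ x ∈ p ^ k, x * (e * c) = 0) →
      ∃ s ∈ I, s ≠ 0 ∧ ∀ x ∈ p, x * s = 0 := by
    intro k
    induction k with
    | zero => intro c _ hc0 h; exact absurd (by simpa using h 1 (by simp)) hc0
    | succ k ih =>
      intro c hc hc0 h
      by_cases hx : ∃ x ∈ p ^ k, x * (e * c) ≠ 0
      · obtain ⟨x, hx, hne⟩ := hx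
        refine ⟨x * (e * c), I.mul_mem_left _ (I.mul_mem_left _ hc), hne, fun y hy => ?_⟩
        rw [← mul_assoc]
        exact h _ (by rw [pow_succ']; exact Ideal.mul_mem_mul hy hx)
      · push Not at hx
        exact ih c hc hc0 hx
  refine key N b hb hb0 fun x hx => ?_
  rw [← mul_assoc, mul_comm x, hN x hx, zero_mul]

end IsLocalIdempotent

end LocalIdempotent

/-! ### Socles of Frobenius algebras -/

section FrobeniusLocal

variable {K B : Type*} [Field K] [CommRing B] [Algebra K B]

/-- The elements killed by an ideal, as a subspace. -/
def killedBy (K : Type*) {B : Type*} [Field K] [CommRing B] [Algebra K B] (q : Ideal B) :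
    Submodule K B where
  carrier := {b | ∀ x ∈ q, x * b = 0}
  add_mem' ha hb x hx := by rw [mul_add, ha x hx, hb x hx, add_zero]
  zero_mem' x _ := mul_zero x
  smul_mem' c b hb x hx := by rw [mul_smul_comm, hb x hx, smul_zero]

/-- By nondegeneracy, `w ↦ η (w · _)` embeds the annihilator of `q` into the dual of `B ⧸ q`. -/
lemma finrank_killedBy_le [Module.Finite K B] {η : B →ₗ[K] K} (hη : ∀ b, (∀ c, η (b * c) = 0) → b = 0) (q : Ideal B) :
    Module.finrank K (killedBy K q) ≤ Module.finrank K (B ⧸ q) := by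
  let Q : Submodule K B := q.restrictScalars K
  let φ : killedBy K q →ₗ[K] Module.Dual K (B ⧸ Q) :=
    { toFun := fun w => Q.liftQ (η ∘ₗ LinearMap.mulLeft K (w : B)) fun x hx => by
        change η (w * x) = 0
        rw [mul_comm, w.2 x hx, map_zero]
      map_add' := fun v w => by ext x; simp [add_mul]
      map_smul' := fun c w => by ext x; simp }
  have hφ : Function.Injective φ := by
    rw [← LinearMap.ker_eq_bot, LinearMap.ker_eq_bot']
    intro w hw
    refine Subtype.ext (hη _ fun c => ?_)
    exact congrArg (fun g : Module.Dual K (B ⧸ Q) => g (Q.mkQ c)) hw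
  have h1 := LinearMap.finrank_le_finrank_of_injective hφ
  rw [Subspace.dual_finrank_eq] at h1
  exact h1

/-- The annihilator of `s` is exactly `q`, by maximality, so `B ⧸ q` embeds by `x ↦ x s`. -/
lemma finrank_quotient_le_span [Module.Finite K B] {q : Ideal B} [hq : q.IsMaximal] {s : B} (hs : s ≠ 0)
    (hqs : ∀ x ∈ q, x * s = 0) :
    Module.finrank K (B ⧸ q) ≤ Module.finrank K ((Ideal.span {s}).restrictScalars K) := by
  let Q : Submodule K B := q.restrictScalars K
  let φ : (B ⧸ Q) →ₗ[K] (Ideal.span {s}).restrictScalars K :=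
    Q.liftQ ((LinearMap.mulRight K s).codRestrict _ fun x => Ideal.mem_span_singleton'.2 ⟨x, rfl⟩)
      fun x hx => Subtype.ext (hqs x hx)
  have hφ : Function.Injective φ := by
    rw [← LinearMap.ker_eq_bot, LinearMap.ker_eq_bot']
    intro w
    obtain ⟨x, rfl⟩ := Q.mkQ_surjective w
    intro hw
    have h1 : x * s = 0 := congrArg Subtype.val hw
    refine (Submodule.Quotient.mk_eq_zero Q).2 ?_
    by_contra hx
    obtain ⟨y, hy⟩ := (Ideal.IsMaximal.exists_inv hq hx)
    obtain ⟨i, hi, h⟩ := hy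
    refine hs ?_
    have : (y * x + i) * s = 0 := by rw [add_mul, mul_assoc, h1, hqs i hi]; simp
    rwa [h, one_mul] at this
  exact LinearMap.finrank_le_finrank_of_injective hφ

/-- In a Frobenius algebra the socle at a maximal ideal is generated by any nonzero element. -/
lemma killedBy_le_span [Module.Finite K B] {η : B →ₗ[K] K} (hη : ∀ b, (∀ c, η (b * c) = 0) → b = 0)
    {q : Ideal B} [q.IsMaximal] {s : B} (hs : s ≠ 0) (hqs : ∀ x ∈ q, x * s = 0) {c : B}
    (hc : ∀ x ∈ q, x * c = 0) : c ∈ Ideal.span {s} := by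
  have hle : (Ideal.span {s}).restrictScalars K ≤ killedBy K q := by
    intro x hx y hy
    obtain ⟨a, rfl⟩ := Ideal.mem_span_singleton'.1 hx
    rw [mul_left_comm, hqs y hy, mul_zero]
  have h := Submodule.eq_of_le_of_finrank_le hle
    ((finrank_killedBy_le hη q).trans (finrank_quotient_le_span hs hqs))
  have : c ∈ killedBy K q := hc
  rw [← h] at this
  exact this

end FrobeniusLocal

/-! ### The Jacobian ideal and its covering Frobenius algebras -/

section JacobianIdeal

open MvPolynomial

variable {K S : Type*} [Field K] [CommRing S] [Algebra K S] {n : ℕ}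

/-- The gradient of a polynomial, with values in an algebra. -/
noncomputable def polyGrad (π : MvPolynomial (Fin n) K →ₐ[K] S) (f : MvPolynomial (Fin n) K) :
    Fin n → S := fun j => π (pderiv j f)

/-- The ideal generated by the Jacobian determinants of the relations of a presentation. -/
def jacobianIdeal (π : MvPolynomial (Fin n) K →ₐ[K] S) : Ideal S :=
  Ideal.span {d | ∃ f : Fin n → MvPolynomial (Fin n) K, (∀ i, π (f i) = 0) ∧
    d = (Matrix.of fun i => polyGrad π (f i)).det}

variable {π : MvPolynomial (Fin n) K →ₐ[K] S}

lemma polyGrad_mul (f g : MvPolynomial (Fin n) K) :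
    polyGrad π (f * g) = π f • polyGrad π g + π g • polyGrad π f := by
  ext j
  simp [polyGrad, Derivation.leibniz]

lemma polyGrad_add (f g : MvPolynomial (Fin n) K) :
    polyGrad π (f + g) = polyGrad π f + polyGrad π g := by
  ext j; simp [polyGrad]

lemma polyGrad_sub (f g : MvPolynomial (Fin n) K) :
    polyGrad π (f - g) = polyGrad π f - polyGrad π g := by
  ext j; simp [polyGrad]

lemma polyGrad_eq_zero_of_mem_sq {f : MvPolynomial (Fin n) K} (hf : f ∈ RingHom.ker π ^ 2) :
    polyGrad π f = 0 := by
  rw [pow_two] at hf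
  refine Submodule.mul_induction_on hf (fun a ha b hb => ?_) fun a b ha hb => ?_
  · rw [polyGrad_mul, show π a = 0 from ha, show π b = 0 from hb, zero_smul, zero_smul, add_zero]
  · rw [polyGrad_add, ha, hb, add_zero]

lemma polyGrad_eq_of_sub_mem_sq {f g : MvPolynomial (Fin n) K} (hf : f - g ∈ RingHom.ker π ^ 2) :
    polyGrad π f = polyGrad π g := by
  have := polyGrad_eq_zero_of_mem_sq hf
  rwa [polyGrad_sub, sub_eq_zero] at this

lemma map_det_pderiv (f : Fin n → MvPolynomial (Fin n) K) :
    π (Matrix.of fun i j => pderiv j (f i)).det = (Matrix.of fun i => polyGrad π (f i)).det := by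
  rw [AlgHom.map_det]; rfl

lemma hasTop_aeval_X (i : Fin n) {h : Polynomial K} (hh : h.Monic) :
    HasTop (Polynomial.aeval (X i : MvPolynomial (Fin n) K) h)
      (Finsupp.single i h.natDegree) := by
  rw [Polynomial.aeval_eq_sum_range, Finset.sum_range_succ, HasTop, hh.coeff_natDegree, one_smul,
    X_pow_eq_monomial, add_sub_cancel_right, Finsupp.degree_single]
  refine Submodule.sum_mem _ fun k hk => Submodule.smul_mem _ _ ?_
  rw [X_pow_eq_monomial]
  exact monomial_mem_degreeLess (by simpa using hk) _

/-- Relations of a finite algebra may be changed, modulo squares, to a triangular system. -/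
lemma exists_triangular [Module.Finite K S] (f : Fin n → MvPolynomial (Fin n) K)
    (hf : ∀ i, π (f i) = 0) :
    ∃ (M : ℕ) (g : Fin n → MvPolynomial (Fin n) K), 0 < M ∧
      (∀ i, HasTop (g i) (Finsupp.single i M)) ∧ (∀ i, π (g i) = 0) ∧
      ∀ i, g i - f i ∈ RingHom.ker π ^ 2 := by
  -- One monic polynomial for all coordinates gives a common exponent `M`. The factor `X` keeps its
  -- degree positive even if the product is `1`.
  let h : Polynomial K := Polynomial.X * ∏ i, minpoly K (π (X i))
  have hmon : h.Monic := Polynomial.monic_X.mul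
    (Polynomial.monic_prod_of_monic _ _ fun i _ => minpoly.monic (Algebra.IsIntegral.isIntegral _))
  have hdeg : 0 < h.natDegree := by
    rw [Polynomial.natDegree_pos_iff_degree_pos]
    have : h.natDegree ≠ 0 := by
      rw [Polynomial.natDegree_X_mul]
      · exact Nat.succ_ne_zero _
      · exact (Polynomial.monic_prod_of_monic _ _ fun i _ =>
          minpoly.monic (Algebra.IsIntegral.isIntegral _)).ne_zero
    exact Polynomial.natDegree_pos_iff_degree_pos.1 (Nat.pos_of_ne_zero this)
  have hzero : ∀ i, Polynomial.aeval (π (X i)) h = 0 := by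
    intro i
    have : minpoly K (π (X i)) ∣ h := (Finset.dvd_prod_of_mem _ (Finset.mem_univ i)).mul_left _
    obtain ⟨c, hc⟩ := this
    rw [hc, map_mul, minpoly.aeval, zero_mul]
  -- Being at least `2` puts the added power in the square of the kernel; exceeding every degree
  -- makes that power dominate `f i`.
  let N := 2 + ∑ i, (f i).totalDegree
  have hker : ∀ i, Polynomial.aeval (X i) h ∈ RingHom.ker π := by
    intro i
    rw [RingHom.mem_ker, ← Polynomial.aeval_algHom_apply, hzero]
  have hker2 : ∀ i, Polynomial.aeval (X i) h ^ N ∈ RingHom.ker π ^ 2 := fun i =>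
    Ideal.pow_le_pow_right (by omega) (Ideal.pow_mem_pow (hker i) N)
  refine ⟨N * h.natDegree, fun i => f i + Polynomial.aeval (X i) h ^ N,
    Nat.mul_pos (by omega) hdeg, fun i => ?_, fun i => ?_, fun i => ?_⟩
  · have h1 := (hasTop_aeval_X i hmon).pow N
    have h2 : N • Finsupp.single i h.natDegree = Finsupp.single i (N * h.natDegree) := by simp
    rw [h2] at h1
    rw [HasTop, add_sub_assoc]
    refine Submodule.add_mem _ (totalDegree_lt_mem_degreeLess ?_) h1
    rw [Finsupp.degree_single]
    have h3 : (f i).totalDegree ≤ ∑ i, (f i).totalDegree :=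
      Finset.single_le_sum (f := fun i => (f i).totalDegree) (fun _ _ => Nat.zero_le _)
        (Finset.mem_univ i)
    calc (f i).totalDegree < N := by omega
      _ ≤ N * h.natDegree := Nat.le_mul_of_pos_right N hdeg
  · rw [map_add, hf, zero_add]
    exact Ideal.pow_le_self (by norm_num) (hker2 i)
  · rw [add_sub_cancel_left]; exact hker2 i

/-- The kernel of the presentation is generated at `p` by a family of `n` polynomials. -/
def GeneratesAt (π : MvPolynomial (Fin n) K →ₐ[K] S) (p : Ideal S)
    (f : Fin n → MvPolynomial (Fin n) K) : Prop :=
  ∃ t, π t ∉ p ∧ ∀ g, π g = 0 → t * g ∈ Ideal.span (Set.range f)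

/-- The Frobenius algebra that covers `S`, attached to a triangular system `g` of relations. -/
structure FrobeniusCover (π : MvPolynomial (Fin n) K →ₐ[K] S) (g : Fin n → MvPolynomial (Fin n) K)
    (B : Type*) [CommRing B] [Algebra K B] where
  ρ : MvPolynomial (Fin n) K →ₐ[K] B
  ker_ρ : RingHom.ker ρ = Ideal.span (Set.range g)
  ρ_surjective : Function.Surjective ρ
  φ : B →ₐ[K] S
  φ_ρ : ∀ a, φ (ρ a) = π a
  η : B →ₗ[K] K
  nondegenerate : ∀ b, (∀ c, η (b * c) = 0) → b = 0
  J : B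
  trace_eq : ∀ b, Algebra.trace K B b = η (b * J)
  φ_J : φ J = (Matrix.of fun i => polyGrad π (g i)).det

lemma exists_frobeniusCover {M : ℕ} (hM : 0 < M) {g : Fin n → MvPolynomial (Fin n) K}
    (hg : ∀ i, HasTop (g i) (Finsupp.single i M)) (hgπ : ∀ i, π (g i) = 0) :
    Nonempty (FrobeniusCover π g (MvPolynomial (Fin n) K ⧸ Ideal.span (Set.range g))) := by
  have hfin := finite_quotient_of_hasTop hM hg
  obtain ⟨η, h1, h2⟩ := exists_frobenius_form hM hg (Ideal.Quotient.mkₐ K (Ideal.span (Set.range g)))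
    (Ideal.Quotient.mkₐ_surjective K _) (Ideal.Quotient.mkₐ_ker K _)
  have hle : ∀ a ∈ Ideal.span (Set.range g), π a = 0 := by
    have : Ideal.span (Set.range g) ≤ RingHom.ker π := by
      rw [Ideal.span_le]; rintro _ ⟨i, rfl⟩; exact hgπ i
    exact fun a ha => this ha
  refine ⟨⟨Ideal.Quotient.mkₐ K _, Ideal.Quotient.mkₐ_ker K _, Ideal.Quotient.mkₐ_surjective K _,
    Ideal.Quotient.liftₐ _ π hle, fun a => rfl, η, h1, _, h2, ?_⟩⟩
  rw [← map_det_pderiv]; rfl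

end JacobianIdeal

/-! ### The Jacobian ideal at one point -/

section JacobianLocal

open MvPolynomial

universe u v

variable {K : Type u} {S : Type v} [Field K] [CommRing S] [Algebra K S] {n : ℕ}
  {π : MvPolynomial (Fin n) K →ₐ[K] S}

namespace FrobeniusCover

variable {g : Fin n → MvPolynomial (Fin n) K} {B : Type*} [CommRing B] [Algebra K B]
  (F : FrobeniusCover π g B) {p : Ideal S}

include F in
lemma φ_surjective (hπ : Function.Surjective π) : Function.Surjective F.φ := fun s => by
  obtain ⟨a, rfl⟩ := hπ s
  exact ⟨F.ρ a, F.φ_ρ a⟩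

/-- Every multiple `b c` is nilpotent, hence of trace zero, so `η (b J c) = 0` for all `c`. Together
with nilpotency of `e q` this puts `e J` in the socle at `q`. -/
lemma mul_J_eq_zero {b : B} (hb : IsNilpotent b) : b * F.J = 0 := by
  refine F.nondegenerate _ fun c => ?_
  rw [mul_right_comm, ← F.trace_eq]
  exact (Algebra.isNilpotent_trace_of_isNilpotent
    ((Commute.all b c).isNilpotent_mul_right hb)).eq_zero

lemma socle_J {q : Ideal B} {e : B} (he : IsLocalIdempotent q e) :
    ∀ x ∈ q, x * (e * F.J) = 0 := fun x hx => by
  rw [← mul_assoc, mul_comm x]; exact F.mul_J_eq_zero (he.isNilpotent hx)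

/-- If `ker φ` met the local factor, it would contain a nonzero socle element. That element
generates the socle, hence also `e J`, whose image in `S` would then vanish. -/
lemma mul_eq_zero_of_mul_J_ne_zero [Module.Finite K B] {q : Ideal B} [q.IsMaximal] {e : B}
    (he : IsLocalIdempotent q e) (hJ : F.φ (e * F.J) ≠ 0) {b : B} (hb : F.φ b = 0) :
    e * b = 0 := by
  by_contra h
  obtain ⟨s, hs, hs0, hqs⟩ := he.exists_socle (RingHom.ker F.φ) hb h
  have h1 := killedBy_le_span F.nondegenerate hs0 hqs (F.socle_J he)
  have h2 : Ideal.span {s} ≤ RingHom.ker F.φ := (Ideal.span_singleton_le_iff_mem _).2 hs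
  exact hJ (h2 h1)

/-- Nakayama: in `B` the `g i` vanish, so the `f i` lie in the square of `I = ker φ`. As they
generate `I` at `p`, `e I` lies in every power of `I`, and a high power is killed by `e`. -/
lemma mul_eq_zero_of_generatesAt {f : Fin n → MvPolynomial (Fin n) K}
    (hfg : ∀ i, g i - f i ∈ RingHom.ker π ^ 2) (hf : GeneratesAt π p f) {e : B}
    (he : IsLocalIdempotent (p.comap F.φ) e) {b : B} (hb : F.φ b = 0) : e * b = 0 := by
  obtain ⟨t, ht, htf⟩ := hf
  let I : Ideal B := RingHom.ker F.φ
  have hker : RingHom.ker π = I.comap F.ρ := by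
    ext a; simp only [Ideal.mem_comap, I, RingHom.mem_ker, F.φ_ρ]
  have hf2 : ∀ i, F.ρ (f i) ∈ I ^ 2 := by
    intro i
    have h1 : F.ρ (g i) = 0 := by
      have : g i ∈ RingHom.ker F.ρ := F.ker_ρ ▸ Ideal.subset_span ⟨i, rfl⟩
      exact this
    have h2 : F.ρ (g i - f i) ∈ I ^ 2 := by
      have := Ideal.mem_map_of_mem F.ρ (hfg i)
      rw [Ideal.map_pow, hker, Ideal.map_comap_of_surjective F.ρ F.ρ_surjective] at this
      exact this
    rw [map_sub, h1, zero_sub] at h2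
    exact neg_mem_iff.1 h2
  have hstep : ∀ b ∈ I, e * b ∈ I * I := by
    intro b hb
    obtain ⟨a, rfl⟩ := F.ρ_surjective b
    obtain ⟨u, hu⟩ := he.exists_mul_eq (F.ρ t) (by rwa [Ideal.mem_comap, F.φ_ρ])
    have h1 : t * a ∈ Ideal.span (Set.range f) := htf a (by rw [← F.φ_ρ]; exact hb)
    have h2 : Ideal.span (Set.range f) ≤ (I ^ 2).comap F.ρ := by
      rw [Ideal.span_le]; rintro _ ⟨i, rfl⟩; exact hf2 i
    have h3 : F.ρ (t * a) ∈ I ^ 2 := h2 h1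
    rw [hu, mul_assoc, ← map_mul, ← pow_two]
    exact Ideal.mul_mem_left _ _ h3
  have hpow : ∀ k : ℕ, ∀ b ∈ I, e * b ∈ I ^ (k + 1) := by
    intro k
    induction k with
    | zero => intro b hb; simpa using I.mul_mem_left e hb
    | succ k ih =>
      intro b hb
      rw [← he.idem, mul_assoc]
      refine Submodule.mul_induction_on (hstep b hb) (fun x hx y hy => ?_) fun x y hx hy => ?_
      · rw [← mul_assoc, pow_succ]
        exact Ideal.mul_mem_mul (ih x hx) hy
      · rw [mul_add]; exact Ideal.add_mem _ hx hy
  obtain ⟨N, hN⟩ := he.exists_pow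
  have hIq : I ≤ p.comap F.φ := fun x hx => by
    rw [Ideal.mem_comap, show F.φ x = 0 from hx]; exact p.zero_mem
  rw [← he.idem, mul_assoc]
  exact hN _ (Ideal.pow_right_mono hIq N (Ideal.pow_le_pow_right (Nat.le_succ N) (hpow N b hb)))

end FrobeniusCover

variable [Module.Finite K S]

/-- Interface for the local arguments: gradients ignore squares of relations, so the Jacobian of
arbitrary relations lifts to the Frobenius algebra of a triangular system. -/
lemma exists_frobenius_of_isLocalIdempotent (hπ : Function.Surjective π) (p : Ideal S)
    [hp : p.IsMaximal] {e : S} (he : IsLocalIdempotent p e) {f : Fin n → MvPolynomial (Fin n) K}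
    (hf : ∀ i, π (f i) = 0) :
    ∃ (M : ℕ) (g : Fin n → MvPolynomial (Fin n) K) (B : Type u) (_ : CommRing B)
      (_ : Algebra K B) (_ : Module.Finite K B) (F : FrobeniusCover π g B) (e' : B),
      0 < M ∧ (∀ i, HasTop (g i) (Finsupp.single i M)) ∧ (∀ i, π (g i) = 0) ∧
      (∀ i, g i - f i ∈ RingHom.ker π ^ 2) ∧ (p.comap F.φ).IsMaximal ∧
      IsLocalIdempotent (p.comap F.φ) e' ∧ F.φ e' = e ∧
      F.φ F.J = (Matrix.of fun i => polyGrad π (f i)).det := by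
  obtain ⟨M, g, hM, hg, hgπ, hfg⟩ := exists_triangular f hf
  obtain ⟨F⟩ := exists_frobeniusCover hM hg hgπ
  have hfin := finite_quotient_of_hasTop hM hg
  have hart : IsArtinianRing (MvPolynomial (Fin n) K ⧸ Ideal.span (Set.range g)) :=
    IsArtinianRing.of_finite K _
  have hmax : (p.comap F.φ).IsMaximal :=
    Ideal.comap_isMaximal_of_surjective F.φ (F.φ_surjective hπ)
  obtain ⟨e', he'⟩ := exists_isLocalIdempotent (p.comap F.φ)
  refine ⟨M, g, MvPolynomial (Fin n) K ⧸ Ideal.span (Set.range g), _, _, hfin, F, e', hM, hg, hgπ, hfg, hmax, he',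
    (he'.map F.φ.toRingHom (F.φ_surjective hπ) rfl).unique he hp.ne_top, ?_⟩
  rw [F.φ_J]
  congr 1
  ext i j
  exact congrFun (polyGrad_eq_of_sub_mem_sq (hfg i)) j

/-- The Jacobian ideal is killed by the maximal ideals of the local factors. -/
lemma jacobianIdeal_mul (hπ : Function.Surjective π) {p : Ideal S} [p.IsMaximal]
    {e : S} (he : IsLocalIdempotent p e) {x : S} (hx : x ∈ p) {s : S} (hs : s ∈ jacobianIdeal π) :
    x * (e * s) = 0 := by
  induction hs using Submodule.span_induction with
  | mem s hs =>
    obtain ⟨f, hf, rfl⟩ := hs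
    obtain ⟨M, g, B, _, _, _, F, e', -, -, -, -, -, he', rfl, hJ⟩ :=
      exists_frobenius_of_isLocalIdempotent hπ p he hf
    obtain ⟨b, rfl⟩ := F.φ_surjective hπ x
    rw [← hJ, ← map_mul, ← map_mul, F.socle_J he' b hx, map_zero]
  | zero => simp
  | add a b _ _ ha hb => rw [mul_add, mul_add, ha, hb, add_zero]
  | smul c a _ ha => rw [smul_eq_mul, mul_left_comm e, mul_left_comm, ha, mul_zero]

/-- If the Jacobian ideal is nonzero at `p`, then a triangular system generates the relations
at `p`. -/
lemma exists_generatesAt (hπ : Function.Surjective π) {p : Ideal S} [hp : p.IsMaximal] {s : S}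
    (hs : s ∈ jacobianIdeal π) (hs0 : s ≠ 0) (hps : ∀ x ∈ p, x * s = 0) :
    ∃ (M : ℕ) (g : Fin n → MvPolynomial (Fin n) K), 0 < M ∧
      (∀ i, HasTop (g i) (Finsupp.single i M)) ∧ (∀ i, π (g i) = 0) ∧ GeneratesAt π p g := by
  have hart : IsArtinianRing S := IsArtinianRing.of_finite K S
  obtain ⟨e, he⟩ := exists_isLocalIdempotent p
  obtain ⟨f, hf, hne⟩ : ∃ f : Fin n → MvPolynomial (Fin n) K, (∀ i, π (f i) = 0) ∧
      e * (Matrix.of fun i => polyGrad π (f i)).det ≠ 0 := by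
    by_contra! h
    refine hs0 ?_
    rw [← he.mul_eq_self hps]
    clear hps hs0
    induction hs using Submodule.span_induction with
    | mem s hs => obtain ⟨f, hf, rfl⟩ := hs; exact h f hf
    | zero => simp
    | add a b _ _ ha hb => rw [mul_add, ha, hb, add_zero]
    | smul c a _ ha => rw [smul_eq_mul, mul_left_comm, ha, mul_zero]
  obtain ⟨M, g, B, _, _, _, F, e', hM, hg, hgπ, -, hmax, he', rfl, hJ⟩ :=
    exists_frobenius_of_isLocalIdempotent hπ p he hf
  refine ⟨M, g, hM, hg, hgπ, ?_⟩
  rw [← hJ, ← map_mul] at hne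
  -- A lift of the local idempotent is the denominator that witnesses generation at `p`.
  obtain ⟨t, ht⟩ := F.ρ_surjective e'
  refine ⟨t, ?_, fun a ha => ?_⟩
  · rw [← F.φ_ρ, ht]; exact he.notMem hp.ne_top
  · rw [← F.ker_ρ, RingHom.mem_ker, map_mul, ht]
    exact F.mul_eq_zero_of_mul_J_ne_zero he' hne (by rw [F.φ_ρ, ha])

lemma cast_ne_zero_of_lt_ringChar {m d : ℕ} (hchar : ringChar K = 0 ∨ d < ringChar K)
    (hm : 0 < m) (hmd : m ≤ d) : (m : K) ≠ 0 := by
  intro h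
  rw [ringChar.spec] at h
  rcases hchar with h0 | h0
  · rw [h0, zero_dvd_iff] at h; omega
  · exact absurd (Nat.le_of_dvd hm h) (by omega)

/-- At a point where the relations are generated by `n` elements the Jacobian ideal is the socle,
whose dimension is the degree of the residue field. -/
lemma finrank_jacobianIdeal_of_generatesAt (hπ : Function.Surjective π)
    (hchar : ringChar K = 0 ∨ Module.finrank K S < ringChar K)
    {p : Ideal S} [hp : p.IsMaximal] {f : Fin n → MvPolynomial (Fin n) K}
    (hf : ∀ i, π (f i) = 0) (hgen : GeneratesAt π p f) :
    Module.finrank K ((jacobianIdeal π).restrictScalars K ⊓ killedBy K p : Submodule K S) =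
      Module.finrank K (S ⧸ p) := by
  have hart : IsArtinianRing S := IsArtinianRing.of_finite K S
  obtain ⟨e, he⟩ := exists_isLocalIdempotent p
  obtain ⟨M, g, B, _, _, _, F, e', hM, hg, hgπ, hfg, hmax, he', rfl, hJ⟩ :=
    exists_frobenius_of_isLocalIdempotent hπ p he hf
  have hzero : ∀ b, F.φ b = 0 → e' * b = 0 := fun b hb =>
    F.mul_eq_zero_of_generatesAt hfg hgen he' hb
  have he0 : e' ≠ 0 := fun h => he'.notMem hmax.ne_top (h ▸ Ideal.zero_mem _)
  -- The trace of an idempotent is the dimension of its image. Here that image embeds into `S`, so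
  -- its dimension is positive and below any positive characteristic.
  have htrace : Algebra.trace K B e' ≠ 0 := by
    let E : Module.End K B := LinearMap.mulLeft K e'
    have hE : IsIdempotentElem E := by
      ext b; simp [E, ← mul_assoc, he'.idem]
    have h1 : Algebra.trace K B e' = (Module.finrank K (LinearMap.range E) : K) :=
      (LinearMap.IsIdempotentElem.isProj_range E hE).trace
    rw [h1]
    refine cast_ne_zero_of_lt_ringChar hchar ?_ ?_
    · rw [Module.finrank_pos_iff, Submodule.nontrivial_iff_ne_bot]
      intro h
      have : e' ∈ LinearMap.range E := ⟨1, by simp [E]⟩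
      rw [h] at this
      exact he0 this
    · refine LinearMap.finrank_le_finrank_of_injective
        (f := F.φ.toLinearMap ∘ₗ (LinearMap.range E).subtype) ?_
      rw [← LinearMap.ker_eq_bot, LinearMap.ker_eq_bot']
      rintro ⟨_, b, rfl⟩ hb
      have := hzero _ hb
      refine Subtype.ext ?_
      simpa [E, ← mul_assoc, he'.idem] using this
  have hne : e' * F.J ≠ 0 := by
    intro h
    rw [F.trace_eq, h, map_zero] at htrace
    exact htrace rfl
  have hne' : F.φ (e' * F.J) ≠ 0 := by
    intro h
    have := hzero _ h
    rw [← mul_assoc, he'.idem] at this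
    exact hne this
  have hmem : F.φ (e' * F.J) ∈ jacobianIdeal π := by
    rw [map_mul, hJ]
    exact Ideal.mul_mem_left _ _ (Ideal.subset_span ⟨f, hf, rfl⟩)
  have hkill : ∀ x ∈ p, x * F.φ (e' * F.J) = 0 := by
    intro x hx
    rw [map_mul]
    refine jacobianIdeal_mul hπ he hx ?_
    rw [hJ]; exact Ideal.subset_span ⟨f, hf, rfl⟩
  refine le_antisymm ?_ ?_
  · refine (Submodule.finrank_mono inf_le_right).trans ?_
    -- As `φ` is injective on the factor of `e'`, socle elements of `S` lift to socle elements of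
    -- `B`, where the Frobenius form bounds the dimension.
    have h1 : killedBy K p ≤ (killedBy K (p.comap F.φ)).map F.φ.toLinearMap := by
      intro s hs
      obtain ⟨b, rfl⟩ := F.φ_surjective hπ s
      refine ⟨e' * b, fun x hx => ?_, ?_⟩
      · have h2 := hzero (x * b) (by rw [map_mul]; exact hs _ hx)
        rwa [mul_left_comm]
      · change F.φ (e' * b) = _
        rw [map_mul]; exact he.mul_eq_self hs
    refine (Submodule.finrank_mono h1).trans ((Submodule.finrank_map_le _ _).trans
      ((finrank_killedBy_le F.nondegenerate _).trans ?_))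
    exact LinearMap.finrank_le_finrank_of_injective
      (f := (Ideal.quotientMapₐ p F.φ le_rfl).toLinearMap) Ideal.quotientMap_injective
  · refine (finrank_quotient_le_span hne' hkill).trans (Submodule.finrank_mono ?_)
    intro x hx
    obtain ⟨a, rfl⟩ := Ideal.mem_span_singleton'.1 hx
    refine ⟨Ideal.mul_mem_left _ _ hmem, fun y hy => ?_⟩
    rw [mul_left_comm, hkill y hy, mul_zero]

end JacobianLocal

/-! ### Decomposition of the Jacobian ideal over all points -/

section JacobianTotal

open MvPolynomial

universe u v

variable {K : Type u} {S : Type v} [Field K] [CommRing S] [Algebra K S] {n : ℕ}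
  {π : MvPolynomial (Fin n) K →ₐ[K] S} [Module.Finite K S]

/-- Local idempotents at different maximal ideals annihilate each other's socles. -/
lemma IsLocalIdempotent.mul_eq_zero_of_ne {p q : Ideal S} [hp : p.IsMaximal] [hq : q.IsMaximal]
    (hpq : p ≠ q) {e : S} (he : IsLocalIdempotent p e) {s : S} (hs : ∀ x ∈ q, x * s = 0) :
    e * s = 0 := by
  obtain ⟨t, htq, htp⟩ : ∃ t ∈ q, t ∉ p := by
    by_contra! h
    exact hpq (hq.eq_of_le hp.ne_top h).symm
  obtain ⟨u, rfl⟩ := he.exists_mul_eq t htp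
  rw [mul_assoc, hs t htq, mul_zero]

/-- The annihilator of a nonzero `s` lies in a maximal ideal `m`, which cannot contain the
idempotent belonging to `m`. -/
lemma eq_zero_of_localIdempotent_mul {e : MaximalSpectrum S → S}
    (he : ∀ p : MaximalSpectrum S, IsLocalIdempotent p.asIdeal (e p)) {s : S}
    (hs : ∀ p, e p * s = 0) : s = 0 := by
  by_contra h
  have hne : Submodule.annihilator (Ideal.span {s}) ≠ ⊤ := by
    rw [Ne, Submodule.annihilator_eq_top_iff, Ideal.span_singleton_eq_bot]
    exact h
  obtain ⟨m, hm, hle⟩ := Ideal.exists_le_maximal _ hne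
  refine (he ⟨m, hm⟩).notMem hm.ne_top (hle ?_)
  rw [Submodule.mem_annihilator_span_singleton]
  exact hs ⟨m, hm⟩

/-- The Jacobian ideal is the direct sum of its socles at the maximal ideals. -/
lemma finrank_jacobianIdeal_eq_sum (hπ : Function.Surjective π) [Fintype (MaximalSpectrum S)] :
    Module.finrank K ((jacobianIdeal π).restrictScalars K) = ∑ p : MaximalSpectrum S,
      Module.finrank K
        ((jacobianIdeal π).restrictScalars K ⊓ killedBy K p.asIdeal : Submodule K S) := by
  classical
  have hart : IsArtinianRing S := IsArtinianRing.of_finite K S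
  have hex : ∀ p : MaximalSpectrum S, ∃ e, IsLocalIdempotent p.asIdeal e := fun p =>
    haveI := p.isMaximal
    exists_isLocalIdempotent p.asIdeal
  choose e he using hex
  let φ : (jacobianIdeal π).restrictScalars K →ₗ[K] ∀ p : MaximalSpectrum S,
      ((jacobianIdeal π).restrictScalars K ⊓ killedBy K p.asIdeal : Submodule K S) :=
    LinearMap.pi fun p => ((LinearMap.mulLeft K (e p)).comp (Submodule.subtype _)).codRestrict _
      fun s => ⟨Ideal.mul_mem_left _ _ s.2, fun x hx =>
        haveI := p.isMaximal
        jacobianIdeal_mul hπ (he p) hx s.2⟩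
  have hφ : ∀ s p, (φ s p : S) = e p * s := fun s p => rfl
  have hinj : Function.Injective φ := by
    rw [← LinearMap.ker_eq_bot, LinearMap.ker_eq_bot']
    intro s hs
    refine Subtype.ext (eq_zero_of_localIdempotent_mul he fun p => ?_)
    rw [← hφ, hs]; rfl
  have hsurj : Function.Surjective φ := by
    intro w
    refine ⟨⟨∑ q, (w q : S), Submodule.sum_mem _ fun q _ => (w q).2.1⟩, ?_⟩
    ext p
    rw [hφ]
    change e p * ∑ q, (w q : S) = _
    have := p.isMaximal
    rw [Finset.mul_sum, Finset.sum_eq_single p]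
    · exact (he p).mul_eq_self (w p).2.2
    · intro q _ hqp
      have := q.isMaximal
      exact (he p).mul_eq_zero_of_ne (fun h => hqp (MaximalSpectrum.ext h).symm) (w q).2.2
    · simp
  rw [(LinearEquiv.ofBijective φ ⟨hinj, hsurj⟩).finrank_eq, Module.finrank_pi_fintype]

/-- The dimension of the Jacobian ideal. -/
theorem finrank_jacobianIdeal (hπ : Function.Surjective π)
    (hchar : ringChar K = 0 ∨ Module.finrank K S < ringChar K) (C : Set (MaximalSpectrum S))
    (hC : ∀ p ∈ C, ∃ f : Fin n → MvPolynomial (Fin n) K, (∀ i, π (f i) = 0) ∧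
      GeneratesAt π p.asIdeal f)
    (hC' : ∀ (p : MaximalSpectrum S) (M : ℕ) (g : Fin n → MvPolynomial (Fin n) K), 0 < M →
      (∀ i, HasTop (g i) (Finsupp.single i M)) → (∀ i, π (g i) = 0) →
      GeneratesAt π p.asIdeal g → p ∈ C) :
    Module.finrank K ((jacobianIdeal π).restrictScalars K) =
      ∑ᶠ p ∈ C, Module.finrank K (S ⧸ p.asIdeal) := by
  classical
  have hart : IsArtinianRing S := IsArtinianRing.of_finite K S
  have := Fintype.ofFinite (MaximalSpectrum S)
  rw [finrank_jacobianIdeal_eq_sum hπ, finsum_mem_eq_finite_toFinset_sum _ C.toFinite,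
    ← Finset.sum_subset (Finset.subset_univ C.toFinite.toFinset)]
  · refine Finset.sum_congr rfl fun p hp => ?_
    obtain ⟨f, hf, hgen⟩ := hC p (by simpa using hp)
    have := p.isMaximal
    exact finrank_jacobianIdeal_of_generatesAt hπ hchar hf hgen
  · intro p _ hp
    have := p.isMaximal
    rw [Submodule.finrank_eq_zero, Submodule.eq_bot_iff]
    rintro s ⟨hs, hps⟩
    by_contra hs0
    obtain ⟨M, g, hM, hg, hgπ, hgen⟩ := exists_generatesAt hπ hs hs0 hps
    exact hp (by simpa using hC' p M g hM hg hgπ hgen)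

end JacobianTotal

/-! ### Complete intersection points and generation by `n` relations -/

section LocalCompleteIntersection

open MvPolynomial RingTheory.Sequence

variable {K S : Type*} [Field K] [CommRing S] [Algebra K S] {n : ℕ}
  {π : MvPolynomial (Fin n) K →ₐ[K] S}

lemma ofList_ofFn {R : Type*} [CommRing R] (f : Fin n → R) :
    Ideal.ofList (List.ofFn f) = Ideal.span (Set.range f) := by
  rw [Ideal.ofList]
  congr 1
  ext x
  simp [List.mem_ofFn]

/-- Weak regularity of the triangular system survives the flat localization, and it becomes
regularity because the system lies in the maximal ideal. -/
lemma isRegular_of_generatesAt {p : Ideal S} {m : Ideal (MvPolynomial (Fin n) K)} [m.IsPrime]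
    (hm : m = p.comap π)
    {M : ℕ} (hM : 0 < M) {g : Fin n → MvPolynomial (Fin n) K}
    (hg : ∀ i, HasTop (g i) (Finsupp.single i M)) (hgπ : ∀ i, π (g i) = 0)
    (hgen : GeneratesAt π p g) :
    ∃ rs : List (Localization.AtPrime m), rs.length = n ∧
      IsRegular (Localization.AtPrime m) rs ∧
      Ideal.ofList rs = (RingHom.ker π).map
        (algebraMap (MvPolynomial (Fin n) K) (Localization.AtPrime m)) := by
  have hker : ∀ a, π a = 0 → a ∈ m := fun a ha => by
    rw [hm, Ideal.mem_comap, ha]; exact p.zero_mem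
  refine ⟨(List.ofFn g).map (algebraMap _ _), by simp, ?_, ?_⟩
  · rw [IsLocalRing.isRegular_iff_isWeaklyRegular_of_subset_maximalIdeal]
    · exact (isWeaklyRegular_of_hasTop hM hg).of_flat
    · intro r hr
      obtain ⟨a, ha, rfl⟩ := List.mem_map.1 hr
      obtain ⟨i, rfl⟩ := (List.mem_ofFn' _ _).1 ha
      exact (IsLocalization.AtPrime.to_map_mem_maximal_iff _ m _).2 (hker _ (hgπ i))
  · rw [← Ideal.map_ofList, ofList_ofFn]
    refine le_antisymm (Ideal.map_mono ?_) ?_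
    · rw [Ideal.span_le]; rintro _ ⟨i, rfl⟩; exact hgπ i
    · rw [Ideal.map_le_iff_le_comap]
      intro a ha
      obtain ⟨t, ht, h⟩ := hgen
      have h1 := Ideal.mem_map_of_mem (algebraMap _ (Localization.AtPrime m)) (h a ha)
      rw [map_mul] at h1
      rw [Ideal.mem_comap]
      refine (Ideal.unit_mul_mem_iff_mem _ ?_).1 h1
      rw [IsLocalization.AtPrime.isUnit_to_map_iff (Localization.AtPrime m) m]
      intro hmem
      rw [SetLike.mem_coe, hm, Ideal.mem_comap] at hmem
      exact ht hmem

/-- Denominators are units, so the generators may be replaced by polynomial relations; only their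
number matters. -/
lemma exists_generatesAt_of_isLocalization {p : Ideal S} {m : Ideal (MvPolynomial (Fin n) K)}
    [m.IsPrime] (hm : m = p.comap π) (rs : List (Localization.AtPrime m)) (hrs : rs.length = n)
    (h : Ideal.ofList rs = (RingHom.ker π).map
      (algebraMap (MvPolynomial (Fin n) K) (Localization.AtPrime m))) :
    ∃ f : Fin n → MvPolynomial (Fin n) K, (∀ i, π (f i) = 0) ∧ GeneratesAt π p f := by
  classical
  obtain ⟨r, rfl⟩ : ∃ r : Fin n → Localization.AtPrime m, rs = List.ofFn r :=
    ⟨fun i => rs[i], List.ext_getElem (by simp [hrs]) (by simp)⟩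
  rw [ofList_ofFn] at h
  have h1 : ∀ i, ∃ f, π f = 0 ∧ ∃ s : m.primeCompl,
      r i * algebraMap _ (Localization.AtPrime m) s.1 = algebraMap _ _ f := by
    intro i
    have : r i ∈ Ideal.span (Set.range r) := Ideal.subset_span ⟨i, rfl⟩
    rw [h, IsLocalization.mem_map_algebraMap_iff m.primeCompl] at this
    obtain ⟨⟨⟨f, hf⟩, s⟩, hs⟩ := this
    exact ⟨f, hf, s, hs⟩
  choose f hf s hs using h1
  refine ⟨f, hf, ?_⟩
  have hle : (RingHom.ker π).map (algebraMap _ (Localization.AtPrime m)) ≤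
      (Ideal.span (Set.range f)).map (algebraMap _ (Localization.AtPrime m)) := by
    rw [← h, Ideal.span_le]
    rintro _ ⟨i, rfl⟩
    have h2 := Ideal.mem_map_of_mem (algebraMap _ (Localization.AtPrime m))
      (Ideal.subset_span (Set.mem_range_self (f := f) i))
    rw [← hs, mul_comm] at h2
    refine (Ideal.unit_mul_mem_iff_mem _ ?_).1 h2
    exact IsLocalization.map_units _ (s i)
  have h3 : ∀ a : MvPolynomial (Fin n) K, π a = 0 →
      ∃ t, t ∉ m ∧ t * a ∈ Ideal.span (Set.range f) := by
    intro a ha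
    have := hle (Ideal.mem_map_of_mem _ ha)
    rw [IsLocalization.mem_map_algebraMap_iff m.primeCompl] at this
    obtain ⟨⟨⟨b, hb⟩, t⟩, ht⟩ := this
    rw [← map_mul, IsLocalization.eq_iff_exists m.primeCompl] at ht
    obtain ⟨c, hc⟩ := ht
    refine ⟨c * t, (c * t).2, ?_⟩
    have : (c : MvPolynomial (Fin n) K) * t * a = c * b := by rw [← hc]; ring
    rw [this]
    exact Ideal.mul_mem_left _ _ hb
  choose! t ht1 ht2 using h3
  -- Finitely many generators of the kernel allow one common denominator.
  obtain ⟨G, hG⟩ := (isNoetherianRing_iff_ideal_fg _).1 inferInstance (RingHom.ker π)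
  have hGker : ∀ a ∈ G, π a = 0 := fun a ha => by
    have : a ∈ RingHom.ker π := hG ▸ Ideal.subset_span ha
    exact this
  refine ⟨∏ a ∈ G, t a, ?_, fun a ha => ?_⟩
  · have : ∏ a ∈ G, t a ∉ m := by
      rw [Ideal.IsPrime.prod_mem_iff]
      rintro ⟨a, ha, h⟩
      exact ht1 a (hGker a ha) h
    rwa [hm, Ideal.mem_comap] at this
  · have ha' : a ∈ RingHom.ker π := ha
    rw [← hG] at ha'
    clear ha
    induction ha' using Submodule.span_induction with
    | mem a ha =>
      rw [← Finset.prod_erase_mul _ _ ha, mul_assoc]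
      exact Ideal.mul_mem_left _ _ (ht2 a (hGker a ha))
    | zero => rw [mul_zero]; exact Ideal.zero_mem _
    | add a b _ _ ha hb => rw [mul_add]; exact Ideal.add_mem _ ha hb
    | smul c a _ ha => rw [smul_eq_mul, mul_left_comm]; exact Ideal.mul_mem_left _ _ ha

end LocalCompleteIntersection

/-! ### Independence of the Fitting ideal from the generators -/

section Fitting

variable {R : Type*} [CommRing R] {n : ℕ}

/-- The ideal generated by the determinants of the square matrices with rows in `N`. -/
def minorIdeal (N : Set (Fin n → R)) : Ideal R :=
  Ideal.span {d | ∃ v : Fin n → Fin n → R, (∀ i, v i ∈ N) ∧ d = (Matrix.of v).det}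

lemma det_mem_minorIdeal {N : Set (Fin n → R)} {v : Fin n → Fin n → R} (hv : ∀ i, v i ∈ N) :
    (Matrix.of v).det ∈ minorIdeal N :=
  Ideal.subset_span ⟨v, hv, rfl⟩

/-- Determinants of matrices with rows in the span of `N`. -/
lemma det_mem_minorIdeal_of_span {N : Set (Fin n → R)} {v : Fin n → Fin n → R}
    (hv : ∀ i, v i ∈ Submodule.span R N) : (Matrix.of v).det ∈ minorIdeal N := by
  classical
  have key : ∀ (s : Finset (Fin n)) (v : Matrix (Fin n) (Fin n) R),
      (∀ i ∈ s, v i ∈ Submodule.span R N) → (∀ i, i ∉ s → v i ∈ N) → v.det ∈ minorIdeal N := by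
    intro s
    induction s using Finset.induction_on with
    | empty => exact fun v _ h => det_mem_minorIdeal fun i => h i (Finset.notMem_empty i)
    | insert a s ha ih =>
      intro v h1 h2
      have h3 : ∀ w ∈ Submodule.span R N, (v.updateRow a w).det ∈ minorIdeal N := by
        intro w hw
        induction hw using Submodule.span_induction with
        | mem w hw =>
          refine ih _ (fun i hi => ?_) fun i hi => ?_
          · rw [Matrix.updateRow_ne (by rintro rfl; exact ha hi)]
            exact h1 i (Finset.mem_insert_of_mem hi)
          · by_cases hia : i = a
            · subst hia; rwa [Matrix.updateRow_self]
            · rw [Matrix.updateRow_ne hia]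
              exact h2 i (by simp [hia, hi])
        | zero =>
          have := Matrix.det_updateRow_smul v a (0 : R) 0
          rw [zero_smul, zero_mul] at this
          rw [this]; exact Ideal.zero_mem _
        | add x y _ _ hx hy => rw [Matrix.det_updateRow_add]; exact Ideal.add_mem _ hx hy
        | smul c x _ hx => rw [Matrix.det_updateRow_smul]; exact Ideal.mul_mem_left _ _ hx
      have := h3 (v a) (h1 a (Finset.mem_insert_self a s))
      rwa [Matrix.updateRow_eq_self] at this
  exact key Finset.univ _ (fun i _ => hv i) fun i hi => absurd (Finset.mem_univ i) hi

lemma minorIdeal_span_le (N : Set (Fin n → R)) :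
    minorIdeal (Submodule.span R N : Set (Fin n → R)) ≤ minorIdeal N := by
  rw [minorIdeal, Ideal.span_le]
  rintro _ ⟨v, hv, rfl⟩
  exact det_mem_minorIdeal_of_span hv

lemma minorIdeal_mono {N N' : Set (Fin n → R)} (h : N ⊆ N') : minorIdeal N ≤ minorIdeal N' :=
  Ideal.span_mono fun _ ⟨v, hv, hd⟩ => ⟨v, fun i => h (hv i), hd⟩

/-- Laplace expansion along the columns that are not among the first `n`. -/
lemma det_mem_minorIdeal_of_columns {N : Set (Fin n → R)} (k : ℕ)
    (A : Matrix (Fin (n + k)) (Fin (n + k)) R)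
    (hA : ∀ i, (fun j : Fin n => A i (Fin.castAdd k j)) ∈ N) : A.det ∈ minorIdeal N := by
  induction k with
  | zero => exact det_mem_minorIdeal (v := A) hA
  | succ k ih =>
    have h : A.det = _ := Matrix.det_succ_column (n := n + k) A (Fin.last (n + k))
    rw [h]
    refine Ideal.sum_mem _ fun i _ => Ideal.mul_mem_left _ _ (ih _ fun l => ?_)
    have := hA (i.succAbove l)
    convert this using 1
    ext j
    simp only [Matrix.submatrix_apply, Fin.succAbove_last]
    rfl

/-- Any system of generators may be used to compute an upper bound of the initial Fitting ideal. -/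
theorem initialFittingIdeal_le {M : Type*} [AddCommGroup M] [Module R M] (y : Fin n → M)
    (hy : Submodule.span R (Set.range y) = ⊤) :
    initialFittingIdeal R M ≤ minorIdeal {c : Fin n → R | ∑ j, c j • y j = 0} := by
  rw [initialFittingIdeal, Ideal.span_le]
  rintro _ ⟨k, m, A, hm, hA, rfl⟩
  have h1 : ∀ l, ∃ c : Fin n → R, ∑ j, c j • y j = m l := fun l =>
    (Submodule.mem_span_range_iff_exists_fun R).1 (hy ▸ Submodule.mem_top)
  have h2 : ∀ j, ∃ b : Fin k → R, ∑ l, b l • m l = y j := fun l =>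
    (Submodule.mem_span_range_iff_exists_fun R).1 (hm ▸ Submodule.mem_top)
  choose c hc using h1
  choose b hb using h2
  let C : Matrix (Fin k) (Fin n) R := Matrix.of c
  let B : Matrix (Fin n) (Fin k) R := Matrix.of b
  -- With `m = C y` and `y = B m`, the first `n` columns `1 - B C` and `A C` consist of relations of
  -- `y`, while `E` factors into block triangular matrices of total determinant `det A`.
  let E : Matrix (Fin n ⊕ Fin k) (Fin n ⊕ Fin k) R :=
    Matrix.fromBlocks (1 - B * C) (-B) (A * C) A
  have hE : E = Matrix.fromBlocks 1 (-B) 0 A * Matrix.fromBlocks 1 0 C 1 := by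
    rw [Matrix.fromBlocks_multiply]
    simp [E, sub_eq_add_neg]
  have hdet : E.det = A.det := by
    rw [hE, Matrix.det_mul, Matrix.det_fromBlocks_zero₂₁, Matrix.det_fromBlocks_zero₁₂]
    simp
  have hsum : ∀ v : Fin k → R, ∑ j, (∑ l, v l * c l j) • y j = ∑ l, v l • m l := by
    intro v
    simp only [← hc, Finset.sum_smul, Finset.smul_sum, mul_smul]
    exact Finset.sum_comm
  have hrow : ∀ i, (fun j : Fin n => E i (Sum.inl j)) ∈ {c : Fin n → R | ∑ j, c j • y j = 0} := by
    rintro (i | i)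
    · change ∑ j, ((1 : Matrix (Fin n) (Fin n) R) i j - ∑ l, b i l * c l j) • y j = 0
      simp only [sub_smul, Finset.sum_sub_distrib, hsum, hb]
      simp [Matrix.one_apply]
    · change ∑ j, (∑ l, A i l * c l j) • y j = 0
      rw [hsum, hA]
  have h3 := det_mem_minorIdeal_of_columns k
    (E.submatrix (finSumFinEquiv (m := n) (n := k)).symm finSumFinEquiv.symm)
    (N := {c : Fin n → R | ∑ j, c j • y j = 0}) fun i => by
      simpa using hrow _
  rw [Matrix.det_submatrix_equiv_self, hdet] at h3
  exact h3

lemma minorIdeal_le_initialFittingIdeal {M : Type*} [AddCommGroup M] [Module R M] (y : Fin n → M)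
    (hy : Submodule.span R (Set.range y) = ⊤) :
    minorIdeal {c : Fin n → R | ∑ j, c j • y j = 0} ≤ initialFittingIdeal R M := by
  rw [minorIdeal, Ideal.span_le]
  rintro _ ⟨v, hv, rfl⟩
  exact Ideal.subset_span ⟨n, y, Matrix.of v, hy, hv, rfl⟩

end Fitting

/-! ### Presentation of the Kähler differentials by gradients -/

section Kaehler

open MvPolynomial KaehlerDifferential

variable {K R : Type*} [Field K] [CommRing R] [Algebra K R] {n : ℕ}
  (θ : MvPolynomial (Fin (n + 1)) K →ₐ[K] R)

/-- The partial derivatives of a polynomial with respect to all but the first variable. -/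
noncomputable def tailGrad (f : MvPolynomial (Fin (n + 1)) K) : Fin n → R :=
  fun j => θ (pderiv j.succ f)

lemma tailGrad_mul (f g : MvPolynomial (Fin (n + 1)) K) :
    tailGrad θ (f * g) = θ f • tailGrad θ g + θ g • tailGrad θ f := by
  ext j
  simp [tailGrad, Derivation.leibniz]

lemma tailGrad_add (f g : MvPolynomial (Fin (n + 1)) K) :
    tailGrad θ (f + g) = tailGrad θ f + tailGrad θ g := by
  ext j; simp [tailGrad]

lemma tailGrad_X_succ (i : Fin n) : tailGrad θ (X i.succ) = Pi.single i 1 := by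
  ext j
  by_cases h : j = i
  · subst h; simp [tailGrad]
  · simp [tailGrad, pderiv_X_of_ne (fun h' => h (Fin.succ_injective n h').symm), h]

lemma tailGrad_X_zero : tailGrad θ (X 0) = 0 := by
  ext j
  simp [tailGrad, pderiv_X_of_ne (Fin.succ_ne_zero j).symm]

local notation "A₀" => Algebra.adjoin K {θ (X 0)}

lemma kaehler_D_eq (f : MvPolynomial (Fin (n + 1)) K) :
    D A₀ R (θ f) = ∑ j, tailGrad θ f j • D A₀ R (θ (X j.succ)) := by
  have hK : ∀ c : K, D A₀ R (algebraMap K R c) = 0 := fun c => by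
    have h := (D A₀ R).map_algebraMap (algebraMap K A₀ c)
    exact h
  have h0 : D A₀ R (θ (X 0)) = 0 := by
    have h := (D A₀ R).map_algebraMap (⟨θ (X 0), Algebra.self_mem_adjoin_singleton K _⟩ : A₀)
    exact h
  induction f using MvPolynomial.induction_on with
  | C c =>
    have : θ (C c) = algebraMap K R c := θ.commutes c
    rw [this, hK]
    simp [tailGrad]
  | add f g hf hg =>
    rw [map_add, map_add, hf, hg, tailGrad_add, ← Finset.sum_add_distrib]
    simp [add_smul]
  | mul_X f i hf =>
    rw [map_mul, Derivation.leibniz, hf, tailGrad_mul]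
    simp only [Pi.add_apply, Pi.smul_apply, smul_eq_mul, add_smul, Finset.sum_add_distrib,
      mul_smul, ← Finset.smul_sum]
    congr 2
    refine Fin.cases ?_ (fun i => ?_) i
    · simp [h0, tailGrad_X_zero]
    · simp [tailGrad_X_succ, Pi.single_apply]

lemma span_kaehler_D (hθ : Function.Surjective θ) :
    Submodule.span R (Set.range fun j : Fin n => D A₀ R (θ (X j.succ))) = ⊤ := by
  rw [eq_top_iff, ← span_range_derivation A₀ R, Submodule.span_le]
  rintro _ ⟨r, rfl⟩
  obtain ⟨f, rfl⟩ := hθ r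
  rw [kaehler_D_eq]
  exact Submodule.sum_mem _ fun j _ => Submodule.smul_mem _ _ (Submodule.subset_span ⟨j, rfl⟩)

/-- The gradients of the relations. -/
def relationGrads : Set (Fin n → R) := {v | ∃ f, θ f = 0 ∧ v = tailGrad θ f}

/-- The gradient induces a derivation of `R` over `K[x₀]` into `Rⁿ` modulo relation gradients. By
the universal property it sends a vanishing combination of the `dx_j` to the class of its
coefficient vector, which is therefore zero. -/
lemma relations_kaehler (hθ : Function.Surjective θ) :
    {c : Fin n → R | ∑ j, c j • D A₀ R (θ (X j.succ)) = 0} =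
      (Submodule.span R (relationGrads θ) : Set (Fin n → R)) := by
  refine Set.Subset.antisymm (fun c hc => ?_) ?_
  · let Q := Submodule.span R (relationGrads θ)
    let s := Function.surjInv hθ
    have hs : ∀ r, θ (s r) = r := Function.surjInv_eq hθ
    let d : R → (Fin n → R) ⧸ Q := fun r => Q.mkQ (tailGrad θ (s r))
    have hd : ∀ f, d (θ f) = Q.mkQ (tailGrad θ f) := by
      intro f
      refine (Submodule.Quotient.eq Q).2 (Submodule.subset_span ⟨s (θ f) - f, ?_, ?_⟩)
      · rw [map_sub, hs, sub_self]
      · ext j; simp [tailGrad]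
    have hadd : ∀ a b, d (a + b) = d a + d b := by
      intro a b
      obtain ⟨f, rfl⟩ := hθ a
      obtain ⟨g, rfl⟩ := hθ b
      rw [← map_add, hd, hd, hd, tailGrad_add, map_add]
    have hmul : ∀ a b, d (a * b) = a • d b + b • d a := by
      intro a b
      obtain ⟨f, rfl⟩ := hθ a
      obtain ⟨g, rfl⟩ := hθ b
      rw [← map_mul, hd, hd, hd, tailGrad_mul, map_add, map_smul, map_smul]
    have hA : ∀ a ∈ A₀, d a = 0 := by
      intro a ha
      induction ha using Algebra.adjoin_induction with
      | mem x hx =>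
        rw [Set.mem_singleton_iff.1 hx, hd, tailGrad_X_zero, map_zero]
      | algebraMap c =>
        have : algebraMap K R c = θ (C c) := (θ.commutes c).symm
        have h0 : tailGrad θ (C c) = 0 := by ext j; simp [tailGrad]
        rw [this, hd, h0, map_zero]
      | add a b _ _ ha hb => rw [hadd, ha, hb, add_zero]
      | mul a b _ _ ha hb => rw [hmul, ha, hb, smul_zero, smul_zero, add_zero]
    let δ : Derivation A₀ R ((Fin n → R) ⧸ Q) := Derivation.mk'
      { toFun := d
        map_add' := hadd
        map_smul' := fun a b => by
          change d ((a : R) * b) = a • d b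
          rw [hmul, hA a a.2, smul_zero, add_zero]; rfl } hmul
    have h1 := congrArg δ.liftKaehlerDifferential hc
    rw [map_zero, map_sum] at h1
    have h2 : ∀ j : Fin n, δ.liftKaehlerDifferential (c j • D A₀ R (θ (X j.succ))) =
        Q.mkQ (c j • Pi.single j 1) := by
      intro j
      rw [map_smul, δ.liftKaehlerDifferential_comp_D, map_smul, ← tailGrad_X_succ θ j, ← hd]
      rfl
    simp only [h2] at h1
    rw [← map_sum] at h1
    have h3 : ∑ j, c j • (Pi.single j 1 : Fin n → R) = c := by
      ext i; simp [Pi.single_apply]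
    rw [h3] at h1
    exact (Submodule.Quotient.mk_eq_zero Q).1 h1
  · have hle : Submodule.span R (relationGrads θ) ≤ LinearMap.ker
        (Fintype.linearCombination R fun j : Fin n => D A₀ R (θ (X j.succ))) := by
      rw [Submodule.span_le]
      rintro _ ⟨f, hf, rfl⟩
      change Fintype.linearCombination R _ _ = 0
      rw [Fintype.linearCombination_apply, ← kaehler_D_eq, hf, map_zero]
    intro c hc
    have := hle hc
    rwa [LinearMap.mem_ker, Fintype.linearCombination_apply] at this

/-- The Kähler different is generated by Jacobian determinants. -/
theorem initialFittingIdeal_kaehler (hθ : Function.Surjective θ) :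
    initialFittingIdeal R (Ω[R⁄A₀]) = minorIdeal (relationGrads θ) := by
  have hspan := span_kaehler_D θ hθ
  refine le_antisymm ?_ ?_
  · refine (initialFittingIdeal_le _ hspan).trans ?_
    rw [relations_kaehler θ hθ]
    exact minorIdeal_span_le _
  · refine (minorIdeal_mono ?_).trans (minorIdeal_le_initialFittingIdeal _ hspan)
    rw [relations_kaehler θ hθ]
    exact Submodule.subset_span

end Kaehler

/-! ### Dehomogenization of polynomials -/

section Dehomogenize

open MvPolynomial

variable {K : Type*} [Field K] {n : ℕ}

/-- Substituting `1` for the first variable. -/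
noncomputable def dehom : MvPolynomial (Fin (n + 1)) K →ₐ[K] MvPolynomial (Fin n) K :=
  aeval (Fin.cons 1 X)

lemma dehom_X_zero : dehom (X 0 : MvPolynomial (Fin (n + 1)) K) = 1 := by simp [dehom]

lemma dehom_X_succ (i : Fin n) : dehom (X i.succ : MvPolynomial (Fin (n + 1)) K) = X i := by
  simp [dehom]

lemma pderiv_dehom (j : Fin n) (F : MvPolynomial (Fin (n + 1)) K) :
    pderiv j (dehom F) = dehom (pderiv j.succ F) := by
  induction F using MvPolynomial.induction_on with
  | C c =>
    have : dehom (C c : MvPolynomial (Fin (n + 1)) K) = C c := dehom.commutes c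
    simp [this]
  | add f g hf hg => simp [hf, hg]
  | mul_X f i hf =>
    rw [map_mul, Derivation.leibniz, Derivation.leibniz, hf]
    simp only [smul_eq_mul, map_add, map_mul]
    congr 2
    refine Fin.cases ?_ (fun i => ?_) i
    · rw [dehom_X_zero, pderiv_X_of_ne (Fin.succ_ne_zero j).symm]
      simp
    · rw [dehom_X_succ]
      by_cases h : i = j
      · subst h; simp
      · rw [pderiv_X_of_ne h, pderiv_X_of_ne fun h' => h (Fin.succ_injective n h'), map_zero]

/-- Every polynomial of degree at most `d` is the dehomogenization of a form of degree `d`. -/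
lemma exists_dehom_eq (d : ℕ) (a : MvPolynomial (Fin n) K) (ha : a.totalDegree ≤ d) :
    ∃ F : MvPolynomial (Fin (n + 1)) K, F.IsHomogeneous d ∧ dehom F = a := by
  refine ⟨∑ α ∈ a.support, X 0 ^ (d - α.degree) * rename Fin.succ (monomial α (coeff α a)), ?_, ?_⟩
  · refine IsHomogeneous.sum _ _ _ fun α hα => ?_
    have hle : α.degree ≤ d := (le_totalDegree hα).trans ha
    have h := (isHomogeneous_X_pow (R := K) (0 : Fin (n + 1)) (d - α.degree)).mul
      ((isHomogeneous_monomial (coeff α a) (rfl : α.degree = α.degree)).rename_isHomogeneous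
        (f := Fin.succ))
    rwa [Nat.sub_add_cancel hle] at h
  · conv_rhs => rw [a.as_sum]
    rw [map_sum]
    refine Finset.sum_congr rfl fun α _ => ?_
    have : (dehom (K := K) (n := n)).comp (rename Fin.succ) = AlgHom.id K _ := by
      ext i; simp [dehom_X_succ]
    rw [map_mul, map_pow, dehom_X_zero, one_pow, one_mul]
    exact congrArg (fun φ : MvPolynomial (Fin n) K →ₐ[K] MvPolynomial (Fin n) K =>
      φ (monomial α (coeff α a))) this

lemma dehom_monomial (α : Fin (n + 1) →₀ ℕ) (c : K) :
    dehom (monomial α c) = monomial α.tail c := by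
  rw [dehom, aeval_monomial, monomial_eq (s := α.tail), Finsupp.prod_fintype _ _ (by simp),
    Finsupp.prod_fintype _ _ (by simp), Fin.prod_univ_succ]
  simp [Finsupp.tail_apply, algebraMap_eq]

lemma totalDegree_dehom_le {d : ℕ} {F : MvPolynomial (Fin (n + 1)) K} (hF : F.IsHomogeneous d) :
    (dehom F).totalDegree ≤ d := by
  rw [F.as_sum, map_sum]
  refine totalDegree_finsetSum_le fun α hα => ?_
  rw [dehom_monomial]
  refine (totalDegree_monomial_le _ _).trans ?_
  have h1 : α.degree = d := by
    rw [Finsupp.degree_eq_weight_one]; exact hF (mem_support_iff.1 hα)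
  rw [← h1, Finsupp.degree_eq_sum, Fin.sum_univ_succ, Finsupp.sum_fintype _ _ (by simp)]
  simp [Finsupp.tail_apply]

lemma homogeneousComponent_mul_of_isHomogeneous {σ : Type*} {m : ℕ} {φ : MvPolynomial σ K}
    (hφ : φ.IsHomogeneous m) (k : ℕ) (b : MvPolynomial σ K) :
    homogeneousComponent (m + k) (φ * b) = φ * homogeneousComponent k b := by
  conv_lhs => rw [← sum_homogeneousComponent b]
  rw [Finset.mul_sum, map_sum]
  have h1 : ∀ j, homogeneousComponent (m + k) (φ * homogeneousComponent j b) =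
      if j = k then φ * homogeneousComponent k b else 0 := by
    intro j
    rw [homogeneousComponent_of_mem (hφ.mul (homogeneousComponent_isHomogeneous j b))]
    by_cases h : j = k
    · subst h; simp
    · rw [if_neg h, if_neg (by omega)]
  simp only [h1, Finset.sum_ite_eq']
  split_ifs with h
  · rfl
  · rw [homogeneousComponent_eq_zero _ _ (by simpa using h), mul_zero]

lemma aeval_mul_of_isHomogeneous {σ L : Type*} [CommRing L] [Algebra K L] {d : ℕ}
    {F : MvPolynomial σ K} (hF : F.IsHomogeneous d) (c : L) (y : σ → L) :
    aeval (fun i => c * y i) F = c ^ d * aeval y F := by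
  rw [F.as_sum, map_sum, map_sum, Finset.mul_sum]
  refine Finset.sum_congr rfl fun α hα => ?_
  have h1 : α.degree = d := by
    rw [Finsupp.degree_eq_weight_one]; exact hF (mem_support_iff.1 hα)
  rw [aeval_monomial, aeval_monomial, mul_left_comm]
  congr 1
  simp only [Finsupp.prod, mul_pow, Finset.prod_mul_distrib, Finset.prod_pow_eq_pow_sum]
  rw [← h1, Finsupp.degree]
  rfl

end Dehomogenize

/-! ### From the graded ring to the affine ring -/

namespace ZeroDimScheme

open MvPolynomial

attribute [local instance] MvPolynomial.gradedAlgebra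

variable {K : Type*} [Field K] {n : ℕ} (𝕏 : ZeroDimScheme K n)

lemma toR_eq_zero_iff {f : MvPolynomial (Fin (n + 1)) K} : 𝕏.toR f = 0 ↔ f ∈ 𝕏.I :=
  Ideal.Quotient.eq_zero_iff_mem

lemma toR_surjective : Function.Surjective 𝕏.toR := Ideal.Quotient.mk_surjective

lemma dehomogenization_surjective : Function.Surjective 𝕏.dehomogenization :=
  Ideal.Quotient.mk_surjective

/-- The radical of a homogeneous ideal is the intersection of the homogeneous primes above it, and
those above `I + (X₀)` contain all variables since no point lies on `X₀ = 0`. -/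
lemma exists_X_pow_mem : ∃ N : ℕ, ∀ i, X i ^ N ∈ 𝕏.I ⊔ Ideal.span {X 0} := by
  have hJ : (𝕏.I ⊔ Ideal.span {X 0}).IsHomogeneous (homogeneousSubmodule (Fin (n + 1)) K) := by
    refine Ideal.IsHomogeneous.sup 𝕏.homogeneous (Ideal.homogeneous_span _ _ ?_)
    rintro _ rfl
    exact ⟨1, isHomogeneous_X K 0⟩
  have h1 : ∀ i, X i ∈ (𝕏.I ⊔ Ideal.span {X 0}).radical := by
    intro i
    rw [hJ.radical_eq, Submodule.mem_sInf]
    rintro 𝔭 ⟨h, hle, hp⟩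
    exact 𝕏.avoids 𝔭 hp h (le_sup_left.trans hle)
      (hle (Ideal.mem_sup_right (Ideal.mem_span_singleton_self _))) i
  choose N hN using h1
  refine ⟨∑ i, N i, fun i => ?_⟩
  exact Ideal.mem_of_dvd _ (pow_dvd_pow _
    (Finset.single_le_sum (f := N) (fun _ _ => Nat.zero_le _) (Finset.mem_univ i))) (hN i)

lemma mem_of_forall_monomial_mul_mem (D : ℕ) (f : MvPolynomial (Fin (n + 1)) K)
    (h : ∀ α : Fin (n + 1) →₀ ℕ, α.degree = D → monomial α 1 * f ∈ 𝕏.I) : f ∈ 𝕏.I := by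
  induction D with
  | zero => simpa using h 0 (by simp)
  | succ D ih =>
    refine ih fun α hα => 𝕏.saturated _ fun i => ?_
    have := h (α + Finsupp.single i 1) (by simp [hα])
    rwa [← mul_one (1 : K), ← monomial_mul, mul_comm (monomial α 1), mul_assoc] at this

lemma exists_le_of_degree {N : ℕ} {α : Fin (n + 1) →₀ ℕ} (h : (n + 1) * N ≤ α.degree) :
    ∃ i, N ≤ α i := by
  by_contra! hlt
  have h1 : α.degree < ∑ _i : Fin (n + 1), N := by
    rw [Finsupp.degree_eq_sum]
    exact Finset.sum_lt_sum_of_nonempty Finset.univ_nonempty fun i _ => hlt i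
  simp at h1
  omega

lemma monomial_mem_of_degree {N : ℕ} (hN : ∀ i, X i ^ N ∈ 𝕏.I ⊔ Ideal.span {X 0})
    {α : Fin (n + 1) →₀ ℕ} (h : (n + 1) * N ≤ α.degree) :
    monomial α (1 : K) ∈ 𝕏.I ⊔ Ideal.span {X 0} := by
  obtain ⟨i, hi⟩ := exists_le_of_degree h
  have : monomial α (1 : K) = monomial (α - Finsupp.single i N) 1 * X i ^ N := by
    rw [X_pow_eq_monomial, monomial_mul, one_mul,
      tsub_add_cancel_of_le (Finsupp.single_le_iff.2 hi)]
  rw [this]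
  exact Ideal.mul_mem_left _ _ (hN i)

/-- As the scheme avoids `X₀ = 0`, the variable `X₀` is a nonzerodivisor modulo `I`. -/
lemma mem_of_X_zero_mul_mem {f : MvPolynomial (Fin (n + 1)) K} (hf : X 0 * f ∈ 𝕏.I) : f ∈ 𝕏.I := by
  obtain ⟨N, hN⟩ := 𝕏.exists_X_pow_mem
  refine 𝕏.mem_of_forall_monomial_mul_mem ((n + 1) * N) f fun α hα => ?_
  obtain ⟨a, ha, b, hb, hab⟩ := Submodule.mem_sup.1 (𝕏.monomial_mem_of_degree hN hα.ge)
  obtain ⟨c, rfl⟩ := Ideal.mem_span_singleton'.1 hb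
  rw [← hab, add_mul, mul_assoc]
  exact Ideal.add_mem _ (Ideal.mul_mem_right _ _ ha) (Ideal.mul_mem_left _ _ hf)

/-- The composite `K[X₀, …, Xₙ] → R → S`. -/
noncomputable def toS : MvPolynomial (Fin (n + 1)) K →ₐ[K] 𝕏.S := 𝕏.dehomogenization.comp 𝕏.toR

lemma toS_apply (f : MvPolynomial (Fin (n + 1)) K) : 𝕏.toS f = 𝕏.dehomogenization (𝕏.toR f) := rfl

lemma toS_surjective : Function.Surjective 𝕏.toS :=
  𝕏.dehomogenization_surjective.comp 𝕏.toR_surjective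

lemma toS_X_zero : 𝕏.toS (X 0) = 1 := by
  have : 𝕏.dehomogenization (𝕏.x 0 - 1) = 0 :=
    Ideal.Quotient.eq_zero_iff_mem.2 (Ideal.mem_span_singleton_self _)
  rw [map_sub, map_one, sub_eq_zero] at this
  exact this

lemma toS_eq (f : MvPolynomial (Fin (n + 1)) K) : 𝕏.toS f = 𝕏.affinePresentation (dehom f) := by
  have : 𝕏.toS = 𝕏.affinePresentation.comp dehom := by
    ext i
    refine Fin.cases ?_ (fun i => ?_) i
    · rw [AlgHom.comp_apply, dehom_X_zero, map_one, toS_X_zero]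
    · rw [AlgHom.comp_apply, dehom_X_succ, affinePresentation, aeval_X]
      rfl
  rw [this]; rfl

lemma affinePresentation_surjective : Function.Surjective 𝕏.affinePresentation := fun s => by
  obtain ⟨f, rfl⟩ := 𝕏.toS_surjective s
  exact ⟨dehom f, (𝕏.toS_eq f).symm⟩

/-- Dehomogenization is injective on forms of a fixed degree. -/
lemma mem_of_toS_eq_zero {d : ℕ} {f : MvPolynomial (Fin (n + 1)) K} (hf : f.IsHomogeneous d)
    (h : 𝕏.toS f = 0) : f ∈ 𝕏.I := by
  -- The substitution `X_i ↦ x_i / x₀` kills `I`, by homogeneity, and `X₀ - 1`. It sends a form `f`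
  -- of degree `d` to `f / x₀ ^ d`, so `f` dies in the localization.
  let L := Localization.Away (𝕏.x 0)
  let ι : 𝕏.R →ₐ[K] L := IsScalarTower.toAlgHom K 𝕏.R L
  let u : L := IsLocalization.Away.invSelf (𝕏.x 0)
  have hu : ι (𝕏.x 0) * u = 1 := IsLocalization.Away.mul_invSelf (𝕏.x 0)
  let ψ : MvPolynomial (Fin (n + 1)) K →ₐ[K] L := aeval fun i => u * ι (𝕏.x i)
  have hψ : ∀ (d : ℕ) (g : MvPolynomial (Fin (n + 1)) K), g.IsHomogeneous d →
      ψ g = u ^ d * ι (𝕏.toR g) := by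
    intro d g hg
    have h1 : ι.comp 𝕏.toR = aeval fun i => ι (𝕏.x i) := by ext i; simp [x]
    have h2 : ι (𝕏.toR g) = aeval (fun i => ι (𝕏.x i)) g := by rw [← h1]; rfl
    rw [h2]
    exact aeval_mul_of_isHomogeneous hg u _
  have hψI : ∀ g ∈ 𝕏.I, ψ g = 0 := by
    intro g hg
    rw [← sum_homogeneousComponent g, map_sum]
    refine Finset.sum_eq_zero fun k _ => ?_
    rw [hψ k _ (homogeneousComponent_isHomogeneous k g),
      𝕏.toR_eq_zero_iff.2 (homogeneousComponent_mem_of_mem 𝕏.homogeneous hg k), map_zero, mul_zero]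
  have h0 : 𝕏.toR f ∈ Ideal.span {𝕏.x 0 - 1} := Ideal.Quotient.eq_zero_iff_mem.1 h
  obtain ⟨r, hr⟩ := Ideal.mem_span_singleton'.1 h0
  obtain ⟨g, rfl⟩ := 𝕏.toR_surjective r
  have h1 : g * (X 0 - 1) - f ∈ 𝕏.I := by
    rw [← toR_eq_zero_iff, map_sub, map_mul, map_sub, map_one, sub_eq_zero]
    exact hr
  have h2 : ψ f = 0 := by
    have := hψI _ h1
    have hX : ψ (X 0) = 1 := by
      simp only [ψ, aeval_X]; rw [mul_comm, hu]
    rw [map_sub, map_mul, map_sub, hX, map_one, sub_self, mul_zero, zero_sub, neg_eq_zero] at this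
    exact this
  rw [hψ d f hf] at h2
  have h3 : ι (𝕏.toR f) = 0 := by
    have h4 : ι (𝕏.x 0) ^ d * (u ^ d * ι (𝕏.toR f)) = 0 := by rw [h2, mul_zero]
    rwa [← mul_assoc, ← mul_pow, hu, one_pow, one_mul] at h4
  obtain ⟨⟨_, k, rfl⟩, hk⟩ := (IsLocalization.map_eq_zero_iff (Submonoid.powers (𝕏.x 0)) L _).1 h3
  have h5 : X 0 ^ k * f ∈ 𝕏.I := by
    rw [← toR_eq_zero_iff, map_mul, map_pow]; exact hk
  clear * - h5
  induction k with
  | zero => simpa using h5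
  | succ k ih =>
    rw [pow_succ', mul_assoc] at h5
    exact ih (𝕏.mem_of_X_zero_mul_mem h5)

end ZeroDimScheme

/-! ### Regularity indices of eventually constant functions -/

section RegularityIndex

lemma isHilbertPolynomial_const {H : ℤ → ℕ} {c : ℕ} {N : ℤ} (h : ∀ i, N ≤ i → H i = c) :
    IsHilbertPolynomial H (Polynomial.C (c : ℚ)) := by
  filter_upwards [Filter.eventually_ge_atTop N] with i hi
  rw [h i hi, Polynomial.eval_C]

/-- The regularity index of an eventually constant function. -/
lemma exists_isRegularityIndex {H : ℤ → ℕ} {c : ℕ} {N₀ : ℤ} (h : ∀ i, N₀ ≤ i → H i = c) :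
    ∃ ρ : WithBot ℤ, IsRegularityIndex H ρ ∧ (∀ N : ℤ, (∀ i, N ≤ i → H i = c) → ρ ≤ N) ∧
      ∀ N : ℤ, (∀ i, N ≤ i → H i = c) → H (N - 1) ≠ c → ρ = N := by
  classical
  have heval : ∀ j : ℤ, (H j : ℚ) = (Polynomial.C (c : ℚ)).eval (j : ℚ) ↔ H j = c := fun j => by
    rw [Polynomial.eval_C, Nat.cast_inj]
  by_cases hall : ∀ i, H i = c
  · refine ⟨⊥, ⟨_, isHilbertPolynomial_const h, Or.inl ⟨rfl, fun j => (heval j).2 (hall j)⟩⟩,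
      fun _ _ => bot_le, fun N _ hN => absurd (hall _) hN⟩
  · push Not at hall
    obtain ⟨i₀, hi₀⟩ := hall
    have hbdd : ∀ z : ℤ, (∀ i, z ≤ i → H i = c) → i₀ ≤ z := fun z hz => by
      by_contra hlt
      exact hi₀ (hz i₀ (by omega))
    obtain ⟨m, hm, hmin⟩ := Int.exists_least_of_bdd ⟨i₀, hbdd⟩ ⟨N₀, h⟩
    refine ⟨(m : WithBot ℤ), ⟨_, isHilbertPolynomial_const h, Or.inr ⟨m, rfl, ?_, ?_⟩⟩,
      fun N hN => WithBot.coe_le_coe.2 (hmin N hN), fun N hN hne => ?_⟩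
    · exact fun j hj => (heval j).2 (hm j hj)
    · exact fun z hz => hmin z fun j hj => (heval j).1 (hz j hj)
    · have h1 := hmin N hN
      have h2 : ¬ m ≤ N - 1 := fun hle => hne (hm _ hle)
      rw [show m = N by omega]

end RegularityIndex

/-! ### Hilbert functions as dimensions of subspaces of `S` -/

namespace ZeroDimScheme

open MvPolynomial

attribute [local instance] MvPolynomial.gradedAlgebra

variable {K : Type*} [Field K] {n : ℕ} (𝕏 : ZeroDimScheme K n)

/-- The degree filtration of the affine coordinate ring. -/
noncomputable def filtr (d : ℕ) : Submodule K 𝕏.S :=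
  (homogeneousSubmodule (Fin (n + 1)) K d).map 𝕏.toS.toLinearMap

lemma mem_filtr {d : ℕ} {s : 𝕏.S} :
    s ∈ 𝕏.filtr d ↔ ∃ f : MvPolynomial (Fin (n + 1)) K, f.IsHomogeneous d ∧ 𝕏.toS f = s := Iff.rfl

lemma filtr_mono {d e : ℕ} (h : d ≤ e) : 𝕏.filtr d ≤ 𝕏.filtr e := by
  rintro _ ⟨f, hf, rfl⟩
  refine ⟨X 0 ^ (e - d) * f, ?_, ?_⟩
  · have := (isHomogeneous_X_pow (R := K) (0 : Fin (n + 1)) (e - d)).mul hf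
    rwa [Nat.sub_add_cancel h] at this
  · change 𝕏.toS _ = 𝕏.toS f
    rw [map_mul, map_pow, toS_X_zero, one_pow, one_mul]

lemma map_mem_filtr {d : ℕ} {a : MvPolynomial (Fin n) K} (ha : a.totalDegree ≤ d) :
    𝕏.affinePresentation a ∈ 𝕏.filtr d := by
  obtain ⟨F, hF, rfl⟩ := exists_dehom_eq d a ha
  exact ⟨F, hF, 𝕏.toS_eq F⟩

lemma exists_of_mem_filtr {d : ℕ} {s : 𝕏.S} (hs : s ∈ 𝕏.filtr d) :
    ∃ a : MvPolynomial (Fin n) K, a.totalDegree ≤ d ∧ 𝕏.affinePresentation a = s := by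
  obtain ⟨F, hF, rfl⟩ := hs
  exact ⟨dehom F, totalDegree_dehom_le hF, (𝕏.toS_eq F).symm⟩

instance (d : ℕ) : Module.Finite K (𝕏.filtr d) :=
  Module.Finite.iff_fg.2 ((homogeneousSubmodule_fg (Fin (n + 1)) K d).map _)

/-- In degrees from `(n + 1) N` on every monomial lies in `I + (X₀)`, so forms of degree `d + 1` are
`X₀` times forms of degree `d` modulo `I`, and the filtration stops growing. -/
lemma exists_filtr_eq_top : ∃ D, 𝕏.filtr D = ⊤ := by
  obtain ⟨N, hN⟩ := 𝕏.exists_X_pow_mem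
  let D := (n + 1) * N
  have hstep : ∀ d, D ≤ d → 𝕏.filtr (d + 1) ≤ 𝕏.filtr d := by
    rintro d hd _ ⟨f, hf, rfl⟩
    change 𝕏.toS f ∈ _
    rw [f.as_sum, map_sum]
    refine Submodule.sum_mem _ fun α hα => ?_
    have hdeg : α.degree = d + 1 := by
      rw [Finsupp.degree_eq_weight_one]; exact hf (mem_support_iff.1 hα)
    obtain ⟨a, ha, b, hb, hab⟩ := Submodule.mem_sup.1
      (𝕏.monomial_mem_of_degree hN (α := α) (by rw [hdeg]; exact hd.trans (Nat.le_succ d)))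
    obtain ⟨c, rfl⟩ := Ideal.mem_span_singleton'.1 hb
    have h1 := congrArg (homogeneousComponent (1 + d)) hab
    rw [map_add, mul_comm c, homogeneousComponent_mul_of_isHomogeneous (isHomogeneous_X K 0),
      homogeneousComponent_of_mem (isHomogeneous_monomial 1 hdeg), if_pos (add_comm _ _)] at h1
    have h2 : 𝕏.toS (homogeneousComponent (1 + d) a) = 0 := by
      rw [toS_apply, 𝕏.toR_eq_zero_iff.2 (homogeneousComponent_mem_of_mem 𝕏.homogeneous ha _),
        map_zero]
    rw [monomial_eq_smul_one, map_smul, ← h1, map_add, h2, zero_add, map_mul, toS_X_zero, one_mul]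
    exact Submodule.smul_mem _ _ ⟨_, homogeneousComponent_isHomogeneous d c, rfl⟩
  have hle : ∀ d, 𝕏.filtr d ≤ 𝕏.filtr D := by
    intro d
    rcases le_total d D with h | h
    · exact 𝕏.filtr_mono h
    · induction d, h using Nat.le_induction with
      | base => exact le_rfl
      | succ d hd ih => exact (hstep d hd).trans ih
  refine ⟨D, eq_top_iff.2 fun s _ => ?_⟩
  obtain ⟨f, rfl⟩ := 𝕏.toS_surjective s
  rw [← sum_homogeneousComponent f, map_sum]
  exact Submodule.sum_mem _ fun d _ =>
    hle d ⟨_, homogeneousComponent_isHomogeneous d f, rfl⟩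

instance : Module.Finite K 𝕏.S := by
  obtain ⟨D, hD⟩ := 𝕏.exists_filtr_eq_top
  have : Module.Finite K (⊤ : Submodule K 𝕏.S) := hD ▸ inferInstance
  exact Module.Finite.of_surjective (⊤ : Submodule K 𝕏.S).subtype fun s => ⟨⟨s, trivial⟩, rfl⟩

instance : Nontrivial 𝕏.S := by
  by_contra h
  rw [not_nontrivial_iff_subsingleton] at h
  have h1 : (1 : MvPolynomial (Fin (n + 1)) K) ∈ 𝕏.I :=
    𝕏.mem_of_toS_eq_zero (isHomogeneous_one (Fin (n + 1)) K) (Subsingleton.elim _ _)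
  have h2 : 𝕏.I = ⊤ := (Ideal.eq_top_iff_one _).2 h1
  have h3 := 𝕏.dim_eq
  have : Subsingleton (MvPolynomial (Fin (n + 1)) K ⧸ 𝕏.I) :=
    Ideal.Quotient.subsingleton_iff.2 h2
  rw [ringKrullDim_eq_bot_of_subsingleton] at h3
  exact absurd h3 (by simp)

/-- The regularity index of the coordinate ring. -/
noncomputable def reg : ℕ := sInf {d | 𝕏.filtr d = ⊤}

lemma filtr_reg : 𝕏.filtr 𝕏.reg = ⊤ := Nat.sInf_mem 𝕏.exists_filtr_eq_top

lemma filtr_eq_top {d : ℕ} (h : 𝕏.reg ≤ d) : 𝕏.filtr d = ⊤ :=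
  eq_top_iff.2 (𝕏.filtr_reg ▸ 𝕏.filtr_mono h)

lemma filtr_ne_top {d : ℕ} (h : d < 𝕏.reg) : 𝕏.filtr d ≠ ⊤ := fun hd =>
  absurd (Nat.sInf_le (s := {d | 𝕏.filtr d = ⊤}) hd) (by change ¬ 𝕏.reg ≤ d; omega)

/-- The image in the affine coordinate ring of a homogeneous component of an ideal. -/
noncomputable def image (𝔞 : Ideal 𝕏.R) (i : ℤ) : Submodule K 𝕏.S :=
  (𝔞.restrictScalars K ⊓ 𝕏.component i).map 𝕏.dehomogenization.toLinearMap

lemma mem_component {k : ℕ} {u : 𝕏.R} : u ∈ 𝕏.component k ↔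
    ∃ f : MvPolynomial (Fin (n + 1)) K, f.IsHomogeneous k ∧ 𝕏.toR f = u := by
  rw [component, if_pos (Int.natCast_nonneg k), Int.toNat_natCast]
  exact Iff.rfl

lemma component_of_neg {i : ℤ} (h : i < 0) : 𝕏.component i = ⊥ := by
  rw [component, if_neg (by omega)]

lemma mem_image {𝔞 : Ideal 𝕏.R} {k : ℕ} {s : 𝕏.S} : s ∈ 𝕏.image 𝔞 k ↔
    ∃ f : MvPolynomial (Fin (n + 1)) K, f.IsHomogeneous k ∧ 𝕏.toR f ∈ 𝔞 ∧ 𝕏.toS f = s := by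
  constructor
  · rintro ⟨u, ⟨h1, h2⟩, rfl⟩
    obtain ⟨f, hf, rfl⟩ := 𝕏.mem_component.1 h2
    exact ⟨f, hf, h1, rfl⟩
  · rintro ⟨f, hf, h1, rfl⟩
    exact ⟨𝕏.toR f, ⟨h1, 𝕏.mem_component.2 ⟨f, hf, rfl⟩⟩, rfl⟩

lemma hilbertFunction_eq (𝔞 : Ideal 𝕏.R) (i : ℤ) :
    𝕏.hilbertFunction 𝔞 i = Module.finrank K (𝕏.image 𝔞 i) := by
  rw [hilbertFunction, image, ← LinearMap.range_domRestrict]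
  refine (LinearMap.finrank_range_of_inj ?_).symm
  rw [← LinearMap.ker_eq_bot, LinearMap.ker_eq_bot']
  rintro ⟨u, h1, h2⟩ hu
  refine Subtype.ext ?_
  rcases lt_or_ge i 0 with h | h
  · rw [𝕏.component_of_neg h] at h2
    exact h2
  · obtain ⟨k, rfl⟩ := Int.eq_ofNat_of_zero_le h
    obtain ⟨f, hf, rfl⟩ := 𝕏.mem_component.1 h2
    exact 𝕏.toR_eq_zero_iff.2 (𝕏.mem_of_toS_eq_zero hf hu)

lemma image_of_neg (𝔞 : Ideal 𝕏.R) {i : ℤ} (h : i < 0) : 𝕏.image 𝔞 i = ⊥ := by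
  rw [image, 𝕏.component_of_neg h, inf_bot_eq, Submodule.map_bot]

lemma image_top (k : ℕ) : 𝕏.image ⊤ k = 𝕏.filtr k := by
  ext s
  rw [mem_image, mem_filtr]
  simp

lemma isRegularityIndex_reg : IsRegularityIndex (𝕏.hilbertFunction ⊤) ((𝕏.reg : ℤ) : WithBot ℤ) := by
  have h1 : ∀ i : ℤ, (𝕏.reg : ℤ) ≤ i → 𝕏.hilbertFunction ⊤ i = Module.finrank K 𝕏.S := by
    intro i hi
    obtain ⟨k, rfl⟩ := Int.eq_ofNat_of_zero_le ((Int.natCast_nonneg _).trans hi)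
    rw [hilbertFunction_eq, image_top, 𝕏.filtr_eq_top (by exact_mod_cast hi), finrank_top]
  obtain ⟨ρ, hρ, -, h2⟩ := exists_isRegularityIndex h1
  rw [← h2 _ h1 ?_]
  · exact hρ
  · rw [hilbertFunction_eq]
    -- If `reg = 0`, the value just below it is taken in degree `-1`, where the component is zero
    -- whereas `S` is not.
    rcases Nat.eq_zero_or_pos 𝕏.reg with h | h
    · rw [𝕏.image_of_neg _ (by omega), finrank_bot]
      exact Module.finrank_pos.ne
    · obtain ⟨k, hk⟩ := Nat.exists_eq_succ_of_ne_zero h.ne'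
      have : (𝕏.reg : ℤ) - 1 = k := by omega
      rw [this, image_top]
      exact fun h' => 𝕏.filtr_ne_top (d := k) (by omega) (Submodule.eq_top_of_finrank_eq h')

lemma polyGrad_dehom (F : MvPolynomial (Fin (n + 1)) K) (j : Fin n) :
    polyGrad 𝕏.affinePresentation (dehom F) j = 𝕏.dehomogenization (tailGrad 𝕏.toR F j) := by
  rw [polyGrad, pderiv_dehom, ← toS_eq]; rfl

lemma kaehlerDifferent_eq : 𝕏.kaehlerDifferent = minorIdeal (relationGrads 𝕏.toR) :=
  initialFittingIdeal_kaehler 𝕏.toR 𝕏.toR_surjective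

lemma dehomogenization_mem_jacobianIdeal {u : 𝕏.R} (hu : u ∈ 𝕏.kaehlerDifferent) :
    𝕏.dehomogenization u ∈ jacobianIdeal 𝕏.affinePresentation := by
  rw [kaehlerDifferent_eq] at hu
  have hle : minorIdeal (relationGrads 𝕏.toR) ≤
      (jacobianIdeal 𝕏.affinePresentation).comap 𝕏.dehomogenization := by
    rw [minorIdeal, Ideal.span_le]
    rintro _ ⟨v, hv, rfl⟩
    choose f hf hvf using hv
    refine Ideal.subset_span ⟨fun i => dehom (f i), fun i => ?_, ?_⟩
    · rw [← toS_eq, toS_apply, hf, map_zero]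
    · rw [AlgHom.map_det]
      congr 1
      ext i j
      simp only [AlgHom.mapMatrix_apply, Matrix.map_apply, Matrix.of_apply]
      rw [hvf, polyGrad_dehom]
  exact hle hu

lemma image_le_jacobianIdeal (i : ℤ) : 𝕏.image 𝕏.kaehlerDifferent i ≤
    (jacobianIdeal 𝕏.affinePresentation).restrictScalars K := by
  rintro _ ⟨u, ⟨hu, -⟩, rfl⟩
  exact 𝕏.dehomogenization_mem_jacobianIdeal hu

/-- Relations of degree at most `d + 1` homogenize to forms of degree `d + 1` in `I`; each
derivative loses one degree, so the determinant is a form of degree `n d` in `ϑ`. -/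
lemma mul_det_mem_image {d k : ℕ} {f : Fin n → MvPolynomial (Fin n) K}
    (hf : ∀ i, 𝕏.affinePresentation (f i) = 0) (hd : ∀ i, (f i).totalDegree ≤ d + 1)
    {s : 𝕏.S} (hs : s ∈ 𝕏.filtr k) :
    s * (Matrix.of fun i => polyGrad 𝕏.affinePresentation (f i)).det ∈
      𝕏.image 𝕏.kaehlerDifferent ((n * d + k : ℕ) : ℤ) := by
  obtain ⟨g, hg, rfl⟩ := hs
  choose F hF hFf using fun i => exists_dehom_eq (d + 1) (f i) (hd i)
  have hFI : ∀ i, 𝕏.toR (F i) = 0 := fun i => 𝕏.toR_eq_zero_iff.2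
    (𝕏.mem_of_toS_eq_zero (hF i) (by rw [toS_eq, hFf, hf]))
  let T : Matrix (Fin n) (Fin n) (MvPolynomial (Fin (n + 1)) K) :=
    Matrix.of fun i j => pderiv j.succ (F i)
  have hT : T.det.IsHomogeneous (n * d) := by
    rw [Matrix.det_apply]
    refine IsHomogeneous.sum _ _ _ fun τ _ => ?_
    have h1 : (∏ i, T (τ i) i).IsHomogeneous (∑ _i : Fin n, d) :=
      IsHomogeneous.prod _ _ _ fun i _ => (hF (τ i)).pderiv
    rw [Finset.sum_const, Finset.card_univ, Fintype.card_fin, smul_eq_mul] at h1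
    rcases Int.units_eq_one_or (Equiv.Perm.sign τ) with h | h
    · simpa [h] using h1
    · rw [h, Units.neg_smul, one_smul]; exact h1.neg
  refine 𝕏.mem_image.2 ⟨g * T.det, ?_, ?_, ?_⟩
  · rw [mul_comm]; exact hT.mul hg
  · rw [map_mul, AlgHom.map_det, kaehlerDifferent_eq]
    refine Ideal.mul_mem_left _ _ ?_
    exact det_mem_minorIdeal (v := fun i => tailGrad 𝕏.toR (F i)) fun i => ⟨F i, hFI i, rfl⟩
  · rw [map_mul, AlgHom.map_det]
    change _ = 𝕏.toS g * _
    congr 2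
    ext i j
    rw [Matrix.of_apply, ← hFf, polyGrad_dehom]
    rfl

end ZeroDimScheme

/-! ### Relations of bounded degree and the bound `(n + 1) r` -/

namespace ZeroDimScheme

open MvPolynomial

attribute [local instance] MvPolynomial.gradedAlgebra

variable {K : Type*} [Field K] {n : ℕ} (𝕏 : ZeroDimScheme K n)

/-- Elements of the affine coordinate ring have linear lifts of degree at most the regularity
index. -/
lemma exists_section : ∃ σ : 𝕏.S →ₗ[K] MvPolynomial (Fin n) K,
    (∀ s, 𝕏.affinePresentation (σ s) = s) ∧ ∀ s, (σ s).totalDegree ≤ 𝕏.reg := by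
  let φ : degreeLess (Fin n) K (𝕏.reg + 1) →ₗ[K] 𝕏.S :=
    𝕏.affinePresentation.toLinearMap ∘ₗ Submodule.subtype _
  have hφ : Function.Surjective φ := by
    intro s
    obtain ⟨a, ha, rfl⟩ := 𝕏.exists_of_mem_filtr (s := s) (d := 𝕏.reg)
      (by rw [filtr_reg]; trivial)
    exact ⟨⟨a, mem_degreeLess_succ.2 ha⟩, rfl⟩
  obtain ⟨τ, hτ⟩ := φ.exists_rightInverse_of_surjective (LinearMap.range_eq_top.2 hφ)
  refine ⟨Submodule.subtype _ ∘ₗ τ, fun s => ?_, fun s => mem_degreeLess_succ.1 (τ s).2⟩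
  exact congrArg (fun g : 𝕏.S →ₗ[K] 𝕏.S => g s) hτ

/-- The affine coordinates. -/
noncomputable def coord (i : Fin n) : 𝕏.S := 𝕏.affinePresentation (X i)

/-- The gradients of the relations of degree at most `d`. -/
def boundedGrads (d : ℕ) : Set (Fin n → 𝕏.S) :=
  {v | ∃ f, 𝕏.affinePresentation f = 0 ∧ f.totalDegree ≤ d ∧ v = polyGrad 𝕏.affinePresentation f}

lemma polyGrad_coord_relation_mem {σ : 𝕏.S →ₗ[K] MvPolynomial (Fin n) K}
    (hσ : ∀ s, 𝕏.affinePresentation (σ s) = s) (hd : ∀ s, (σ s).totalDegree ≤ 𝕏.reg)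
    (i : Fin n) (s : 𝕏.S) :
    polyGrad 𝕏.affinePresentation (X i * σ s - σ (𝕏.coord i * s)) ∈
      𝕏.boundedGrads (𝕏.reg + 1) := by
  refine ⟨_, ?_, ?_, rfl⟩
  · rw [map_sub, map_mul, hσ, hσ]; exact sub_self _
  · refine (totalDegree_sub _ _).trans (max_le ((totalDegree_mul _ _).trans ?_)
      ((hd _).trans (Nat.le_succ _)))
    rw [totalDegree_X, add_comm]
    exact Nat.add_le_add_right (hd s) 1

lemma polyGrad_X (π : MvPolynomial (Fin n) K →ₐ[K] 𝕏.S) (i : Fin n) :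
    polyGrad π (X i) = Pi.single i 1 := by
  ext j
  by_cases h : j = i
  · subst h; simp [polyGrad]
  · simp [polyGrad, pderiv_X_of_ne (Ne.symm h), h]

/-- The gradients of relations are combinations of those of relations of small degree. -/
lemma polyGrad_mem_span {f : MvPolynomial (Fin n) K} (hf : 𝕏.affinePresentation f = 0) :
    polyGrad 𝕏.affinePresentation f ∈ Submodule.span 𝕏.S (𝕏.boundedGrads (𝕏.reg + 1)) := by
  obtain ⟨σ, hσ, hd⟩ := 𝕏.exists_section
  set π := 𝕏.affinePresentation with hπ
  -- Any polynomial reduces to its bounded lift `σ (π a)` one variable at a time, each step using a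
  -- relation `X i * σ s - σ (x_i s)`. Constants contribute the relation `σ 1 - 1`.
  have key : ∀ a : MvPolynomial (Fin n) K, polyGrad π a - polyGrad π (σ (π a)) ∈
      Submodule.span 𝕏.S (𝕏.boundedGrads (𝕏.reg + 1)) := by
    intro a
    induction a using MvPolynomial.induction_on with
    | C c =>
      have h1 : π (C c) = c • (1 : 𝕏.S) := by
        rw [← Algebra.algebraMap_eq_smul_one]; exact π.commutes c
      have h2 : polyGrad π (C c) = 0 := by ext j; simp [polyGrad]
      have h3 : polyGrad π (σ (c • (1 : 𝕏.S))) =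
          algebraMap K 𝕏.S c • polyGrad π (σ 1 - 1) := by
        rw [map_smul, algebraMap_smul]
        ext j
        simp [polyGrad]
      rw [h1, h2, h3, zero_sub]
      refine Submodule.neg_mem _ (Submodule.smul_mem _ _ (Submodule.subset_span ⟨_, ?_, ?_, rfl⟩))
      · rw [map_sub, hσ, map_one, sub_self]
      · refine (totalDegree_sub _ _).trans (max_le ((hd _).trans (Nat.le_succ _)) ?_)
        simp
    | add a b ha hb =>
      have : polyGrad π (a + b) - polyGrad π (σ (π (a + b))) =
          (polyGrad π a - polyGrad π (σ (π a))) + (polyGrad π b - polyGrad π (σ (π b))) := by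
        rw [map_add, map_add, polyGrad_add, polyGrad_add]; abel
      rw [this]
      exact Submodule.add_mem _ ha hb
    | mul_X a i ha =>
      have : polyGrad π (a * X i) - polyGrad π (σ (π (a * X i))) =
          𝕏.coord i • (polyGrad π a - polyGrad π (σ (π a))) +
            polyGrad π (X i * σ (π a) - σ (𝕏.coord i * π a)) := by
        have h1 : π (a * X i) = 𝕏.coord i * π a := by rw [map_mul, mul_comm]; rfl
        rw [h1, polyGrad_sub, polyGrad_mul, polyGrad_mul, hσ, smul_sub]
        change _ + 𝕏.coord i • _ - _ = _ + (𝕏.coord i • _ + _ - _)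
        abel
      rw [this]
      exact Submodule.add_mem _ (Submodule.smul_mem _ _ ha)
        (Submodule.subset_span (𝕏.polyGrad_coord_relation_mem hσ hd i _))
  have := key f
  have h0 : polyGrad π 0 = 0 := by ext j; simp [polyGrad]
  rwa [hf, map_zero, h0, sub_zero] at this

lemma jacobianIdeal_le_minorIdeal :
    jacobianIdeal 𝕏.affinePresentation ≤ minorIdeal (𝕏.boundedGrads (𝕏.reg + 1)) := by
  rw [jacobianIdeal, Ideal.span_le]
  rintro _ ⟨f, hf, rfl⟩
  exact det_mem_minorIdeal_of_span fun i => 𝕏.polyGrad_mem_span (hf i)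

lemma mul_det_mem_image_of_boundedGrads {d k : ℕ} {v : Fin n → Fin n → 𝕏.S}
    (hv : ∀ i, v i ∈ 𝕏.boundedGrads (d + 1)) {s : 𝕏.S} (hs : s ∈ 𝕏.filtr k) :
    s * (Matrix.of v).det ∈ 𝕏.image 𝕏.kaehlerDifferent ((n * d + k : ℕ) : ℤ) := by
  choose f hf hd hvf using hv
  have := 𝕏.mul_det_mem_image hf hd hs
  rwa [← funext hvf] at this

/-- The generating determinants live in degree `n * reg`; the remaining degree is at least `reg`,
enough for all multiples by elements of `S`. -/
lemma image_eq_jacobianIdeal_of_le {i : ℤ} (hi : ((n + 1) * 𝕏.reg : ℤ) ≤ i) :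
    𝕏.image 𝕏.kaehlerDifferent i =
      (jacobianIdeal 𝕏.affinePresentation).restrictScalars K := by
  refine le_antisymm (𝕏.image_le_jacobianIdeal i) fun s hs => ?_
  obtain ⟨k, hk, rfl⟩ : ∃ k : ℕ, 𝕏.reg ≤ k ∧ i = ((n * 𝕏.reg + k : ℕ) : ℤ) := by
    refine ⟨(i - n * 𝕏.reg).toNat, ?_, ?_⟩
    · have : (𝕏.reg : ℤ) ≤ i - n * 𝕏.reg := by linarith
      omega
    · have : (0 : ℤ) ≤ i - n * 𝕏.reg := by
        have : (0 : ℤ) ≤ 𝕏.reg := Int.natCast_nonneg _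
        linarith
      push_cast
      rw [Int.toNat_of_nonneg this]; ring
  have h1 : ∀ c : 𝕏.S, c * s ∈ 𝕏.image 𝕏.kaehlerDifferent ((n * 𝕏.reg + k : ℕ) : ℤ) := by
    have hs' := 𝕏.jacobianIdeal_le_minorIdeal hs
    clear hs
    induction hs' using Submodule.span_induction with
    | mem s hs =>
      obtain ⟨v, hv, rfl⟩ := hs
      exact fun c => 𝕏.mul_det_mem_image_of_boundedGrads hv
        (by rw [𝕏.filtr_eq_top hk]; trivial)
    | zero => intro c; rw [mul_zero]; exact Submodule.zero_mem _
    | add a b _ _ ha hb => intro c; rw [mul_add]; exact Submodule.add_mem _ (ha c) (hb c)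
    | smul a s _ hs => intro c; rw [smul_eq_mul, ← mul_assoc]; exact hs _
  simpa using h1 1

lemma kappa_eq (p : 𝕏.Point) : p.kappa = Module.finrank K (𝕏.S ⧸ p.asIdeal) := by
  have := p.isMaximal
  let φ : (𝕏.S ⧸ p.asIdeal) →ₐ[K] p.asIdeal.ResidueField :=
    IsScalarTower.toAlgHom K (𝕏.S ⧸ p.asIdeal) p.asIdeal.ResidueField
  exact (LinearEquiv.ofBijective φ.toLinearMap
    p.asIdeal.bijective_algebraMap_quotient_residueField).finrank_eq.symm

lemma finrank_jacobianIdeal_eq (hchar : ringChar K = 0 ∨ 𝕏.degree < ringChar K) :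
    Module.finrank K ((jacobianIdeal 𝕏.affinePresentation).restrictScalars K) =
      ∑ᶠ p ∈ 𝕏.ciPoints, p.kappa := by
  rw [finrank_jacobianIdeal 𝕏.affinePresentation_surjective hchar 𝕏.ciPoints]
  · exact finsum_congr fun p => by rw [kappa_eq]
  · rintro p ⟨rs, hrs, -, h⟩
    have := p.isMaximal.isPrime
    exact exists_generatesAt_of_isLocalization rfl rs hrs h
  · intro p M g hM hg hgπ hgen
    have := p.isMaximal.isPrime
    exact isRegular_of_generatesAt rfl hM hg hgπ hgen

lemma finite_ciPoints : 𝕏.ciPoints.Finite := by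
  have : IsArtinianRing 𝕏.S := IsArtinianRing.of_finite K _
  exact Set.toFinite _

end ZeroDimScheme

/-! ### A rank one perturbation of an idempotent -/

section IdempotentDeterminant

open Matrix

variable {A : Type*} [CommRing A] {n : ℕ}

/-- The characteristic polynomial of a rank one matrix gives `e ^ n + e ^ (n - 1) (u · v)`. For `n ≥
2` the second term still has a factor `e`, which kills `u`; this fails for `n = 1`. -/
lemma det_smul_one_add_vecMulVec_of_mul_eq_zero {e : A} (he : e * e = e) {u v : Fin n → A}
    (hu : ∀ i, e * u i = 0) (hn : 2 ≤ n) :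
    (Matrix.of fun i j => e * (if i = j then 1 else 0) + u i * v j).det = e := by
  have h1 := Matrix.eval_charpoly (vecMulVec u (-v)) e
  rw [charpoly_vecMulVec, Fintype.card_fin] at h1
  have h2 : (Matrix.of fun i j => e * (if i = j then 1 else 0) + u i * v j) =
      Matrix.scalar (Fin n) e - vecMulVec u (-v) := by
    ext i j
    by_cases h : i = j <;> simp [vecMulVec_apply, h]
  have h3 : ∀ m, e ^ (m + 1) = e := fun m => by
    induction m with
    | zero => rw [zero_add, pow_one]
    | succ m ih => rw [pow_succ, ih, he]
  obtain ⟨m, rfl⟩ := Nat.exists_eq_add_of_le' hn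
  rw [h2, ← h1]
  simp only [Polynomial.eval_sub, Polynomial.eval_pow, Polynomial.eval_X, Polynomial.eval_smul,
    smul_eq_mul]
  rw [show m + 2 - 1 = m + 1 from rfl, h3 m, h3 (m + 1), dotProduct, Finset.sum_mul,
    Finset.sum_eq_zero, sub_zero]
  intro i _
  rw [mul_comm, ← mul_assoc, hu, zero_mul]

end IdempotentDeterminant

/-! ### Polarization over the residue field -/

section TracePolarization

open TensorProduct Module

variable {K L S : Type*} [Field K] [Field L] [Algebra K L] [FiniteDimensional K L]
  [Algebra.IsSeparable K L] [CommRing S] [Algebra K S] {ι : Type*} [Fintype ι] [DecidableEq ι]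
  (b : Basis ι K L)

lemma repr_eq_trace (x : L) (i : ι) : b.repr x i = Algebra.trace K L (x * b.traceDual i) := by
  have := b.traceDual.traceDual_repr_apply x i
  rwa [b.traceDual_traceDual, Algebra.traceForm_apply] at this

/-- Pairing the sum with `l` under the trace form gives the matrix trace of multiplication by `l`,
which is also the pairing of `1` with `l`. -/
lemma sum_mul_traceDual : ∑ k, b k * b.traceDual k = 1 := by
  have h : ∀ l : L, Algebra.traceForm K L (∑ k, b k * b.traceDual k - 1) l = 0 := by
    intro l
    rw [Algebra.traceForm_apply, sub_mul, one_mul, map_sub, Finset.sum_mul, map_sum, sub_eq_zero,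
      Algebra.trace_eq_matrix_trace b l, Matrix.trace]
    refine Finset.sum_congr rfl fun k _ => ?_
    rw [Matrix.diag_apply, Algebra.leftMulMatrix_eq_repr_mul, repr_eq_trace]
    ring_nf
  have := (traceForm_nondegenerate K L).1 _ h
  exact sub_eq_zero.1 this

/-- The tensor that represents a linear map with respect to the trace form. -/
noncomputable def traceTensor (φ : L →ₗ[K] S) : L ⊗[K] S := ∑ k, b.traceDual k ⊗ₜ[K] φ (b k)

lemma traceTensor_sub (φ ψ : L →ₗ[K] S) :
    traceTensor b (φ - ψ) = traceTensor b φ - traceTensor b ψ := by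
  simp [traceTensor, tmul_sub, Finset.sum_sub_distrib]

lemma traceTensor_comp_mulLeft (φ : L →ₗ[K] S) (ξ : L) :
    traceTensor b (φ ∘ₗ LinearMap.mulLeft K ξ) = (ξ ⊗ₜ[K] (1 : S)) * traceTensor b φ := by
  have h1 : ∀ k, φ (ξ * b k) = ∑ m, Algebra.trace K L (ξ * b k * b.traceDual m) • φ (b m) := by
    intro k
    conv_lhs => rw [← b.sum_repr (ξ * b k)]
    rw [map_sum]
    exact Finset.sum_congr rfl fun m _ => by rw [map_smul, repr_eq_trace]
  have h2 : ∀ m, ξ * b.traceDual m =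
      ∑ k, Algebra.trace K L (ξ * b k * b.traceDual m) • b.traceDual k := by
    intro m
    conv_lhs => rw [← b.traceDual.sum_repr (ξ * b.traceDual m)]
    refine Finset.sum_congr rfl fun k _ => ?_
    rw [b.traceDual_repr_apply, Algebra.traceForm_apply]
    congr 2; ring
  simp only [traceTensor, LinearMap.comp_apply, LinearMap.mulLeft_apply, Finset.mul_sum,
    Algebra.TensorProduct.tmul_mul_tmul, one_mul]
  simp_rw [h1, h2, tmul_sum, sum_tmul, tmul_smul, smul_tmul']
  exact Finset.sum_comm

lemma traceTensor_mulLeft_comp (φ : L →ₗ[K] S) (x : S) :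
    traceTensor b (LinearMap.mulLeft K x ∘ₗ φ) = ((1 : L) ⊗ₜ[K] x) * traceTensor b φ := by
  simp [traceTensor, Finset.mul_sum, Algebra.TensorProduct.tmul_mul_tmul]

lemma traceTensor_mul_self {β : L →ₗ[K] S} (hβ : ∀ l l', β l * β l' = β (l * l')) :
    traceTensor b β * traceTensor b β = traceTensor b β := by
  -- The tensor identifies the two actions of `L`; its square then collapses through `∑ b k *
  -- b.traceDual k = 1`.
  have h1 : ∀ l, ((1 : L) ⊗ₜ[K] β l) * traceTensor b β = (l ⊗ₜ[K] (1 : S)) * traceTensor b β := by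
    intro l
    rw [← traceTensor_mulLeft_comp, ← traceTensor_comp_mulLeft]
    congr 1
    ext l'
    exact hβ l l'
  conv_lhs => enter [1]; rw [traceTensor]
  rw [Finset.sum_mul]
  have h2 : ∀ k, (b.traceDual k ⊗ₜ[K] β (b k)) * traceTensor b β =
      ((b k * b.traceDual k) ⊗ₜ[K] (1 : S)) * traceTensor b β := by
    intro k
    have : b.traceDual k ⊗ₜ[K] β (b k) = (b.traceDual k ⊗ₜ[K] (1 : S)) * ((1 : L) ⊗ₜ[K] β (b k)) := by
      rw [Algebra.TensorProduct.tmul_mul_tmul, one_mul, mul_one]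
    rw [this, mul_assoc, h1, ← mul_assoc, Algebra.TensorProduct.tmul_mul_tmul, one_mul, mul_comm (b k)]
  rw [Finset.sum_congr rfl fun k _ => h2 k, ← Finset.sum_mul, ← sum_tmul, sum_mul_traceDual,
    ← Algebra.TensorProduct.one_def, one_mul]

lemma traceTensor_mem_of_forall {U : Submodule K S} {β : L →ₗ[K] S}
    (h : traceTensor b β ∈ LinearMap.ker (LinearMap.lTensor L U.mkQ)) (l : L) : β l ∈ U := by
  have h1 : ∀ k, β (b k) ∈ U := by
    intro k
    rw [LinearMap.mem_ker, traceTensor, map_sum] at h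
    simp only [LinearMap.lTensor_tmul] at h
    have := sum_tmul_basis_left_eq_zero b.traceDual
      (Finsupp.equivFunOnFinite.symm fun k => U.mkQ (β (b k))) (by
        rw [Finsupp.sum_fintype _ _ (by simp)]; simpa using h)
    have := DFunLike.congr_fun this k
    simpa using this
  rw [← b.sum_repr l, map_sum]
  exact Submodule.sum_mem _ fun k _ => by rw [map_smul]; exact U.smul_mem _ (h1 k)

/-- Multilinearity in the rows lets each row have its own argument in `L`, so the coefficients are
determinants of actual relation gradients. -/
lemma det_traceTensor {n : ℕ} (W : Fin n → Fin n → L →ₗ[K] S) :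
    (Matrix.of fun i j => traceTensor b (W i j)).det =
      ∑ κ : Fin n → ι, (∏ i, b.traceDual (κ i)) ⊗ₜ[K]
        (Matrix.of fun i j => W i j (b (κ i))).det := by
  have h1 : (Matrix.of fun i j => traceTensor b (W i j)).det =
      Matrix.detRowAlternating.toMultilinearMap fun i => ∑ k,
        fun j => b.traceDual k ⊗ₜ[K] W i j (b k) := by
    change Matrix.det _ = Matrix.det _
    congr 1
    ext i j
    simp [traceTensor]
  rw [h1, MultilinearMap.map_sum]
  refine Finset.sum_congr rfl fun κ _ => ?_
  have h2 : (fun i j => b.traceDual (κ i) ⊗ₜ[K] W i j (b (κ i))) = Matrix.of fun i j =>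
      (b.traceDual (κ i) ⊗ₜ[K] (1 : S)) *
        (Algebra.TensorProduct.includeRight : S →ₐ[K] L ⊗[K] S).toRingHom.mapMatrix
          (Matrix.of fun i j => W i j (b (κ i))) i j := by
    ext i j
    simp
  change Matrix.det _ = _
  rw [h2, Matrix.det_mul_column, ← RingHom.map_det]
  have h3 : ∏ i, (b.traceDual (κ i) ⊗ₜ[K] (1 : S)) = (∏ i, b.traceDual (κ i)) ⊗ₜ[K] (1 : S) :=
    (map_prod (Algebra.TensorProduct.includeLeft : L →ₐ[K] L ⊗[K] S) _ _).symm
  rw [h3]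
  simp

/-- A multiplicative system of residue classes belongs to every space that contains the
determinants of the gradients of its relations with the coordinates. -/
lemma mem_of_forall_det_mem {n : ℕ} (hn : 2 ≤ n) {U : Submodule K S} {β : L →ₗ[K] S}
    (hβ : ∀ l l', β l * β l' = β (l * l')) {x : Fin n → S} {ξ : Fin n → L}
    (hx : ∀ i l, x i * β l = β (ξ i * l)) (D : Fin n → L →ₗ[K] S)
    (hU : ∀ l : Fin n → L, (Matrix.of fun i j => β (l i) * (if i = j then 1 else 0) +
      x i * D j (l i) - D j (ξ i * l i)).det ∈ U) (l : L) : β l ∈ U := by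
  classical
  let b := Module.finBasis K L
  refine traceTensor_mem_of_forall b ?_ l
  let W : Fin n → Fin n → L →ₗ[K] S := fun i j => (if i = j then β else 0) +
    (LinearMap.mulLeft K (x i) ∘ₗ D j - D j ∘ₗ LinearMap.mulLeft K (ξ i))
  have hW : ∀ i j l, W i j l = β l * (if i = j then 1 else 0) + x i * D j l - D j (ξ i * l) := by
    intro i j l
    by_cases h : i = j
    · simp [W, h, add_sub_assoc]
    · simp [W, h]
  -- On tensors, `W` becomes the idempotent of `β` on the diagonal plus `u_i v_j`, where `u_i = 1 ⊗
  -- x_i - ξ_i ⊗ 1` annihilates that idempotent.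
  have h1 : traceTensor b β = (Matrix.of fun i j => traceTensor b (W i j)).det := by
    have he := traceTensor_mul_self b hβ
    rw [← det_smul_one_add_vecMulVec_of_mul_eq_zero he
      (u := fun i => (1 : L) ⊗ₜ[K] x i - ξ i ⊗ₜ[K] (1 : S)) (v := fun j => traceTensor b (D j))
      (fun i => ?_) hn]
    · congr 1
      ext i j
      have h2 : traceTensor b (W i j) = traceTensor b β * (if i = j then 1 else 0) +
          traceTensor b (LinearMap.mulLeft K (x i) ∘ₗ D j - D j ∘ₗ LinearMap.mulLeft K (ξ i)) := by
        by_cases h : i = j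
        · simp [W, h, traceTensor, tmul_add, Finset.sum_add_distrib]
        · simp [W, h]
      rw [Matrix.of_apply, Matrix.of_apply, h2, traceTensor_sub, traceTensor_mulLeft_comp,
        traceTensor_comp_mulLeft, sub_mul]
    · rw [mul_comm, sub_mul, ← traceTensor_mulLeft_comp, ← traceTensor_comp_mulLeft, sub_eq_zero]
      congr 1
      ext l
      exact hx i l
  rw [h1, det_traceTensor, LinearMap.mem_ker, map_sum]
  refine Finset.sum_eq_zero fun κ _ => ?_
  rw [LinearMap.lTensor_tmul]
  have : U.mkQ (Matrix.of fun i j => W i j (b (κ i))).det = 0 := by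
    rw [Submodule.mkQ_apply, Submodule.Quotient.mk_eq_zero]
    simpa only [hW] using hU fun i => b (κ i)
  rw [this, tmul_zero]

end TracePolarization

/-! ### Separability of the residue fields -/

section Separable

open Polynomial

variable {K : Type*} [Field K]

lemma derivative_ne_zero_of_lt_ringChar {f : K[X]} {d : ℕ} (hf : f.Monic)
    (hpos : 0 < f.natDegree) (hd : f.natDegree ≤ d) (hchar : ringChar K = 0 ∨ d < ringChar K) :
    derivative f ≠ 0 := by
  intro h
  have h1 := congrArg (Polynomial.coeff · (f.natDegree - 1)) h
  simp only [coeff_derivative, coeff_zero] at h1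
  rw [Nat.sub_add_cancel hpos, coeff_natDegree, hf, one_mul,
    ← Nat.cast_add_one, Nat.sub_add_cancel hpos] at h1
  exact cast_ne_zero_of_lt_ringChar hchar hpos hd h1

end Separable

lemma isSeparable_of_finrank_lt_ringChar {K L : Type*} [Field K] [Field L] [Algebra K L]
    [FiniteDimensional K L]
    (hchar : ringChar K = 0 ∨ Module.finrank K L < ringChar K) : Algebra.IsSeparable K L := by
  refine ⟨fun x => ?_⟩
  have hx := Algebra.IsIntegral.isIntegral (R := K) x
  have hpos := minpoly.natDegree_pos hx
  exact (Polynomial.separable_iff_derivative_ne_zero (minpoly.irreducible hx)).2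
    (derivative_ne_zero_of_lt_ringChar (minpoly.monic hx) hpos (minpoly.natDegree_le x) hchar)

/-- The nilpotent `e * x` vanishes in the reduced local ring, so some `t ∉ p` kills it, and `e` is a
multiple of `t`. -/
lemma IsLocalIdempotent.mul_eq_zero_of_isReduced {S : Type*} [CommRing S] {p : Ideal S}
    [p.IsPrime] {e : S} (he : IsLocalIdempotent p e) [IsReduced (Localization.AtPrime p)] {x : S}
    (hx : x ∈ p) : e * x = 0 := by
  have h1 : algebraMap S (Localization.AtPrime p) (e * x) = 0 :=
    ((he.isNilpotent hx).map (algebraMap S (Localization.AtPrime p))).eq_zero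
  obtain ⟨⟨t, ht⟩, h2⟩ := (IsLocalization.map_eq_zero_iff p.primeCompl _ _).1 h1
  obtain ⟨u, hu⟩ := he.exists_mul_eq t ht
  calc e * x = e * (e * x) := by rw [← mul_assoc, he.idem]
    _ = u * (t * (e * x)) := by rw [← mul_assoc u, ← hu]
    _ = 0 := by rw [h2, mul_zero]

/-! ### The bound `n r` for reduced complete intersection points -/

namespace ZeroDimScheme

open MvPolynomial

attribute [local instance] MvPolynomial.gradedAlgebra

variable {K : Type*} [Field K] {n : ℕ} (𝕏 : ZeroDimScheme K n)

/-- The gradient as a linear map. -/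
noncomputable def gradComponent (j : Fin n) : MvPolynomial (Fin n) K →ₗ[K] 𝕏.S :=
  𝕏.affinePresentation.toLinearMap ∘ₗ (pderiv (R := K) j).toLinearMap

/-- Here `p` vanishes on the local factor, so `e S` is a copy of the separable field `S ⧸ p`,
embedded multiplicatively by `β`. Polarization applies to the relations `X i * σ (β l) - σ (x_i β
l)`, without a further factor from `S` that would cost another `reg`. -/
lemma localIdempotent_mul_mem_image (hchar : ringChar K = 0 ∨ 𝕏.degree < ringChar K)
    (hn : 2 ≤ n) {p : Ideal 𝕏.S} [hp : p.IsMaximal] {e : 𝕏.S} (he : IsLocalIdempotent p e)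
    (hred : ∀ x ∈ p, e * x = 0) {i : ℤ} (hi : (n * 𝕏.reg : ℤ) ≤ i) (s : 𝕏.S) :
    e * s ∈ 𝕏.image 𝕏.kaehlerDifferent i := by
  obtain ⟨σ, hσ, hd⟩ := 𝕏.exists_section
  let _ : Field (𝕏.S ⧸ p) := Ideal.Quotient.field p
  have hfin : FiniteDimensional K (𝕏.S ⧸ p) :=
    inferInstanceAs (Module.Finite K (𝕏.S ⧸ p))
  let q : 𝕏.S →ₐ[K] 𝕏.S ⧸ p := Ideal.Quotient.mkₐ K p
  have hq : Function.Surjective q := Ideal.Quotient.mkₐ_surjective K p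
  have hle : Module.finrank K (𝕏.S ⧸ p) ≤ 𝕏.degree :=
    LinearMap.finrank_le_finrank_of_surjective (f := q.toLinearMap) hq
  have hsep : Algebra.IsSeparable K (𝕏.S ⧸ p) :=
    isSeparable_of_finrank_lt_ringChar (hchar.imp_right hle.trans_lt)
  obtain ⟨τ, hτ⟩ := q.toLinearMap.exists_rightInverse_of_surjective (LinearMap.range_eq_top.2 hq)
  have hτ' : ∀ l, q (τ l) = l := fun l => congrArg (fun g : (𝕏.S ⧸ p) →ₗ[K] (𝕏.S ⧸ p) => g l) hτ
  have heq : ∀ {a c : 𝕏.S}, q a = q c → e * a = e * c := by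
    intro a c h
    have := hred _ (Ideal.Quotient.eq.1 h)
    rwa [mul_sub, sub_eq_zero] at this
  let β : (𝕏.S ⧸ p) →ₗ[K] 𝕏.S := LinearMap.mulLeft K e ∘ₗ τ
  have hβ : ∀ a, β (q a) = e * a := fun a => heq (hτ' _)
  have hβmul : ∀ l l', β l * β l' = β (l * l') := by
    intro l l'
    obtain ⟨a, rfl⟩ := hq l
    obtain ⟨c, rfl⟩ := hq l'
    rw [← map_mul q, hβ, hβ, hβ, mul_mul_mul_comm, he.idem]
  have hβx : ∀ (j : Fin n) l, 𝕏.coord j * β l = β (q (𝕏.coord j) * l) := by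
    intro j l
    obtain ⟨a, rfl⟩ := hq l
    rw [← map_mul q, hβ, hβ]
    ring
  rw [← hβ s]
  refine mem_of_forall_det_mem hn hβmul hβx (fun j => 𝕏.gradComponent j ∘ₗ σ ∘ₗ β) (fun l => ?_) _
  -- The surplus degree `k` is absorbed by `X₀ ^ k`, which maps to `1` in `S`.
  obtain ⟨k, rfl⟩ : ∃ k : ℕ, i = ((n * 𝕏.reg + k : ℕ) : ℤ) := by
    refine ⟨(i - n * 𝕏.reg).toNat, ?_⟩
    push_cast
    rw [Int.toNat_of_nonneg (by linarith)]; ring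
  have h1 := 𝕏.mul_det_mem_image_of_boundedGrads (k := k)
    (fun i => 𝕏.polyGrad_coord_relation_mem hσ hd i (β (l i)))
    (s := 1) (𝕏.filtr_mono (Nat.zero_le k) ⟨1, isHomogeneous_one _ _, map_one 𝕏.toS⟩)
  rw [one_mul] at h1
  convert h1 using 2
  ext i j
  have h2 := congrFun (polyGrad_sub (π := 𝕏.affinePresentation) (X i * σ (β (l i)))
    (σ (𝕏.coord i * β (l i)))) j
  rw [Matrix.of_apply, Matrix.of_apply, h2, polyGrad_mul, polyGrad_X, hσ, hβx]
  simp only [Pi.sub_apply, Pi.add_apply, Pi.smul_apply, smul_eq_mul]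
  rw [Pi.single_apply, add_comm (β (l i) * _)]
  simp only [eq_comm (a := i) (b := j)]
  rfl

lemma image_eq_jacobianIdeal_of_reduced (hchar : ringChar K = 0 ∨ 𝕏.degree < ringChar K)
    (hn : 2 ≤ n) (hred : ∀ p ∈ 𝕏.ciPoints, p.Reduced) {i : ℤ} (hi : (n * 𝕏.reg : ℤ) ≤ i) :
    𝕏.image 𝕏.kaehlerDifferent i =
      (jacobianIdeal 𝕏.affinePresentation).restrictScalars K := by
  classical
  refine le_antisymm (𝕏.image_le_jacobianIdeal i) fun s hs => ?_
  have : IsArtinianRing 𝕏.S := IsArtinianRing.of_finite K _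
  have := Fintype.ofFinite 𝕏.Point
  have hmax : ∀ p : 𝕏.Point, p.asIdeal.IsMaximal := fun p => p.isMaximal
  choose e he using fun p : 𝕏.Point => exists_isLocalIdempotent p.asIdeal
  have hsum : s = ∑ p, e p * s := by
    rw [← sub_eq_zero]
    refine eq_zero_of_localIdempotent_mul he fun p => ?_
    rw [mul_sub, Finset.mul_sum, Finset.sum_eq_single p, ← mul_assoc, (he p).idem, sub_self]
    · exact fun p' _ hne => (he p).mul_eq_zero_of_ne
        (fun h => hne (MaximalSpectrum.ext h).symm) fun x hx =>
          jacobianIdeal_mul 𝕏.affinePresentation_surjective (he p') hx hs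
    · simp
  rw [hsum]
  refine Submodule.sum_mem _ fun p _ => ?_
  by_cases h0 : e p * s = 0
  · rw [h0]; exact Submodule.zero_mem _
  have := p.isMaximal.isPrime
  obtain ⟨M, g, hM, hg, hgπ, hgen⟩ := exists_generatesAt 𝕏.affinePresentation_surjective
    (Ideal.mul_mem_left _ (e p) hs) h0
    fun x hx => jacobianIdeal_mul 𝕏.affinePresentation_surjective (he p) hx hs
  -- A nonzero component of an element of `J` forces a complete intersection point, hence by
  -- assumption a reduced one.
  have hci : p ∈ 𝕏.ciPoints := isRegular_of_generatesAt rfl hM hg hgπ hgen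
  have : IsReduced p.localRing := hred p hci
  exact 𝕏.localIdempotent_mul_mem_image hchar hn (he p)
    (fun x hx => (he p).mul_eq_zero_of_isReduced hx) hi s

end ZeroDimScheme

/-! ### Spans of consecutive powers -/

section PowerSpan

open Polynomial

variable {K S : Type*} [Field K] [CommRing S] [Algebra K S] (a x : S)

/-- The space spanned by `a`, `a x`, …, `a x ^ (c - 1)`. -/
noncomputable def powerSpan (K : Type*) {S : Type*} [Field K] [CommRing S] [Algebra K S]
    (a x : S) (c : ℕ) : Submodule K S :=
  Submodule.span K ((fun m => a * x ^ m) '' (Finset.range c : Set ℕ))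

variable {a x}

lemma mul_pow_mem_powerSpan {m c : ℕ} (h : m < c) : a * x ^ m ∈ powerSpan K a x c :=
  Submodule.subset_span ⟨m, by simpa using h, rfl⟩

lemma powerSpan_le {c : ℕ} {U : Submodule K S} (h : ∀ m < c, a * x ^ m ∈ U) :
    powerSpan K a x c ≤ U := by
  rw [powerSpan, Submodule.span_le]
  rintro _ ⟨m, hm, rfl⟩
  exact h m (by simpa using hm)

lemma powerSpan_mono {c d : ℕ} (h : c ≤ d) : powerSpan K a x c ≤ powerSpan K a x d :=
  powerSpan_le fun _ hm => mul_pow_mem_powerSpan (hm.trans_le h)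

lemma finrank_powerSpan_le (c : ℕ) : Module.finrank K (powerSpan K a x c) ≤ c := by
  classical
  rw [powerSpan, ← Finset.coe_image]
  exact (finrank_span_finset_le_card _).trans (Finset.card_image_le.trans (Finset.card_range c).le)

lemma mul_aeval_mem_powerSpan {q : K[X]} {c : ℕ} (hq : q.natDegree < c) :
    a * aeval x q ∈ powerSpan K a x c := by
  rw [aeval_eq_sum_range, Finset.mul_sum]
  refine Submodule.sum_mem _ fun m hm => ?_
  rw [mul_smul_comm]
  exact Submodule.smul_mem _ _ (mul_pow_mem_powerSpan (by rw [Finset.mem_range] at hm; omega))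

lemma le_finrank_powerSpan [Module.Finite K S] {J : Submodule K S} {N : ℕ}
    (hJ : powerSpan K a x N = J) (hle : ∀ c, powerSpan K a x c ≤ J) (c : ℕ) :
    c ≤ Module.finrank K (powerSpan K a x c) ∨ powerSpan K a x c = J := by
  induction c with
  | zero => exact Or.inl (Nat.zero_le _)
  | succ c ih =>
    rcases ih with ih | ih
    · by_cases h : powerSpan K a x (c + 1) = powerSpan K a x c
      · refine Or.inr ?_
        -- A span that does not grow in one step is stable under `x`, hence contains all `a * x ^ m`
        -- and equals `J`.
        have hx : ∀ w ∈ powerSpan K a x c, x * w ∈ powerSpan K a x c := by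
          have : powerSpan K a x c ≤ (powerSpan K a x c).comap (LinearMap.mulLeft K x) := by
            refine powerSpan_le fun m hm => ?_
            rw [Submodule.mem_comap, LinearMap.mulLeft_apply, ← h, mul_left_comm, ← pow_succ']
            exact mul_pow_mem_powerSpan (Nat.succ_lt_succ hm)
          exact this
        have hall : ∀ m, a * x ^ m ∈ powerSpan K a x c := by
          intro m
          induction m with
          | zero => rw [← h]; exact mul_pow_mem_powerSpan c.succ_pos
          | succ m ihm => rw [pow_succ', mul_left_comm]; exact hx _ ihm
        refine le_antisymm (hle _) ?_
        rw [h, ← hJ]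
        exact powerSpan_le fun m _ => hall m
      · left
        have := Submodule.finrank_lt_finrank_of_lt
          (lt_of_le_of_ne (powerSpan_mono (K := K) (a := a) (x := x) c.le_succ) (Ne.symm h))
        exact Nat.succ_le_of_lt (ih.trans_lt this)
    · exact Or.inr (le_antisymm (hle _) (ih ▸ powerSpan_mono c.le_succ))

end PowerSpan

/-! ### Polynomials in one variable -/

section Monogenic

open Polynomial

variable {K : Type*} [Field K]

lemma exists_aeval_X_zero_eq (g : MvPolynomial (Fin 1) K) : ∃ h : K[X],
    h.natDegree ≤ g.totalDegree ∧ aeval (MvPolynomial.X 0) h = g := by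
  refine ⟨MvPolynomial.aeval (fun _ => Polynomial.X) g, ?_, ?_⟩
  · simpa using MvPolynomial.aeval_natDegree_le g le_rfl (fun _ : Fin 1 => (Polynomial.X : K[X]))
      (n := 1) fun _ => natDegree_X_le
  · have : ((aeval (MvPolynomial.X 0 : MvPolynomial (Fin 1) K)).comp
        (MvPolynomial.aeval fun _ => (Polynomial.X : K[X]))) = AlgHom.id K _ := by
      ext i
      simp [Fin.fin_one_eq_zero i]
    exact congrArg (fun φ : MvPolynomial (Fin 1) K →ₐ[K] MvPolynomial (Fin 1) K => φ g) this

lemma totalDegree_aeval_X_zero_le (h : K[X]) :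
    (aeval (MvPolynomial.X 0 : MvPolynomial (Fin 1) K) h).totalDegree ≤ h.natDegree := by
  rw [aeval_eq_sum_range]
  refine (MvPolynomial.totalDegree_finsetSum _ _).trans (Finset.sup_le fun m hm => ?_)
  refine (MvPolynomial.totalDegree_smul_le _ _).trans ?_
  rw [MvPolynomial.totalDegree_X_pow]
  rw [Finset.mem_range] at hm
  omega

end Monogenic

/-! ### The projective line -/

namespace ZeroDimScheme

open MvPolynomial

attribute [local instance] MvPolynomial.gradedAlgebra

variable {K : Type*} [Field K] (𝕏 : ZeroDimScheme K 1)

lemma affinePresentation_aeval (h : Polynomial K) :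
    𝕏.affinePresentation (Polynomial.aeval (X 0) h) = Polynomial.aeval (𝕏.coord 0) h :=
  (Polynomial.aeval_algHom_apply 𝕏.affinePresentation (X 0) h).symm

lemma polyGrad_aeval (h : Polynomial K) (j : Fin 1) :
    polyGrad 𝕏.affinePresentation (Polynomial.aeval (X 0) h) j =
      Polynomial.aeval (𝕏.coord 0) (Polynomial.derivative h) := by
  rw [Fin.fin_one_eq_zero j, polyGrad, Derivation.map_aeval, pderiv_X_self, smul_eq_mul, mul_one,
    affinePresentation_aeval]

/-- The `d`-th step of the filtration consists of values of polynomials of degree at most `d`. It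
fills `S = K[x]` exactly when `x ^ (d + 1)` reduces to lower powers. -/
lemma natDegree_minpoly_coord : (minpoly K (𝕏.coord 0)).natDegree = 𝕏.reg + 1 := by
  have hint := Algebra.IsIntegral.isIntegral (R := K) (𝕏.coord 0)
  have hpos := minpoly.natDegree_pos hint
  refine le_antisymm ?_ ?_
  · obtain ⟨g, hg, hgx⟩ := 𝕏.exists_of_mem_filtr (s := 𝕏.coord 0 ^ (𝕏.reg + 1)) (d := 𝕏.reg)
      (by rw [filtr_reg]; trivial)
    obtain ⟨h, hh, rfl⟩ := exists_aeval_X_zero_eq g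
    rw [affinePresentation_aeval] at hgx
    have hdeg : h.natDegree < 𝕏.reg + 1 := by omega
    have hdeg' : h.degree < (𝕏.reg + 1 : ℕ) :=
      (Polynomial.degree_le_natDegree).trans_lt (by exact_mod_cast hdeg)
    have hmonic := Polynomial.monic_X_pow_sub (n := 𝕏.reg + 1) (p := h) hdeg'
    have := Polynomial.natDegree_le_of_dvd (minpoly.dvd K (𝕏.coord 0)
      (p := Polynomial.X ^ (𝕏.reg + 1) - h) (by simp [hgx])) hmonic.ne_zero
    refine this.trans ?_
    refine (Polynomial.natDegree_sub_le _ _).trans ?_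
    rw [Polynomial.natDegree_X_pow]
    omega
  · by_contra! hlt
    refine 𝕏.filtr_ne_top (d := (minpoly K (𝕏.coord 0)).natDegree - 1) (by omega)
      (eq_top_iff.2 fun s _ => ?_)
    obtain ⟨g, rfl⟩ := 𝕏.affinePresentation_surjective s
    obtain ⟨h, -, rfl⟩ := exists_aeval_X_zero_eq g
    rw [affinePresentation_aeval, ← Polynomial.aeval_modByMonic_eq_self_of_root (minpoly.aeval K _),
      ← affinePresentation_aeval]
    refine 𝕏.map_mem_filtr ?_
    have hne : minpoly K (𝕏.coord 0) ≠ 1 := minpoly.ne_one K _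
    have h1 := Polynomial.natDegree_modByMonic_lt h (minpoly.monic hint) hne
    exact (totalDegree_aeval_X_zero_le _).trans (by omega)

/-- The value at the coordinate of the derivative of its minimal polynomial. -/
noncomputable def different : 𝕏.S :=
  Polynomial.aeval (𝕏.coord 0) (Polynomial.derivative (minpoly K (𝕏.coord 0)))

/-- The characteristic assumption makes the derivative nonzero, and its degree is too small for it
to be a multiple of the minimal polynomial. -/
lemma different_ne_zero (hchar : ringChar K = 0 ∨ 𝕏.degree < ringChar K) : 𝕏.different ≠ 0 := by
  have hint := Algebra.IsIntegral.isIntegral (R := K) (𝕏.coord 0)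
  have hpos := minpoly.natDegree_pos hint
  have h := derivative_ne_zero_of_lt_ringChar (minpoly.monic hint) hpos (minpoly.natDegree_le _)
    hchar
  intro h0
  have h1 := Polynomial.natDegree_le_of_dvd (minpoly.dvd K _ h0) h
  have h2 := Polynomial.natDegree_derivative_lt hpos.ne'
  omega

/-- A relation is `μ q` with derivative `μ'(x) q(x)` in `S`, and `q` has degree at most `i - reg`.
For `i < reg` only `q = 0` remains and the truncated bound `i + 1 - reg` is `0`. -/
lemma polyGrad_mem_powerSpan {g : MvPolynomial (Fin 1) K} (hg : 𝕏.affinePresentation g = 0)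
    {i : ℕ} (hd : g.totalDegree ≤ i + 1) (j : Fin 1) :
    polyGrad 𝕏.affinePresentation g j ∈
      powerSpan K 𝕏.different (𝕏.coord 0) (i + 1 - 𝕏.reg) := by
  obtain ⟨h, hh, rfl⟩ := exists_aeval_X_zero_eq g
  rw [affinePresentation_aeval] at hg
  rw [polyGrad_aeval]
  obtain ⟨q, rfl⟩ := minpoly.dvd K _ hg
  rw [Polynomial.derivative_mul, map_add, map_mul, map_mul, minpoly.aeval, zero_mul, add_zero]
  by_cases hq : q = 0
  · rw [hq, map_zero, mul_zero]; exact Submodule.zero_mem _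
  refine mul_aeval_mem_powerSpan ?_
  rw [Polynomial.natDegree_mul (minpoly.ne_zero_of_finite K _) hq, natDegree_minpoly_coord] at hh
  omega

lemma toS_mul_mem_powerSpan {a : 𝕏.S} {j c d : ℕ} {C : MvPolynomial (Fin 2) K}
    (hC : C.IsHomogeneous j) {s : 𝕏.S} (hs : s ∈ powerSpan K a (𝕏.coord 0) c) (hd : 0 < c → j + c ≤ d) :
    𝕏.toS C * s ∈ powerSpan K a (𝕏.coord 0) d := by
  obtain ⟨h, hh, hC'⟩ := exists_aeval_X_zero_eq (dehom C)
  have hdeg : h.natDegree ≤ j := hh.trans (totalDegree_dehom_le hC)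
  rw [toS_eq, ← hC', affinePresentation_aeval]
  have : powerSpan K a (𝕏.coord 0) c ≤ (powerSpan K a (𝕏.coord 0) d).comap
      (LinearMap.mulLeft K (Polynomial.aeval (𝕏.coord 0) h)) := by
    refine powerSpan_le fun m hm => ?_
    rw [Submodule.mem_comap, LinearMap.mulLeft_apply, mul_left_comm]
    have h1 : Polynomial.aeval (𝕏.coord 0) h * 𝕏.coord 0 ^ m =
        Polynomial.aeval (𝕏.coord 0) (h * Polynomial.X ^ m) := by simp
    rw [h1]
    refine mul_aeval_mem_powerSpan ?_
    have h2 := Polynomial.natDegree_mul_le (p := h) (q := Polynomial.X ^ m)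
    rw [Polynomial.natDegree_X_pow] at h2
    have h3 := hd (Nat.zero_lt_of_lt hm)
    omega
  exact this hs

/-- The generators of `ϑ` come from arbitrary relations, so the induction runs over all elements and
tracks the homogeneous components of every lift. -/
lemma toS_homogeneousComponent_mem_powerSpan {u : 𝕏.R} (hu : u ∈ 𝕏.kaehlerDifferent)
    {F : MvPolynomial (Fin 2) K} (hF : 𝕏.toR F = u) (i : ℕ) :
    𝕏.toS (homogeneousComponent i F) ∈
      powerSpan K 𝕏.different (𝕏.coord 0) (i + 1 - 𝕏.reg) := by
  have hI : ∀ {G : MvPolynomial (Fin 2) K}, 𝕏.toR G = 0 → ∀ i,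
      𝕏.toS (homogeneousComponent i G) = 0 := by
    intro G hG i
    rw [toS_apply, 𝕏.toR_eq_zero_iff.2 (homogeneousComponent_mem_of_mem 𝕏.homogeneous
      (𝕏.toR_eq_zero_iff.1 hG) i), map_zero]
  have hcongr : ∀ {G H : MvPolynomial (Fin 2) K}, 𝕏.toR G = 𝕏.toR H → ∀ i,
      𝕏.toS (homogeneousComponent i G) = 𝕏.toS (homogeneousComponent i H) := by
    intro G H h i
    have := hI (G := G - H) (by rw [map_sub, h, sub_self]) i
    rwa [map_sub, map_sub, sub_eq_zero] at this
  rw [kaehlerDifferent_eq, minorIdeal] at hu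
  induction hu using Submodule.span_induction generalizing F i with
  | mem u hu =>
    obtain ⟨v, hv, rfl⟩ := hu
    obtain ⟨f, hf, hvf⟩ := hv 0
    rw [Matrix.det_fin_one, Matrix.of_apply, hvf, tailGrad] at hF
    rw [hcongr hF, ← sum_homogeneousComponent f, map_sum, map_sum, map_sum]
    refine Submodule.sum_mem _ fun j _ => ?_
    have hj := homogeneousComponent_isHomogeneous j f
    rw [homogeneousComponent_of_mem (hj.pderiv (i := Fin.succ 0))]
    split_ifs with hij
    · rw [toS_eq, ← pderiv_dehom]
      refine 𝕏.polyGrad_mem_powerSpan (g := dehom (homogeneousComponent j f)) ?_ ?_ 0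
      · rw [← toS_eq]; exact hI hf j
      · exact (totalDegree_dehom_le hj).trans (by omega)
    · rw [map_zero]; exact Submodule.zero_mem _
  | zero => rw [hI hF]; exact Submodule.zero_mem _
  | add u w _ _ ihu ihw =>
    obtain ⟨G, rfl⟩ := 𝕏.toR_surjective u
    obtain ⟨H, rfl⟩ := 𝕏.toR_surjective w
    rw [← map_add] at hF
    rw [hcongr hF, map_add, map_add]
    exact Submodule.add_mem _ (ihu rfl i) (ihw rfl i)
  | smul c u _ ihu =>
    obtain ⟨C, rfl⟩ := 𝕏.toR_surjective c
    obtain ⟨G, rfl⟩ := 𝕏.toR_surjective u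
    rw [smul_eq_mul, ← map_mul] at hF
    rw [hcongr hF]
    rw [← sum_homogeneousComponent C, ← sum_homogeneousComponent G, Finset.sum_mul_sum, map_sum, map_sum]
    refine Submodule.sum_mem _ fun j _ => ?_
    rw [map_sum, map_sum]
    refine Submodule.sum_mem _ fun k _ => ?_
    have hj := homogeneousComponent_isHomogeneous j C
    rw [homogeneousComponent_of_mem (hj.mul (homogeneousComponent_isHomogeneous k G))]
    split_ifs with hij
    · rw [map_mul]
      exact 𝕏.toS_mul_mem_powerSpan hj (ihu rfl k) fun _ => by omega
    · rw [map_zero]; exact Submodule.zero_mem _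

lemma image_eq_powerSpan (i : ℕ) : 𝕏.image 𝕏.kaehlerDifferent i =
    powerSpan K 𝕏.different (𝕏.coord 0) (i + 1 - 𝕏.reg) := by
  refine le_antisymm (fun s hs => ?_) (powerSpan_le fun m hm => ?_)
  · obtain ⟨F, hF, hu, rfl⟩ := 𝕏.mem_image.1 hs
    have := 𝕏.toS_homogeneousComponent_mem_powerSpan hu rfl i
    rwa [homogeneousComponent_of_mem hF, if_pos rfl] at this
  · obtain ⟨k, rfl⟩ := Nat.exists_eq_add_of_le (show 𝕏.reg ≤ i by omega)
    let g : MvPolynomial (Fin 1) K := Polynomial.aeval (X 0) (minpoly K (𝕏.coord 0))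
    have hg : 𝕏.affinePresentation g = 0 := by rw [affinePresentation_aeval, minpoly.aeval]
    have hd : g.totalDegree ≤ 𝕏.reg + 1 := by
      rw [← natDegree_minpoly_coord]
      exact totalDegree_aeval_X_zero_le _
    have hs : 𝕏.coord 0 ^ m ∈ 𝕏.filtr k := by
      rw [coord, ← map_pow]
      exact 𝕏.map_mem_filtr (by rw [totalDegree_X_pow]; omega)
    have h1 := 𝕏.mul_det_mem_image (f := fun _ => g) (fun _ => hg) (fun _ => hd) hs
    rwa [one_mul, Matrix.det_fin_one, Matrix.of_apply, polyGrad_aeval, mul_comm] at h1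

lemma finrank_image_kaehlerDifferent {i : ℕ}
    (hi : 𝕏.reg + Module.finrank K ((jacobianIdeal 𝕏.affinePresentation).restrictScalars K) ≤
      i + 1) :
    Module.finrank K (𝕏.image 𝕏.kaehlerDifferent i) =
      Module.finrank K ((jacobianIdeal 𝕏.affinePresentation).restrictScalars K) := by
  have hle : ∀ c, powerSpan K 𝕏.different (𝕏.coord 0) c ≤
      (jacobianIdeal 𝕏.affinePresentation).restrictScalars K := by
    intro c
    have := 𝕏.image_le_jacobianIdeal ((𝕏.reg + c : ℕ) : ℤ)
    rw [image_eq_powerSpan] at this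
    exact (powerSpan_mono (by omega)).trans this
  -- In degree `2 * reg` the general bound already gives `J`, and there the number of powers is `2 *
  -- reg + 1 - reg`.
  have hJ : powerSpan K 𝕏.different (𝕏.coord 0) (𝕏.reg + 1) =
      (jacobianIdeal 𝕏.affinePresentation).restrictScalars K := by
    rw [← 𝕏.image_eq_jacobianIdeal_of_le (i := ((2 * 𝕏.reg : ℕ) : ℤ)) (by push_cast; linarith),
      image_eq_powerSpan]
    congr 1
    omega
  rw [image_eq_powerSpan]
  rcases le_finrank_powerSpan hJ hle (i + 1 - 𝕏.reg) with h | h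
  · exact le_antisymm (Submodule.finrank_mono (hle _)) (by omega)
  · rw [h]

lemma finrank_jacobianIdeal_pos (hchar : ringChar K = 0 ∨ 𝕏.degree < ringChar K) :
    0 < Module.finrank K ((jacobianIdeal 𝕏.affinePresentation).restrictScalars K) := by
  have h1 : 𝕏.different ∈ (jacobianIdeal 𝕏.affinePresentation).restrictScalars K := by
    refine 𝕏.image_le_jacobianIdeal (𝕏.reg : ℤ) ?_
    rw [image_eq_powerSpan, Nat.add_sub_cancel_left]
    have := mul_pow_mem_powerSpan (K := K) (a := 𝕏.different) (x := 𝕏.coord 0) one_pos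
    rwa [pow_zero, mul_one] at this
  rw [Module.finrank_pos_iff, Submodule.nontrivial_iff_ne_bot]
  intro h
  rw [h] at h1
  exact 𝕏.different_ne_zero hchar h1

end ZeroDimScheme

theorem proposition2p8 {K : Type*} [Field K] {n : ℕ} (𝕏 : ZeroDimScheme K n)
    (hchar : ringChar K = 0 ∨ 𝕏.degree < ringChar K) :
    𝕏.ciPoints.Finite ∧
    IsHilbertPolynomial (𝕏.hilbertFunction 𝕏.kaehlerDifferent)
      (Polynomial.C ((∑ᶠ p ∈ 𝕏.ciPoints, p.kappa : ℕ) : ℚ)) ∧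
    ∃ (r : ℤ) (ρ : WithBot ℤ),
      IsRegularityIndex (𝕏.hilbertFunction ⊤) r ∧
      IsRegularityIndex (𝕏.hilbertFunction 𝕏.kaehlerDifferent) ρ ∧
      ρ ≤ (((n + 1) * r : ℤ) : WithBot ℤ) ∧
      (n = 1 → ρ = ((r + (∑ᶠ p ∈ 𝕏.ciPoints, p.kappa : ℕ) - 1 : ℤ) : WithBot ℤ)) ∧
      (2 ≤ n → (∀ p ∈ 𝕏.ciPoints, p.Reduced) → ρ ≤ ((n * r : ℤ) : WithBot ℤ)) := by
  rw [← 𝕏.finrank_jacobianIdeal_eq hchar]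
  set c := Module.finrank K ((jacobianIdeal 𝕏.affinePresentation).restrictScalars K) with hc
  have hconst : ∀ i : ℤ, ((n + 1) * 𝕏.reg : ℤ) ≤ i →
      𝕏.hilbertFunction 𝕏.kaehlerDifferent i = c := fun i hi => by
    rw [ZeroDimScheme.hilbertFunction_eq, 𝕏.image_eq_jacobianIdeal_of_le hi]
  obtain ⟨ρ, hρ, hle, heq⟩ := exists_isRegularityIndex hconst
  refine ⟨𝕏.finite_ciPoints, isHilbertPolynomial_const hconst, 𝕏.reg, ρ,
    𝕏.isRegularityIndex_reg, hρ, hle _ hconst, ?_, fun hn hred => hle _ fun i hi => ?_⟩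
  · rintro rfl
    -- Positivity of `c` makes the claimed index nonnegative and the Hilbert function nonconstant,
    -- which excludes the value `⊥`.
    have hpos := 𝕏.finrank_jacobianIdeal_pos hchar
    refine heq _ (fun i hi => ?_) ?_
    · obtain ⟨k, rfl⟩ := Int.eq_ofNat_of_zero_le (show 0 ≤ i by omega)
      rw [ZeroDimScheme.hilbertFunction_eq]
      exact 𝕏.finrank_image_kaehlerDifferent (by omega)
    · rw [ZeroDimScheme.hilbertFunction_eq]
      rcases lt_or_ge ((𝕏.reg : ℤ) + c - 1 - 1) 0 with h | h
      · rw [𝕏.image_of_neg _ h, finrank_bot]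
        exact hpos.ne
      -- One degree earlier at most `c - 1` powers are available, so the dimension is still too
      -- small.
      · obtain ⟨k, hk⟩ := Int.eq_ofNat_of_zero_le h
        rw [hk, 𝕏.image_eq_powerSpan]
        have := finrank_powerSpan_le (K := K) (a := 𝕏.different) (x := 𝕏.coord 0)
          (k + 1 - 𝕏.reg)
        omega
  · rw [ZeroDimScheme.hilbertFunction_eq, 𝕏.image_eq_jacobianIdeal_of_reduced hchar hn hred hi]
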